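/- Let $k$ be a field. A $\mathbb Z$-graded $k$-algebra $A=\bigoplus_{n}A_n$ is connected if $A_n=0$ for $n<0$ and $A_0=k$; put $A_{\ge 1}=\bigoplus_{n\ge1}A_n$ and let $k\cong A/A_{\ge1}$ be the trivial left module. A connected graded algebra $A$ is called AS-regular of dimension $d\in\mathbb N$ if $A$ has global dimension $d$, $\operatorname{Ext}^i_A(k,A)=0$ for $i\ne d$, and $\operatorname{Ext}^d_A(k,A)\cong k$. Let $H=\bigoplus_{n\in\mathbb Z}H_n$ be a graded Hopf algebra over $k$ (its algebra structure, coalgebra structure and antipode are graded) with bijective antipode. Let $A$ and $B$ be AS-regular algebras of dimensions $d_1$ and $d_2$. Let $A$ be an $H$-module graded algebra, that is, a left $H$-module algebra with $H_m\rightharpoonup A_n\subseteq A_{m+n}$ for all $m,n$, and let $B$ be an $H$-comodule graded algebra, that is, a left $H$-comodule algebra with coaction $\rho\colon B\to H\otimes B$, $\rho(b)=\sum b_{-1}\otimes b_0$, such that $\rho(B_n)\subseteq\bigoplus_i H_i\otimes B_{n-i}$ for all $n$. Suppose that $H\rightharpoonup A_{\ge1}\subseteq A_{\ge1}$ or $\rho(B_{\ge1})\subseteq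 H\otimes B_{\ge1}$. Then the Takeuchi smash product $A\#B$, which is the space $A\otimes B$ with multiplication $$(a\#b)(a'\#b')=\sum a(b_{-1}\rightharpoonup a')\#b_0b'$$ and grading $(A\#B)_n=\bigoplus_iA_i\otimes B_{n-i}$, is AS-regular of dimension $d_1+d_2$. In particular, graded Ore extensions preserve AS-regularity: if $A$ is AS-regular of dimension $d$, $\sigma$ is a $k$-algebra automorphism of $A$ with $\sigma(A_n)\subseteq A_n$, and $\delta\colon A\to A$ is a $k$-linear $\sigma$-derivation ($\delta(ab)=\sigma(a)\delta(b)+\delta(a)b$) with $\delta(A_n)\subseteq A_{n+1}$ for all $n$, then the Ore extension $A[x;\sigma,\delta]$ (polynomials $\sum_i a_ix^i$ multiplied by the rule $xa=\sigma(a)x+\delta(a)$), graded with $\deg x=1$, is AS-regular of dimension $d+1$. -/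

import Mathlib

open scoped TensorProduct
open CategoryTheory

universe u

noncomputable section

/-! ## Gradings -/

section Gradings

variable {k : Type u} [Field k]

/-- The family `𝒜` of subspaces makes `A` a `ℤ`-graded algebra: `1 ∈ A₀`, `Aₘ Aₙ ⊆ Aₘ₊ₙ`, and
`A = ⨁ₙ Aₙ` (internal direct sum). -/
structure IsGradedAlgebra {A : Type u} [Ring A] [Algebra k A] (𝒜 : ℤ → Submodule k A) :
    Prop where
  gradedMonoid : SetLike.GradedMonoid 𝒜
  isInternal : DirectSum.IsInternal 𝒜

/-- `A` is connected graded: `A` is graded, `A₍<₀₎ = 0` and `A₀ = k` (that is, `A ≠ 0`, so that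
`k → A` is injective, and its image is `A₀`). -/
structure IsConnectedGraded {A : Type u} [Ring A] [Algebra k A] (𝒜 : ℤ → Submodule k A) :
    Prop where
  isGraded : IsGradedAlgebra 𝒜
  neg_eq_bot : ∀ n : ℤ, n < 0 → 𝒜 n = ⊥
  nontrivial : Nontrivial A
  zero_eq : 𝒜 0 = LinearMap.range (Algebra.linearMap k A)

/-- `V_{≥ 1} = ⨁_{n ≥ 1} Vₙ`. -/
def geOne {V : Type u} [AddCommGroup V] [Module k V] (𝒱 : ℤ → Submodule k V) : Submodule k V :=
  ⨆ (n : ℤ) (_ : 1 ≤ n), 𝒱 n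

/-- The tensor product grading `(V ⊗ W)ₙ = ⨁ᵢ Vᵢ ⊗ Wₙ₋ᵢ`. -/
def tensorGrading {V W : Type u} [AddCommGroup V] [Module k V] [AddCommGroup W] [Module k W]
    (𝒱 : ℤ → Submodule k V) (𝒲 : ℤ → Submodule k W) (n : ℤ) : Submodule k (V ⊗[k] W) :=
  ⨆ i : ℤ, LinearMap.range (TensorProduct.map (𝒱 i).subtype (𝒲 (n - i)).subtype)

end Gradings

/-! ## Artin-Schelter regular algebras -/

section ASRegular

/-- The (left) global dimension of a ring: the supremum of the projective dimensions of all left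
modules. For connected graded algebras it agrees with the right global dimension. -/
def globalDimension (R : Type u) [Ring R] : WithBot ℕ∞ :=
  ⨆ M : ModuleCat.{u} R, projectiveDimension M

variable {k : Type u} [Field k] {A : Type u} [Ring A] [Algebra k A]

/-- The trivial left module `k ≅ A / A_{≥ 1}` of a connected graded algebra. For such an algebra
`A_{≥ 1}` is an ideal, so it equals the left ideal that it generates. -/
def trivialModule (𝒜 : ℤ → Submodule k A) : ModuleCat.{u} A :=
  ModuleCat.of A (A ⧸ Ideal.span (geOne 𝒜 : Set A))

/-- Artin-Schelter regular algebras of dimension `d`: connected graded, of global dimension `d`,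
with `Ext^i_A(k, A) = 0` for `i ≠ d` and `Ext^d_A(k, A) ≅ k`. -/
structure IsASRegular (𝒜 : ℤ → Submodule k A) (d : ℕ) : Prop where
  connected : IsConnectedGraded 𝒜
  globalDimension_eq : globalDimension A = d
  ext_eq_zero : ∀ i : ℕ, i ≠ d →
    Subsingleton (Abelian.Ext (trivialModule 𝒜) (ModuleCat.of A A) i)
  ext_equiv : Nonempty (Abelian.Ext (trivialModule 𝒜) (ModuleCat.of A A) d ≃ₗ[k] k)

end ASRegular

/-! ## Hopf module algebras and Hopf comodule algebras -/

section HopfActions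

variable (k H A B : Type u) [Field k] [Ring H] [HopfAlgebra k H] [Ring A] [Algebra k A]
  [Ring B] [Algebra k B]

variable {A} in
/-- For `a` in a left `H`-module, the linear map `H → A`, `h ↦ h ⇀ a`. -/
def actOn [Module H A] [IsScalarTower k H A] (a : A) : H →ₗ[k] A :=
  (Algebra.lsmul k k A : H →ₐ[k] Module.End k A).toLinearMap.flip a

/-- `A` is a left `H`-module algebra: `h ⇀ 1 = ε(h) 1` and
`h ⇀ (a b) = ∑ (h₁ ⇀ a) (h₂ ⇀ b)`. -/
class IsHopfModuleAlgebra [Module H A] [IsScalarTower k H A] : Prop where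
  smul_one : ∀ h : H, h • (1 : A) = algebraMap k A (Coalgebra.counit h)
  smul_mul : ∀ (h : H) (a b : A), h • (a * b) =
    LinearMap.mul' k A (TensorProduct.map (actOn k H a) (actOn k H b) (Coalgebra.comul h))

/-- `B` is a left `H`-comodule algebra: it carries a coassociative and counital coaction
`ρ : B → H ⊗ B`, `ρ(b) = ∑ b₋₁ ⊗ b₀`, which is an algebra homomorphism. -/
class HopfComoduleAlgebra where
  coaction : B →ₐ[k] H ⊗[k] B
  coassoc : ∀ b : B,
    TensorProduct.assoc k H H B
        (LinearMap.rTensor B (Coalgebra.comul : H →ₗ[k] H ⊗[k] H) (coaction b)) =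
      LinearMap.lTensor H coaction.toLinearMap (coaction b)
  counit_coaction : ∀ b : B,
    TensorProduct.lid k B (LinearMap.rTensor B (Coalgebra.counit : H →ₗ[k] k) (coaction b)) = b

variable {k H A B}

/-- `H` is a graded Hopf algebra: its algebra structure, its coalgebra structure and its antipode
are graded. -/
structure IsGradedHopfAlgebra (ℋ : ℤ → Submodule k H) : Prop where
  isGraded : IsGradedAlgebra ℋ
  comul_mem : ∀ (n : ℤ), ∀ h ∈ ℋ n, Coalgebra.comul (R := k) h ∈ tensorGrading ℋ ℋ n
  counit_eq_zero : ∀ (n : ℤ), n ≠ 0 → ∀ h ∈ ℋ n, Coalgebra.counit (R := k) h = 0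
  antipode_mem : ∀ (n : ℤ), ∀ h ∈ ℋ n, HopfAlgebra.antipode k h ∈ ℋ n

/-- The graded algebra and `H`-module algebra `A` is an `H`-module graded algebra:
`Hₘ ⇀ Aₙ ⊆ Aₘ₊ₙ`. -/
structure IsModuleGradedAlgebra [Module H A] [IsScalarTower k H A] [IsHopfModuleAlgebra k H A]
    (ℋ : ℤ → Submodule k H) (𝒜 : ℤ → Submodule k A) : Prop where
  isGraded : IsGradedAlgebra 𝒜
  smul_mem : ∀ (m n : ℤ), ∀ h ∈ ℋ m, ∀ a ∈ 𝒜 n, h • a ∈ 𝒜 (m + n)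

/-- The graded algebra `B`, with an `H`-comodule algebra structure `ρ`, is an `H`-comodule graded
algebra: `ρ(Bₙ) ⊆ ⨁ᵢ Hᵢ ⊗ Bₙ₋ᵢ`. -/
structure IsComoduleGradedAlgebra [HopfComoduleAlgebra k H B]
    (ℋ : ℤ → Submodule k H) (ℬ : ℤ → Submodule k B) : Prop where
  isGraded : IsGradedAlgebra ℬ
  coaction_mem : ∀ (n : ℤ), ∀ b ∈ ℬ n,
    (HopfComoduleAlgebra.coaction b : H ⊗[k] B) ∈ tensorGrading ℋ ℬ n

end HopfActions

/-! ## The Takeuchi smash product -/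

section Takeuchi

variable (k H A B : Type u) [Field k] [Ring H] [HopfAlgebra k H] [Ring A] [Algebra k A]
  [Ring B] [Algebra k B] [Module H A] [IsScalarTower k H A]

/-- The Takeuchi smash product `A # B`, with underlying space `A ⊗ B` and multiplication
`(a # b) (a' # b') = ∑ a (b₋₁ ⇀ a') # b₀ b'`. -/
def TakeuchiSmash [IsHopfModuleAlgebra k H A] [HopfComoduleAlgebra k H B] : Type u := A ⊗[k] B

namespace TakeuchiSmash

/-- The algebra map `H ⊗ B → End(A ⊗ B)` for which `h ⊗ b` sends `a' ⊗ b'` to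
`(h ⇀ a') ⊗ b b'`. -/
def hopfOp : H ⊗[k] B →ₐ[k] Module.End k (A ⊗[k] B) :=
  (Module.endTensorEndAlgHom (R := k) (A := k) (M := A) (N := B)).comp
    (Algebra.TensorProduct.map (Algebra.lsmul k k A : H →ₐ[k] Module.End k A)
      (Algebra.lmul k B))

/-- Left multiplication by `1 # b` : `a' ⊗ b' ↦ ∑ (b₋₁ ⇀ a') ⊗ b₀ b'`. -/
def opB [HopfComoduleAlgebra k H B] : B →ₐ[k] Module.End k (A ⊗[k] B) :=
  (hopfOp k H A B).comp HopfComoduleAlgebra.coaction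

/-- Left multiplication by `a # 1` : `a' ⊗ b' ↦ a a' ⊗ b'`. -/
def opA : A →ₐ[k] Module.End k (A ⊗[k] B) :=
  (Module.endTensorEndAlgHom (R := k) (A := k) (M := A) (N := B)).comp
    ((Algebra.TensorProduct.includeLeft).comp (Algebra.lmul k A))

/-- Left multiplication by `a # b` : `a' ⊗ b' ↦ ∑ a (b₋₁ ⇀ a') ⊗ b₀ b'`. -/
def op [HopfComoduleAlgebra k H B] : A ⊗[k] B →ₗ[k] Module.End k (A ⊗[k] B) :=
  TensorProduct.lift
    ((LinearMap.mul k (Module.End k (A ⊗[k] B))).compl₁₂ (opA k A B).toLinearMap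
      (opB k H A B).toLinearMap)

variable {k H A B}

@[simp] theorem hopfOp_tmul (h : H) (b : B) (a' : A) (b' : B) :
    hopfOp k H A B (h ⊗ₜ b) (a' ⊗ₜ b') = (h • a') ⊗ₜ (b * b') := by
  simp [hopfOp, Module.endTensorEndAlgHom_apply]

@[simp] theorem opA_tmul (a a' : A) (b' : B) :
    opA k A B a (a' ⊗ₜ b') = (a * a') ⊗ₜ b' := by
  simp [opA, Module.endTensorEndAlgHom_apply]

@[simp] theorem op_tmul [HopfComoduleAlgebra k H B] (a : A) (b : B) :
    op k H A B (a ⊗ₜ b) = opA k A B a * opB k H A B b := by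
  simp [op]

theorem opB_apply_eq [HopfComoduleAlgebra k H B] (b : B) (x : A ⊗[k] B) :
    opB k H A B b x = hopfOp k H A B (HopfComoduleAlgebra.coaction b) x := rfl

theorem actOn_apply (a : A) (h : H) : actOn k H a h = h • a := rfl

theorem opB_mul_opA [IsHopfModuleAlgebra k H A] [HopfComoduleAlgebra k H B] (b : B) (a : A) :
    opB k H A B b * opA k A B a =
      op k H A B ((TensorProduct.map (actOn k H a) LinearMap.id)
        (HopfComoduleAlgebra.coaction b)) := by
  ext x y
  have key : ∀ t : H ⊗[k] B, hopfOp k H A B t ((a * x) ⊗ₜ y) =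
      (TensorProduct.map ((LinearMap.mul' k A) ∘ₗ
        (TensorProduct.map (actOn k H a) (actOn k H x))) (LinearMap.mulRight k y))
        (LinearMap.rTensor B (Coalgebra.comul : H →ₗ[k] H ⊗[k] H) t) := by
    intro t
    induction t with
    | zero => simp
    | add s t hs ht => simp only [map_add, LinearMap.add_apply, hs, ht]
    | tmul h c => simp [IsHopfModuleAlgebra.smul_mul (k := k)]
  have key2 : ∀ t : H ⊗[k] B, op k H A B ((TensorProduct.map (actOn k H a) LinearMap.id) t)
        (x ⊗ₜ y) =
      (TensorProduct.map ((LinearMap.mul' k A) ∘ₗ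
        (TensorProduct.map (actOn k H a) (actOn k H x))) (LinearMap.mulRight k y))
        ((TensorProduct.assoc k H H B).symm
          (LinearMap.lTensor H (HopfComoduleAlgebra.coaction : B →ₐ[k] H ⊗[k] B).toLinearMap
            t)) := by
    intro t
    induction t with
    | zero => simp
    | add s t hs ht => simp only [map_add, LinearMap.add_apply, hs, ht]
    | tmul h c =>
      simp only [TensorProduct.map_tmul, LinearMap.id_coe, id_eq, op_tmul, Module.End.mul_apply,
        opB_apply_eq, LinearMap.lTensor_tmul, AlgHom.toLinearMap_apply]
      generalize (HopfComoduleAlgebra.coaction c : H ⊗[k] B) = s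
      induction s with
      | zero => simp
      | add s t hs ht =>
        simp only [map_add, LinearMap.add_apply, TensorProduct.tmul_add, hs, ht]
      | tmul h' c' => simp [actOn_apply]
  simp only [TensorProduct.AlgebraTensorModule.curry_apply, LinearMap.restrictScalars_self,
    TensorProduct.curry_apply, Module.End.mul_apply, opA_tmul, opB_apply_eq]
  rw [key, key2, ← HopfComoduleAlgebra.coassoc, LinearEquiv.symm_apply_apply]

theorem op_opA (a : A) [HopfComoduleAlgebra k H B] (x : A ⊗[k] B) :
    op k H A B (opA k A B a x) = opA k A B a * op k H A B x := by
  induction x with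
  | zero => simp
  | add s t hs ht => simp only [map_add, mul_add, hs, ht]
  | tmul a' b' => simp [mul_assoc]

theorem op_opB [IsHopfModuleAlgebra k H A] [HopfComoduleAlgebra k H B] (b : B) (x : A ⊗[k] B) :
    op k H A B (opB k H A B b x) = opB k H A B b * op k H A B x := by
  induction x with
  | zero => simp
  | add s t hs ht => simp only [map_add, mul_add, hs, ht]
  | tmul a' b' =>
    rw [op_tmul, ← mul_assoc, opB_mul_opA, opB_apply_eq]
    generalize (HopfComoduleAlgebra.coaction b : H ⊗[k] B) = s
    induction s with
    | zero => simp
    | add s t hs ht => simp only [map_add, LinearMap.add_apply, add_mul, hs, ht]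
    | tmul h c => simp [actOn_apply, mul_assoc]

theorem op_op [IsHopfModuleAlgebra k H A] [HopfComoduleAlgebra k H B] (x y : A ⊗[k] B) :
    op k H A B (op k H A B x y) = op k H A B x * op k H A B y := by
  induction x with
  | zero => simp
  | add s t hs ht => simp only [map_add, LinearMap.add_apply, add_mul, hs, ht]
  | tmul a b => rw [op_tmul, Module.End.mul_apply, op_opA, op_opB, mul_assoc]

theorem op_one [HopfComoduleAlgebra k H B] : op k H A B (1 ⊗ₜ 1) = 1 := by
  simp

theorem op_apply_one [IsHopfModuleAlgebra k H A] [HopfComoduleAlgebra k H B] (x : A ⊗[k] B) :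
    op k H A B x (1 ⊗ₜ 1) = x := by
  induction x with
  | zero => simp
  | add s t hs ht => simp only [map_add, LinearMap.add_apply, hs, ht]
  | tmul a b =>
    have key : ∀ t : H ⊗[k] B, hopfOp k H A B t ((1 : A) ⊗ₜ (1 : B)) =
        1 ⊗ₜ TensorProduct.lid k B
          (LinearMap.rTensor B (Coalgebra.counit : H →ₗ[k] k) t) := by
      intro t
      induction t with
      | zero => simp
      | add s t hs ht => simp only [map_add, LinearMap.add_apply, TensorProduct.tmul_add, hs, ht]
      | tmul h c =>
        simp [IsHopfModuleAlgebra.smul_one (k := k), Algebra.algebraMap_eq_smul_one,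
          TensorProduct.smul_tmul]
    rw [op_tmul, Module.End.mul_apply, opB_apply_eq, key, HopfComoduleAlgebra.counit_coaction]
    simp

variable [IsHopfModuleAlgebra k H A] [HopfComoduleAlgebra k H B]

instance : AddCommGroup (TakeuchiSmash k H A B) := inferInstanceAs (AddCommGroup (A ⊗[k] B))

instance : Module k (TakeuchiSmash k H A B) := inferInstanceAs (Module k (A ⊗[k] B))

instance : Ring (TakeuchiSmash k H A B) where
  __ := (inferInstance : AddCommGroup (TakeuchiSmash k H A B))
  mul x y := op k H A B x y
  one := ((1 : A) ⊗ₜ[k] (1 : B) : A ⊗[k] B)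
  left_distrib x y z := map_add (op k H A B x) y z
  right_distrib x y z := LinearMap.congr_fun (map_add (op k H A B) x y) z
  zero_mul x := LinearMap.congr_fun (map_zero (op k H A B)) x
  mul_zero x := map_zero (op k H A B x)
  mul_assoc x y z := LinearMap.congr_fun (op_op x y) z
  one_mul x := LinearMap.congr_fun op_one x
  mul_one x := op_apply_one x

instance : Algebra k (TakeuchiSmash k H A B) :=
  Algebra.ofModule
    (fun r x y => LinearMap.congr_fun (map_smul (op k H A B) r x) y)
    (fun r x y => map_smul (op k H A B x) r y)

variable (k H) in
/-- The element `a # b` of `A # B`. -/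
def mk (a : A) (b : B) : TakeuchiSmash k H A B := (a ⊗ₜ[k] b : A ⊗[k] B)

variable (k H) in
/-- The multiplication of `A # B`: if `ρ(b) = ∑ᵢ hᵢ ⊗ bᵢ`, then
`(a # b) (a' # b') = ∑ᵢ a (hᵢ ⇀ a') # bᵢ b'`. -/
theorem mk_mul_mk {ι : Type*} (s : Finset ι) (h : ι → H) (c : ι → B) (a a' : A) (b b' : B)
    (hb : HopfComoduleAlgebra.coaction b = ∑ i ∈ s, h i ⊗ₜ[k] c i) :
    mk k H a b * mk k H a' b' = ∑ i ∈ s, mk k H (a * (h i • a')) (c i * b') := by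
  change op k H A B (a ⊗ₜ b) (a' ⊗ₜ b') = ∑ i ∈ s, (a * (h i • a')) ⊗ₜ[k] (c i * b')
  rw [op_tmul, Module.End.mul_apply, opB_apply_eq, hb]
  simp [LinearMap.sum_apply]

/-- The grading of `A # B`: `(A # B)ₙ = ⨁ᵢ Aᵢ ⊗ Bₙ₋ᵢ`. -/
def grading (𝒜 : ℤ → Submodule k A) (ℬ : ℤ → Submodule k B) :
    ℤ → Submodule k (TakeuchiSmash k H A B) :=
  tensorGrading 𝒜 ℬ

end TakeuchiSmash
end Takeuchi

/-! ## Ore extensions -/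

section Ore

variable {k : Type u} [Field k] {A : Type u} [Ring A] [Algebra k A]

/-- A (`k`-linear, left) `σ`-derivation `δ` of `A`: `δ(a b) = σ(a) δ(b) + δ(a) b`. -/
structure SkewDerivation (σ : A ≃ₐ[k] A) extends A →ₗ[k] A where
  leibniz : ∀ a b : A, toLinearMap (a * b) = σ a * toLinearMap b + toLinearMap a * b

/-- The Ore extension `A[x; σ, δ]`: its elements are the polynomials `∑ᵢ aᵢ xⁱ` with coefficients
`aᵢ` in `A` on the left, multiplied by the rule `x a = σ(a) x + δ(a)`. -/
def OreExtension {σ : A ≃ₐ[k] A} (_ : SkewDerivation σ) : Type u := ℕ →₀ A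

namespace OreExtension

variable (k A) in
/-- Left multiplication by `a` in `A` on polynomials: `∑ᵢ aᵢ xⁱ ↦ ∑ᵢ a aᵢ xⁱ`. -/
def opC (a : A) : Module.End k (ℕ →₀ A) := Finsupp.mapRange.linearMap (LinearMap.mulLeft k a)

variable {σ : A ≃ₐ[k] A} (δ : SkewDerivation σ)

/-- Left multiplication by `x` on polynomials: `∑ᵢ aᵢ xⁱ ↦ ∑ᵢ (σ(aᵢ) xⁱ⁺¹ + δ(aᵢ) xⁱ)`. -/
def opX : Module.End k (ℕ →₀ A) :=
  Finsupp.lmapDomain A k Nat.succ ∘ₗ Finsupp.mapRange.linearMap σ.toLinearMap +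
    Finsupp.mapRange.linearMap δ.toLinearMap

/-- Left multiplication by the polynomial `∑ᵢ aᵢ xⁱ`. -/
def op : (ℕ →₀ A) →ₗ[k] Module.End k (ℕ →₀ A) :=
  Finsupp.lsum k fun n =>
    { toFun := fun a => opC k A a * opX δ ^ n
      map_add' := fun a b => by
        rw [← add_mul]
        congr 1
        apply Finsupp.lhom_ext
        intro m c
        simp [opC, add_mul, -Finsupp.single_mul]
      map_smul' := fun r a => by
        rw [RingHom.id_apply, ← smul_mul_assoc]
        congr 1
        apply Finsupp.lhom_ext
        intro m c
        simp [opC, -Finsupp.single_mul] }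

@[simp] theorem opC_single (a : A) (n : ℕ) (b : A) :
    opC k A a (Finsupp.single n b) = Finsupp.single n (a * b) := by
  simp [opC, -Finsupp.single_mul]

@[simp] theorem opX_single (n : ℕ) (b : A) :
    opX δ (Finsupp.single n b) = Finsupp.single (n + 1) (σ b) + Finsupp.single n (δ.toLinearMap b) := by
  simp [opX]

@[simp] theorem op_single (n : ℕ) (a : A) :
    op δ (Finsupp.single n a) = opC k A a * opX δ ^ n := by
  rw [op, Finsupp.lsum_single]
  rfl

theorem derivation_one : δ.toLinearMap 1 = 0 := by
  have := δ.leibniz 1 1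
  simpa using this

theorem opX_mul_opC (a : A) :
    opX δ * opC k A a = opC k A (σ a) * opX δ + opC k A (δ.toLinearMap a) := by
  apply Finsupp.lhom_ext
  intro n b
  simp only [Module.End.mul_apply, opC_single, opX_single, map_mul, δ.leibniz, map_add,
    LinearMap.add_apply, Finsupp.single_add, add_assoc]

theorem opC_mul (a b : A) : opC k A (a * b) = opC k A a * opC k A b := by
  apply Finsupp.lhom_ext
  intro n c
  simp [mul_assoc, -Finsupp.single_mul]

theorem op_opC (a : A) (f : ℕ →₀ A) : op δ (opC k A a f) = opC k A a * op δ f := by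
  induction f using Finsupp.induction_linear with
  | zero => simp
  | add f g hf hg => simp only [map_add, mul_add, hf, hg]
  | single n b => rw [opC_single, op_single, op_single, opC_mul, mul_assoc]

theorem op_opX (f : ℕ →₀ A) : op δ (opX δ f) = opX δ * op δ f := by
  induction f using Finsupp.induction_linear with
  | zero => simp
  | add f g hf hg => simp only [map_add, mul_add, hf, hg]
  | single n b =>
    rw [opX_single, map_add, op_single, op_single, op_single, ← mul_assoc, opX_mul_opC, add_mul,
      pow_succ', mul_assoc]

theorem op_opX_pow (n : ℕ) (f : ℕ →₀ A) : op δ ((opX δ ^ n) f) = opX δ ^ n * op δ f := by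
  induction n with
  | zero => simp
  | succ n ih => rw [pow_succ', Module.End.mul_apply, op_opX, ih, mul_assoc]

theorem op_op (f g : ℕ →₀ A) : op δ (op δ f g) = op δ f * op δ g := by
  induction f using Finsupp.induction_linear with
  | zero => simp
  | add f f' hf hg => simp only [map_add, LinearMap.add_apply, add_mul, hf, hg]
  | single n a => rw [op_single, Module.End.mul_apply, op_opC, op_opX_pow, mul_assoc]

theorem opX_pow_one (n : ℕ) : (opX δ ^ n) (Finsupp.single 0 1) = Finsupp.single n 1 := by
  induction n with
  | zero => simp
  | succ n ih => rw [pow_succ', Module.End.mul_apply, ih, opX_single]; simp [derivation_one]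

theorem op_one : op δ (Finsupp.single 0 1) = 1 := by
  rw [op_single]
  apply Finsupp.lhom_ext
  intro n c
  simp

theorem op_apply_one (f : ℕ →₀ A) : op δ f (Finsupp.single 0 1) = f := by
  induction f using Finsupp.induction_linear with
  | zero => simp
  | add f g hf hg => simp only [map_add, LinearMap.add_apply, hf, hg]
  | single n b => rw [op_single, Module.End.mul_apply, opX_pow_one]; simp

instance : AddCommGroup (OreExtension δ) := inferInstanceAs (AddCommGroup (ℕ →₀ A))

instance : Module k (OreExtension δ) := inferInstanceAs (Module k (ℕ →₀ A))

instance : Ring (OreExtension δ) where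
  __ := (inferInstance : AddCommGroup (OreExtension δ))
  mul f g := op δ f g
  one := (Finsupp.single 0 1 : ℕ →₀ A)
  left_distrib x y z := map_add (op δ x) y z
  right_distrib x y z := LinearMap.congr_fun (map_add (op δ) x y) z
  zero_mul x := LinearMap.congr_fun (map_zero (op δ)) x
  mul_zero x := map_zero (op δ x)
  mul_assoc x y z := LinearMap.congr_fun (op_op δ x y) z
  one_mul x := LinearMap.congr_fun (op_one δ) x
  mul_one x := op_apply_one δ x

instance : Algebra k (OreExtension δ) :=
  Algebra.ofModule
    (fun r x y => LinearMap.congr_fun (map_smul (op δ) r x) y)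
    (fun r x y => map_smul (op δ x) r y)

/-- The element `a xⁿ` of `A[x; σ, δ]`. -/
def monomial (n : ℕ) (a : A) : OreExtension δ := (Finsupp.single n a : ℕ →₀ A)

/-- The commutation rule `x a = σ(a) x + δ(a)`. -/
theorem X_mul_C (a : A) : monomial δ 1 1 * monomial δ 0 a =
    monomial δ 1 (σ a) + monomial δ 0 (δ.toLinearMap a) := by
  have h : op δ (Finsupp.single 1 1) (Finsupp.single 0 a) =
      Finsupp.single 1 (σ a) + Finsupp.single 0 (δ.toLinearMap a) := by simp
  exact h

/-- Monomials with coefficients on the left: `(a xᵐ) xⁿ = a xᵐ⁺ⁿ`. -/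
theorem monomial_mul_X_pow (m n : ℕ) (a : A) :
    monomial δ m a * monomial δ n 1 = monomial δ (m + n) a := by
  change @Eq (ℕ →₀ A) (op δ (Finsupp.single m a) (Finsupp.single n 1)) (Finsupp.single (m + n) a)
  rw [← opX_pow_one δ, op_single, Module.End.mul_apply, ← Module.End.mul_apply (opX δ ^ m),
    ← pow_add, opX_pow_one]
  simp

/-- The grading of `A[x; σ, δ]` with `deg x = 1`: the polynomial `∑ᵢ aᵢ xⁱ` is homogeneous of
degree `n` if every `aᵢ` is in `Aₙ₋ᵢ`. -/
def grading (𝒜 : ℤ → Submodule k A) (n : ℤ) : Submodule k (OreExtension δ) where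
  carrier := {f | ∀ i : ℕ, DFunLike.coe (F := ℕ →₀ A) f i ∈ 𝒜 (n - i)}
  add_mem' hf hg i := (𝒜 (n - i)).add_mem (hf i) (hg i)
  zero_mem' i := (𝒜 (n - i)).zero_mem
  smul_mem' r _ hf i := (𝒜 (n - i)).smul_mem r (hf i)

end OreExtension

end Ore

end

/-! Regularity of `A` is used in a two-sided form: the trivial left module `k` has a resolution of
length `d` by finite free modules, of rank one at both ends, whose transpose resolves the trivial
right module (`IsRegularAug.resolution`). It is the minimal graded resolution. Since `Ext^i(k, A) =
0` for `i ≠ d`, the dual complex is exact away from the top, and `Ext^d(k, A) ≅ k` together with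
minimality forces the last space of generators to be one-dimensional. Finiteness of the other ranks
then descends from the top, by a duality argument.

Both `A # B` and `A[x; σ, δ]` are twisted tensor products `R`: the products `A ⊗ B → R` and `B ⊗ A →
R` are bijective, and an algebra projection from `R` onto `B` restricts to the augmentation on `A`.
Hence `R` is free over `A` on either side, and extension of scalars turns the resolution of `k` over
`A` into a resolution of `B` over `R` whose transpose again resolves `B`. Therefore `Ext_R^i(B, R)`
vanishes for `i ≠ d₁`, and for `i = d₁` it is free of rank one over `B`
(`FiniteFreeResolution.isExtGenerator`). Now take a finite free resolution of `k` over `B` and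
restrict it to `R`. Every term has `Ext` into `R` in the single degree `d₁`, so `Ext_R^{d₁+j}(k, R)`
is computed by the transposed resolution over `B`: it is `k` for `j = d₂` and zero otherwise
(`IsTwistedTensor.isRegularAug`). This is a collapsed change-of-rings spectral sequence, carried out
by dimension shifting.

The global dimension involves all modules, not only graded ones. It still equals the projective
dimension of `k`, because an arbitrary module `M` is a deformation of the vector space `M` with `A`
acting through the augmentation: the two actions agree up to terms of lower degree. Deformation
passes to syzygies, and a deformation of a projective graded module is projective
(`hasProjectiveDimensionLT_of_trivialMod`).

For the smash product, the inverse of the antipode inverts the twist `b ⊗ a ↦ ∑ (b₋₁ ⇀ a) ⊗ b₀`,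
which gives the second bijection. The first stability hypothesis makes the augmentation of `A`
linear over `H` and yields a projection onto `B`; the second yields a projection onto `A`, and the
two factors exchange roles. For the Ore extension the second factor is `k[x]`, and the second
bijection holds because `xⁿ a = σⁿ(a) xⁿ` up to lower powers of `x`. -/

noncomputable section

/-! ### Finite free resolutions given by matrices, with their transposes. -/

section FiniteFreeResolutions

/-- A resolution of `S / I` of length `d` by finite free left modules, given by matrices acting on
rows, whose transpose is a resolution of `S / J` by finite free right modules.  Both ends of the
resolution have rank one, and the indexing is shifted so that `D i` is the differential from
`S ^ ι (i + 1)` to `S ^ ι i` and `ι 0` is empty. -/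
structure FiniteFreeResolution (S : Type u) [Ring S] (I J : Set S) (d : ℕ) where
  ι : ℕ → Type
  fintype : ∀ i, Fintype (ι i)
  D : ∀ i, Matrix (ι (i + 1)) (ι i) S
  isEmpty_zero : IsEmpty (ι 0)
  unique_one : Unique (ι 1)
  unique_top : Unique (ι (d + 1))
  isEmpty_of_lt : ∀ i, d + 1 < i → IsEmpty (ι i)
  exact_left : ∀ i (v : ι (i + 2) → S), Matrix.vecMul v (D (i + 1)) = 0 ↔
    ∃ u : ι (i + 3) → S, v = Matrix.vecMul u (D (i + 2))
  left : ∀ x : S, x ∈ I ↔ ∃ u : ι 2 → S, (fun _ => x) = Matrix.vecMul u (D 1)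
  exact_right : ∀ i, i < d → ∀ w : ι (i + 1) → S, Matrix.mulVec (D (i + 1)) w = 0 ↔
    ∃ u : ι i → S, w = Matrix.mulVec (D i) u
  right : ∀ x : S, x ∈ J ↔ ∃ u : ι d → S, (fun _ => x) = Matrix.mulVec (D d) u

attribute [instance] FiniteFreeResolution.fintype FiniteFreeResolution.isEmpty_zero

/-- Right multiplication by `s` as an endomorphism of the left module `S`. -/
def mulRightHom {S : Type u} [Ring S] (s : S) : ModuleCat.of S S ⟶ ModuleCat.of S S :=
  ModuleCat.ofHom (LinearMap.toSpanSingleton S S s)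

/-- The map `S ^ ι → S` given by a column. -/
def columnHom {S : Type u} [Ring S] {ι : Type} [Fintype ι] (w : ι → S) :
    ModuleCat.of S (ι → S) ⟶ ModuleCat.of S S :=
  ModuleCat.ofHom (Fintype.linearCombination S w)

/-- The map `S ^ m → S ^ n` given by a matrix acting on rows. -/
def rowHom {S : Type u} [Ring S] {m n : Type} [Fintype m] (M : Matrix m n S) :
    ModuleCat.of S (m → S) ⟶ ModuleCat.of S (n → S) :=
  ModuleCat.ofHom M.vecMulLinear

theorem rowHom_comp_columnHom {S : Type u} [Ring S] {m n : Type} [Fintype m] [Fintype n]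
    (M : Matrix m n S) (w : n → S) : rowHom M ≫ columnHom w = columnHom (M.mulVec w) := by
  ext v
  simp only [rowHom, ModuleCat.hom_comp, ModuleCat.hom_ofHom, LinearMap.comp_apply, columnHom]
  exact (Matrix.dotProduct_mulVec v M w).symm

theorem columnHom_comp_mulRightHom {S : Type u} [Ring S] {n : Type} [Fintype n]
    (w : n → S) (s : S) : columnHom w ≫ mulRightHom s = columnHom (fun i => w i * s) := by
  ext v
  simp only [mulRightHom, ModuleCat.hom_comp, ModuleCat.hom_ofHom, LinearMap.comp_apply,
    columnHom, Fintype.linearCombination_apply, LinearMap.toSpanSingleton_apply, smul_eq_mul, Finset.sum_mul, mul_assoc]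

theorem mulRightHom_add {S : Type u} [Ring S] (s t : S) :
    mulRightHom (s + t) = mulRightHom s + mulRightHom t := by
  ext
  simp [mulRightHom]

end FiniteFreeResolutions

/-! ### Ext of finite free modules under an additive functor. -/

section ExtOfFree

variable {S : Type u} [Ring S] {𝒟 : Type*} [Category 𝒟] [Abelian 𝒟]
  [HasExt.{u} 𝒟] (F : ModuleCat.{u} S ⥤ 𝒟) [F.Additive] {N : 𝒟}

open Abelian

/-- The identity of `S ^ ι` is the sum of its coordinate idempotents, and `Ext` is additive in its
first argument. -/
theorem ext_free_eq_sum {ι : Type} [Fintype ι] [DecidableEq ι] {n : ℕ}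
    (x : Ext (F.obj (ModuleCat.of S (ι → S))) N n) :
    x = ∑ i : ι, (Ext.mk₀ (F.map (columnHom (S := S) (Pi.single i 1)))).comp
      ((Ext.mk₀ (F.map (ModuleCat.ofHom (LinearMap.single S (fun _ : ι => S) i)))).comp x
        (zero_add n)) (zero_add n) := by
  have h : 𝟙 (ModuleCat.of S (ι → S)) = ∑ i : ι, columnHom (S := S) (Pi.single i 1) ≫
      ModuleCat.ofHom (LinearMap.single S (fun _ : ι => S) i) := by
    ext v
    rw [ModuleCat.hom_sum]
    simp only [ModuleCat.hom_id, LinearMap.coe_comp, Function.comp_apply,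
      ModuleCat.hom_comp, ModuleCat.hom_ofHom, LinearMap.sum_apply, columnHom, Fintype.linearCombination_apply, LinearMap.id_coe,
      id_eq]
    simp [Pi.single_apply, Finset.sum_apply]
  conv_lhs => rw [← Ext.mk₀_id_comp x, ← F.map_id, h, Functor.map_sum, Ext.mk₀_sum, Ext.sum_comp]
  simp

theorem ext_free_subsingleton {ι : Type} [Fintype ι] {n : ℕ}
    [Subsingleton (Ext (F.obj (ModuleCat.of S S)) N n)] :
    Subsingleton (Ext (F.obj (ModuleCat.of S (ι → S))) N n) := by
  classical
  refine ⟨fun x y => ?_⟩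
  rw [ext_free_eq_sum F x, ext_free_eq_sum F y]
  refine Finset.sum_congr rfl fun i _ => ?_
  congr 1
  exact Subsingleton.elim (α := Ext (F.obj (ModuleCat.of S S)) N n) _ _

/-- `e` generates `Ext^c (F S, N)` freely over `S`, and the other `Ext (F S, N)` vanish. -/
structure IsExtGenerator (N : 𝒟) (c : ℕ) (e : Ext (F.obj (ModuleCat.of S S)) N c) : Prop where
  subsingleton : ∀ n, n ≠ c → Subsingleton (Ext (F.obj (ModuleCat.of S S)) N n)
  bijective : Function.Bijective fun s : S =>
    (Ext.mk₀ (F.map (mulRightHom s))).comp e (zero_add c)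

variable {F} {c : ℕ} {e : Ext (F.obj (ModuleCat.of S S)) N c}

/-- Each component of `x` is a multiple of the generator `e`, and the coefficients form the column
`w`. With `column_injective` this identifies `Ext^c (F (S ^ ι), N)` with columns, so that the
differentials act by the transposed matrices. -/
theorem IsExtGenerator.exists_column (he : IsExtGenerator F N c e) {ι : Type} [Fintype ι]
    (x : Ext (F.obj (ModuleCat.of S (ι → S))) N c) :
    ∃ w : ι → S, x = (Ext.mk₀ (F.map (columnHom w))).comp e (zero_add c) := by
  classical
  choose w hw using fun i => he.bijective.2
    ((Ext.mk₀ (F.map (ModuleCat.ofHom (LinearMap.single S (fun _ : ι => S) i)))).comp x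
        (zero_add c))
  refine ⟨w, ?_⟩
  rw [ext_free_eq_sum F x]
  simp only [← hw, Ext.mk₀_comp_mk₀_assoc, ← F.map_comp, columnHom_comp_mulRightHom]
  rw [← Ext.sum_comp, ← Ext.mk₀_sum, ← Functor.map_sum]
  congr 3
  ext v
  rw [ModuleCat.hom_sum]
  simp only [columnHom]
  simp [Pi.single_apply]

omit [F.Additive] in
theorem IsExtGenerator.column_injective (he : IsExtGenerator F N c e) {ι : Type} [Fintype ι]
    {w w' : ι → S} (h : (Ext.mk₀ (F.map (columnHom w))).comp e (zero_add c) =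
      (Ext.mk₀ (F.map (columnHom w'))).comp e (zero_add c)) : w = w' := by
  classical
  funext i
  apply he.bijective.1
  have key : ∀ w : ι → S, ModuleCat.ofHom (LinearMap.single S (fun _ : ι => S) i) ≫ columnHom w =
      mulRightHom (w i) := by
    intro w
    ext
    simp [mulRightHom, columnHom, Fintype.linearCombination_apply, Pi.single_apply]
  have := congrArg (fun y => (Ext.mk₀ (F.map (ModuleCat.ofHom
    (LinearMap.single S (fun _ : ι => S) i)))).comp y (zero_add c)) h
  simpa only [Ext.mk₀_comp_mk₀_assoc, ← F.map_comp, key] using this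

theorem IsExtGenerator.column_zero (e : Ext (F.obj (ModuleCat.of S S)) N c)
    {ι : Type} [Fintype ι] :
    (Ext.mk₀ (F.map (columnHom (0 : ι → S)))).comp e (zero_add c) = 0 := by
  have : columnHom (0 : ι → S) = 0 := by
    ext v
    simp [columnHom, Fintype.linearCombination_apply]
  rw [this, F.map_zero, Ext.mk₀_zero, Ext.zero_comp]

end ExtOfFree

/-! ### Dimension shifting along the syzygies of a resolution. -/

namespace FiniteFreeResolution

open Abelian

variable {S : Type u} [Ring S] {I J : Set S} {d : ℕ} (X : FiniteFreeResolution S I J d)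

/-- The `j`-th free module of the resolution. -/
abbrev P (j : ℕ) : ModuleCat.{u} S := ModuleCat.of S (X.ι (j + 1) → S)

/-- The submodule of boundaries in the `j`-th free module. -/
abbrev boundaries (j : ℕ) : Submodule S (X.ι (j + 1) → S) :=
  LinearMap.range (X.D (j + 1)).vecMulLinear

/-- The `j`-th syzygy module. -/
abbrev Y (j : ℕ) : ModuleCat.{u} S := ModuleCat.of S ((X.ι (j + 1) → S) ⧸ X.boundaries j)

theorem mem_boundaries_succ {j : ℕ} {v : X.ι (j + 2) → S} :
    v ∈ X.boundaries (j + 1) ↔ Matrix.vecMul v (X.D (j + 1)) = 0 := by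
  rw [X.exact_left, LinearMap.mem_range]
  exact ⟨fun ⟨u, hu⟩ => ⟨u, hu.symm⟩, fun ⟨u, hu⟩ => ⟨u, hu.symm⟩⟩

theorem boundaries_succ_le_ker (j : ℕ) :
    X.boundaries (j + 1) ≤ LinearMap.ker (X.D (j + 1)).vecMulLinear := fun _ hv =>
  X.mem_boundaries_succ.1 hv

/-- The projection onto the `j`-th syzygy. -/
def proj (j : ℕ) : X.P j ⟶ X.Y j := ModuleCat.ofHom (X.boundaries j).mkQ

/-- The inclusion of a syzygy into the preceding free module. -/
def incl (j : ℕ) : X.Y (j + 1) ⟶ X.P j :=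
  ModuleCat.ofHom ((X.boundaries (j + 1)).liftQ _ (X.boundaries_succ_le_ker j))

theorem proj_incl (j : ℕ) : X.proj (j + 1) ≫ X.incl j = rowHom (X.D (j + 1)) := by
  ext v
  rfl

instance epi_proj (j : ℕ) : Epi (X.proj j) :=
  (ModuleCat.epi_iff_surjective _).2 (Submodule.mkQ_surjective _)

/-- The short exact sequence relating two successive syzygies. -/
def sc (j : ℕ) : ShortComplex (ModuleCat.{u} S) :=
  ShortComplex.mk (X.incl j) (X.proj j) (by
    rw [← cancel_epi (X.proj (j + 1)), ← Category.assoc, proj_incl, Limits.comp_zero]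
    ext v
    exact (Submodule.Quotient.mk_eq_zero _).2 ⟨_, rfl⟩)

theorem sc_shortExact (j : ℕ) : (X.sc j).ShortExact := by
  refine ModuleCat.shortComplex_shortExact _ ?_ ?_ (Submodule.mkQ_surjective _)
  · intro v
    constructor
    · intro hv
      obtain ⟨u, hu⟩ := (Submodule.Quotient.mk_eq_zero _).1 hv
      exact ⟨(X.boundaries (j + 1)).mkQ u, hu⟩
    · rintro ⟨u, rfl⟩
      obtain ⟨u, rfl⟩ := Submodule.mkQ_surjective _ u
      exact (Submodule.Quotient.mk_eq_zero _).2 ⟨u, rfl⟩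
  · rw [injective_iff_map_eq_zero]
    intro v hv
    obtain ⟨v, rfl⟩ := Submodule.mkQ_surjective _ v
    exact (Submodule.Quotient.mk_eq_zero _).2 (X.mem_boundaries_succ.2 hv)

theorem isZero_Y {j : ℕ} (hj : d < j) : Limits.IsZero (X.Y j) := by
  have := X.isEmpty_of_lt (j + 1) (by lia)
  have : Subsingleton (X.Y j) := inferInstanceAs (Subsingleton ((X.ι (j + 1) → S) ⧸ X.boundaries j))
  exact ModuleCat.isZero_of_subsingleton _

/-- The last syzygy is free of rank one. -/
def topHom : X.Y d ⟶ ModuleCat.of S S :=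
  ModuleCat.ofHom ((X.boundaries d).liftQ
    (LinearMap.proj (R := S) (φ := fun _ => S) X.unique_top.default) (by
      -- The term after the last one has rank zero, so the boundaries in degree `d` vanish.
      have := X.isEmpty_of_lt (d + 2) (by lia)
      rintro v ⟨u, rfl⟩
      rw [Subsingleton.elim u 0, map_zero]
      exact zero_mem _))

theorem proj_topHom_mulRight (s : S) :
    X.proj d ≫ X.topHom ≫ mulRightHom s = columnHom (fun _ => s) := by
  ext v
  let := X.unique_top
  simp only [mulRightHom, columnHom, ModuleCat.hom_comp, ModuleCat.hom_ofHom, topHom, proj,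
    LinearMap.comp_apply, Fintype.linearCombination_apply, Fintype.sum_unique,
    LinearMap.toSpanSingleton_apply]
  rfl

section Ext

variable {𝒟 : Type*} [Category 𝒟] [Abelian 𝒟] [HasExt.{u} 𝒟] (F : ModuleCat.{u} S ⥤ 𝒟)
  [F.Additive] [Limits.PreservesFiniteLimits F] [Limits.PreservesFiniteColimits F] {N : 𝒟}

/-- The class of the extension of two successive syzygies. -/
def cls (j : ℕ) : Ext (F.obj (X.Y j)) (F.obj (X.Y (j + 1))) 1 :=
  ((X.sc_shortExact j).map_of_exact F).extClass

/-- The class of the Yoneda extension of the `j`-th syzygy by the zeroth. -/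
def delta : ∀ j : ℕ, Ext (F.obj (X.Y 0)) (F.obj (X.Y j)) j
  | 0 => Ext.mk₀ (𝟙 _)
  | j + 1 => (delta j).comp (X.cls F j) rfl

variable {F} {c : ℕ} {e : Ext (F.obj (ModuleCat.of S S)) N c}

omit [Limits.PreservesFiniteLimits F] [Limits.PreservesFiniteColimits F] in
theorem subsingleton_P (he : IsExtGenerator F N c e) (j : ℕ) {n : ℕ} (hn : n ≠ c) :
    Subsingleton (Ext (F.obj (X.P j)) N n) :=
  have := he.subsingleton n hn
  ext_free_subsingleton F

theorem exists_cls_comp_of_proj_comp_eq_zero (j : ℕ) {n : ℕ} (y : Ext (F.obj (X.Y j)) N (n + 1))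
    (h : (Ext.mk₀ (F.map (X.proj j))).comp y (zero_add _) = 0) :
    ∃ x : Ext (F.obj (X.Y (j + 1))) N n, (X.cls F j).comp x (add_comm 1 n) = y :=
  Ext.contravariant_sequence_exact₃ ((X.sc_shortExact j).map_of_exact F) N y h (add_comm 1 n)

/-- Apart from degree `c` the free term has no `Ext`, so the connecting map into degree `n + 1` is
onto. -/
theorem exists_cls_comp (he : IsExtGenerator F N c e) (j : ℕ) {n : ℕ} (hn : n + 1 ≠ c)
    (y : Ext (F.obj (X.Y j)) N (n + 1)) :
    ∃ x : Ext (F.obj (X.Y (j + 1))) N n, (X.cls F j).comp x (add_comm 1 n) = y := by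
  have := X.subsingleton_P he j hn
  exact X.exists_cls_comp_of_proj_comp_eq_zero j y (Subsingleton.elim _ _)

theorem cls_comp_incl (j : ℕ) {n : ℕ} (y : Ext (F.obj (X.P j)) N n) :
    (X.cls F j).comp ((Ext.mk₀ (F.map (X.incl j))).comp y (zero_add n)) (add_comm 1 n) = 0 :=
  ShortComplex.ShortExact.extClass_comp_assoc ((X.sc_shortExact j).map_of_exact F) y

theorem eq_incl_comp (j : ℕ) {n : ℕ} (x : Ext (F.obj (X.Y (j + 1))) N n)
    (h : (X.cls F j).comp x (add_comm 1 n) = 0) :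
    ∃ y : Ext (F.obj (X.P j)) N n, (Ext.mk₀ (F.map (X.incl j))).comp y (zero_add n) = x :=
  Ext.contravariant_sequence_exact₁ ((X.sc_shortExact j).map_of_exact F) N x (add_comm 1 n) h

/-- Dimension shifting moves the class down to degree zero, where it embeds into `Ext^0` of a free
term. -/
theorem subsingleton_Y_of_lt (he : IsExtGenerator F N c e) {n : ℕ} (hn : n < c) (j : ℕ) :
    Subsingleton (Ext (F.obj (X.Y j)) N n) := by
  induction n generalizing j with
  | zero =>
    have := X.subsingleton_P he j hn.ne
    exact (Ext.precomp_mk₀_injective_of_epi N (F.map (X.proj j))).subsingleton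
  | succ n ih =>
    have := ih (by lia) (j + 1)
    refine subsingleton_of_forall_eq 0 fun y => ?_
    obtain ⟨x, rfl⟩ := X.exists_cls_comp he j hn.ne y
    rw [Subsingleton.elim x 0, Ext.comp_zero]

/-- The kernel of restriction to the free cover is the image of `Ext^{c-1}` of the next syzygy,
which is zero. Classes in degree `c` on a syzygy are thus determined by their columns. -/
theorem proj_comp_injective (he : IsExtGenerator F N c e) (j : ℕ) {x y : Ext (F.obj (X.Y j)) N c}
    (h : (Ext.mk₀ (F.map (X.proj j))).comp x (zero_add c) =
      (Ext.mk₀ (F.map (X.proj j))).comp y (zero_add c)) : x = y := by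
  cases c with
  | zero => exact Ext.precomp_mk₀_injective_of_epi N (F.map (X.proj j)) h
  | succ c =>
    have := X.subsingleton_Y_of_lt he (Nat.lt_succ_self c) (j + 1)
    rw [← sub_eq_zero]
    obtain ⟨z, hz⟩ := X.exists_cls_comp_of_proj_comp_eq_zero j (x - y)
      (by rw [sub_eq_add_neg, Ext.comp_add, Ext.comp_neg, ← sub_eq_add_neg, sub_eq_zero, h])
    rw [← hz, Subsingleton.elim z 0, Ext.comp_zero]

omit [F.Additive] [Limits.PreservesFiniteLimits F] [Limits.PreservesFiniteColimits F] in
theorem proj_incl_comp (j : ℕ) (u : X.ι (j + 1) → S) :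
    (Ext.mk₀ (F.map (X.proj (j + 1)))).comp ((Ext.mk₀ (F.map (X.incl j))).comp
      ((Ext.mk₀ (F.map (columnHom u))).comp e (zero_add c)) (zero_add c)) (zero_add c) =
    (Ext.mk₀ (F.map (columnHom ((X.D (j + 1)).mulVec u)))).comp e (zero_add c) := by
  rw [Ext.mk₀_comp_mk₀_assoc, Ext.mk₀_comp_mk₀_assoc, ← F.map_comp, ← F.map_comp, proj_incl,
    rowHom_comp_columnHom]

omit [Limits.PreservesFiniteLimits F] [Limits.PreservesFiniteColimits F] in
/-- Below the top, every class on a syzygy is represented by a column in the image of the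
preceding differential. -/
theorem exists_column (he : IsExtGenerator F N c e) {j : ℕ} (hj : j < d)
    (x : Ext (F.obj (X.Y j)) N c) : ∃ u : X.ι j → S,
      (Ext.mk₀ (F.map (X.proj j))).comp x (zero_add c) =
        (Ext.mk₀ (F.map (columnHom ((X.D j).mulVec u)))).comp e (zero_add c) := by
  obtain ⟨w, hw⟩ := he.exists_column ((Ext.mk₀ (F.map (X.proj j))).comp x (zero_add c))
  have h0 : (X.D (j + 1)).mulVec w = 0 := by
    apply he.column_injective
    rw [IsExtGenerator.column_zero e, ← rowHom_comp_columnHom, F.map_comp,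
      ← Ext.mk₀_comp_mk₀_assoc, ← hw, Ext.mk₀_comp_mk₀_assoc, ← F.map_comp, ← X.proj_incl,
      Category.assoc, show X.incl j ≫ X.proj j = 0 from (X.sc j).zero]
    simp
  obtain ⟨u, hu⟩ := (X.exact_right j hj w).1 h0
  exact ⟨u, by rw [hw, hu]⟩

/-- Exactness of the transpose below the top: the column of `x` is in the image of the previous
differential, so `x` extends to the free module `P j` and its connecting image is zero. -/
theorem cls_comp_eq_zero (he : IsExtGenerator F N c e) {j : ℕ} (hj : j + 1 < d)
    (x : Ext (F.obj (X.Y (j + 1))) N c) : (X.cls F j).comp x (add_comm 1 c) = 0 := by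
  obtain ⟨u, hu⟩ := X.exists_column he hj x
  rw [← X.proj_incl_comp] at hu
  rw [X.proj_comp_injective he _ hu, cls_comp_incl]

theorem exists_delta_comp (he : IsExtGenerator F N c e) (m : ℕ) (y : Ext (F.obj (X.Y 0)) N (c + m)) :
    ∃ x : Ext (F.obj (X.Y m)) N c, (X.delta F m).comp x (add_comm m c) = y := by
  -- The degree `n` must vary in the induction: after `m` shifts the class still sits above degree
  -- `c`, which is what allows one more shift.
  suffices ∀ m n, c ≤ n → ∀ p, (hp : m + n = p) → ∀ y : Ext (F.obj (X.Y 0)) N p,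
      ∃ x : Ext (F.obj (X.Y m)) N n, (X.delta F m).comp x hp = y from
    this m c le_rfl _ _ y
  intro m
  induction m with
  | zero =>
    intro n _ p hp y
    obtain rfl : n = p := by lia
    exact ⟨y, Ext.mk₀_id_comp y⟩
  | succ m ih =>
    intro n hn p hp y
    obtain ⟨x, rfl⟩ := ih (n + 1) (by lia) p (by lia) y
    obtain ⟨x, rfl⟩ := X.exists_cls_comp he m (by lia) x
    exact ⟨x, Ext.comp_assoc _ _ _ _ _ (by lia)⟩

/-- Strictly above degree `c` the free terms have no `Ext`, so every connecting map making up
`delta` is injective. -/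
theorem delta_comp_injective (he : IsExtGenerator F N c e) (m : ℕ) {n : ℕ} (hn : c < n) {p : ℕ}
    (hp : m + n = p) (x : Ext (F.obj (X.Y m)) N n) (h : (X.delta F m).comp x hp = 0) : x = 0 := by
  induction m generalizing n with
  | zero =>
    obtain rfl : n = p := by lia
    simpa [delta] using h
  | succ m ih =>
    have h1 : (X.cls F m).comp x (add_comm 1 n) = 0 := by
      refine ih (n := n + 1) (by lia) (by lia) _ ?_
      rw [← h]
      exact (Ext.comp_assoc _ _ _ _ _ (by lia)).symm
    obtain ⟨y, rfl⟩ := X.eq_incl_comp m x h1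
    have := X.subsingleton_P he m hn.ne'
    rw [Subsingleton.elim y 0, Ext.comp_zero]

/-- Below `c` this is dimension shifting. In degree `c + m` a class is `delta m` times a class on
the `m`-th syzygy: for `m < d` exactness of the transpose kills the product, and for `m > d` the
syzygy itself is zero. -/
theorem ext_subsingleton (he : IsExtGenerator F N c e) {n : ℕ} (hn : n ≠ c + d) :
    Subsingleton (Ext (F.obj (X.Y 0)) N n) := by
  rcases lt_or_ge n c with h | h
  · exact X.subsingleton_Y_of_lt he h 0
  obtain ⟨m, rfl⟩ := Nat.exists_eq_add_of_le h
  refine subsingleton_of_forall_eq 0 fun y => ?_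
  obtain ⟨x, rfl⟩ := X.exists_delta_comp he m y
  rcases lt_or_gt_of_ne (show m ≠ d by lia) with hm | hm
  · cases m with
    | zero =>
      obtain ⟨u, hu⟩ := X.exists_column he hm x
      have : (X.D 0).mulVec u = 0 := by
        rw [Subsingleton.elim u 0, Matrix.mulVec_zero]
      rw [this, IsExtGenerator.column_zero e] at hu
      have hx : x = 0 := X.proj_comp_injective he 0 (by rw [hu, Ext.comp_zero])
      rw [hx, Ext.comp_zero]
    | succ m =>
      rw [delta, Ext.comp_assoc (a₂₃ := c + 1) _ _ _ _ (by lia) (by lia),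
        X.cls_comp_eq_zero he hm, Ext.comp_zero]
  · have h0 : x = 0 := by
      rw [← Ext.mk₀_id_comp x, (F.map_isZero (X.isZero_Y hm)).eq_of_src (𝟙 _) 0, Ext.mk₀_zero,
        Ext.zero_comp]
    rw [h0, Ext.comp_zero]

/-- The class in the top `Ext` given by right multiplication by `s`. -/
def topClass (e : Ext (F.obj (ModuleCat.of S S)) N c) (s : S) :
    Ext (F.obj (X.Y 0)) N (c + d) :=
  (X.delta F d).comp ((Ext.mk₀ (F.map (X.topHom ≫ mulRightHom s))).comp e (zero_add c))
    (add_comm d c)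

theorem topClass_add (s t : S) : X.topClass e (s + t) = X.topClass e s + X.topClass e t := by
  simp only [topClass, mulRightHom_add, Preadditive.comp_add, F.map_add, Ext.mk₀_add, Ext.add_comp,
    Ext.comp_add]

theorem topClass_surjective (he : IsExtGenerator F N c e) : Function.Surjective (X.topClass e) := by
  intro y
  obtain ⟨x, rfl⟩ := X.exists_delta_comp he d y
  obtain ⟨w, hw⟩ := he.exists_column ((Ext.mk₀ (F.map (X.proj d))).comp x (zero_add c))
  refine ⟨w X.unique_top.default, ?_⟩
  rw [topClass]
  congr 1
  apply X.proj_comp_injective he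
  rw [hw, Ext.mk₀_comp_mk₀_assoc, ← F.map_comp, proj_topHom_mulRight]
  congr 5
  funext i
  rw [X.unique_top.uniq i]

/-- The set `J` is the image of the last transposed differential. Membership says exactly that the
class on the last syzygy extends to the preceding free module, and the remaining connecting maps are
injective because they start in degree `c + 1`. -/
theorem topClass_eq_zero_iff (he : IsExtGenerator F N c e) (s : S) :
    X.topClass e s = 0 ↔ s ∈ J := by
  have key : (∃ u, (Ext.mk₀ (F.map (X.proj d))).comp ((Ext.mk₀ (F.map (X.topHom ≫
      mulRightHom s))).comp e (zero_add c)) (zero_add c) =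
        (Ext.mk₀ (F.map (columnHom ((X.D d).mulVec u)))).comp e (zero_add c)) ↔ s ∈ J := by
    rw [Ext.mk₀_comp_mk₀_assoc, ← F.map_comp, proj_topHom_mulRight, X.right]
    exact exists_congr fun u => ⟨fun h => he.column_injective h, fun h => by rw [h]⟩
  rw [← key, topClass]
  generalize (Ext.mk₀ (F.map (X.topHom ≫ mulRightHom s))).comp e (zero_add c) = x
  clear key
  -- For `d = 0` there is no connecting map, and `D 0` contributes only the zero column.
  obtain _ | d := d
  · have hu0 : ∀ u, (Ext.mk₀ (F.map (columnHom ((X.D 0).mulVec u)))).comp e (zero_add c) = 0 := by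
      intro u
      rw [Subsingleton.elim u 0, Matrix.mulVec_zero, IsExtGenerator.column_zero e]
    have h0 : (X.delta F 0).comp x (add_comm 0 c) = x := Ext.mk₀_id_comp x
    simp only [hu0, exists_const, h0]
    exact ⟨fun h => by rw [h, Ext.comp_zero],
      fun h => X.proj_comp_injective he 0 (h.trans (Ext.comp_zero _ _ _ _ _).symm)⟩
  · rw [delta, Ext.comp_assoc (a₂₃ := c + 1) _ _ _ _ (by lia) (by lia)]
    constructor
    · intro h
      have h1 := X.delta_comp_injective he d (Nat.lt_succ_self c) (by lia) _ h
      obtain ⟨y, rfl⟩ := X.eq_incl_comp d x h1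
      obtain ⟨u, rfl⟩ := he.exists_column y
      exact ⟨u, X.proj_incl_comp d u⟩
    · rintro ⟨u, hu⟩
      rw [← X.proj_incl_comp] at hu
      rw [X.proj_comp_injective he _ hu, cls_comp_incl, Ext.comp_zero]

end Ext

end FiniteFreeResolution

namespace FiniteFreeResolution

open Abelian

variable {S : Type u} [Ring S] {I J : Set S} {d : ℕ} (X : FiniteFreeResolution S I J d)

/-! ### Projective dimension of the resolved module. -/

section ProjectiveDimension

variable {𝒟 : Type*} [Category 𝒟] [Abelian 𝒟] [HasExt.{u} 𝒟] (F : ModuleCat.{u} S ⥤ 𝒟)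
  [F.Additive] [Limits.PreservesFiniteLimits F] [Limits.PreservesFiniteColimits F]

/-- Descent from the vanishing syzygy `Y (d + 1)`: each short exact sequence raises the bound by
one, and the free terms have the same bound as `F S`. -/
theorem hasProjectiveDimensionLT {c : ℕ}
    (h : HasProjectiveDimensionLT (F.obj (ModuleCat.of S S)) (c + 1)) :
    HasProjectiveDimensionLT (F.obj (X.Y 0)) (c + d + 1) := by
  suffices ∀ m j, m + j = d + 1 → HasProjectiveDimensionLT (F.obj (X.Y j)) (c + m) from
    this (d + 1) 0 rfl
  intro m
  induction m with
  | zero =>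
    intro j hj
    have := (F.map_isZero (X.isZero_Y (show d < j by lia))).hasProjectiveDimensionLT_zero
    exact hasProjectiveDimensionLT_of_ge _ 0 _ (by lia)
  | succ m ih =>
    intro j hj
    have hP : HasProjectiveDimensionLT (F.obj (X.P j)) (c + 1) := by
      refine (hasProjectiveDimensionLT_iff _ _).2 fun i hi N x => ?_
      have : Subsingleton (Ext (F.obj (ModuleCat.of S S)) N i) :=
        h.subsingleton _ _ i hi N
      have := ext_free_subsingleton (ι := X.ι (j + 1)) F (N := N) (n := i)
      exact Subsingleton.elim _ _
    exact ((X.sc_shortExact j).map_of_exact F).hasProjectiveDimensionLT_X₃ (c + m)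
      (ih (j + 1) (by lia)) (hasProjectiveDimensionLT_of_ge (F.obj (X.P j)) (c + 1) _ (by lia))

end ProjectiveDimension

/-! ### Chain maps of the resolution and their action on the top class. -/

section ChainMaps

theorem D_mul_D_of_pos (j : ℕ) : X.D (j + 2) * X.D (j + 1) = 0 := by
  classical
  ext a b
  have := (X.exact_left j (X.D (j + 2) a)).2
    ⟨Pi.single a 1, by rw [Matrix.single_one_vecMul]; rfl⟩
  exact congrFun this b

theorem D_mul_D : ∀ j : ℕ, X.D (j + 1) * X.D j = 0
  | 0 => by
    ext a b
    exact isEmptyElim b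
  | j + 1 => X.D_mul_D_of_pos j

/-- `Lifts i G j G'`: there is a chain of matrices from `G` in degree `i` to `G'` in degree `j`
commuting with the differentials. -/
inductive Lifts : ∀ i : ℕ, Matrix (X.ι (i + 1)) (X.ι (i + 1)) S → ∀ j : ℕ,
    Matrix (X.ι (j + 1)) (X.ι (j + 1)) S → Prop
  | refl (i : ℕ) (G : Matrix (X.ι (i + 1)) (X.ι (i + 1)) S) : Lifts i G i G
  | tail {i : ℕ} {G : Matrix (X.ι (i + 1)) (X.ι (i + 1)) S} {j : ℕ}
      {G' : Matrix (X.ι (j + 1)) (X.ι (j + 1)) S}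
      {G'' : Matrix (X.ι (j + 2)) (X.ι (j + 2)) S} :
      Lifts i G j G' → X.D (j + 1) * G' = G'' * X.D (j + 1) → Lifts i G (j + 1) G''

variable {X}

/-- Chains grow at their upper end; prepending is needed when one is built downwards from the top
degree. -/
theorem Lifts.head {i : ℕ} {G : Matrix (X.ι (i + 1)) (X.ι (i + 1)) S}
    {G' : Matrix (X.ι (i + 2)) (X.ι (i + 2)) S} {j : ℕ}
    {G'' : Matrix (X.ι (j + 1)) (X.ι (j + 1)) S}
    (h : X.D (i + 1) * G = G' * X.D (i + 1)) (h' : X.Lifts (i + 1) G' j G'') :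
    X.Lifts i G j G'' := by
  induction h' with
  | refl => exact Lifts.tail (Lifts.refl _ _) h
  | tail _ hc ih => exact Lifts.tail ih hc

theorem exists_mul_of_rows {m n l : Type} [Fintype n] (M : Matrix l m S) (N : Matrix n m S)
    (h : ∀ i, ∃ u : n → S, M i = Matrix.vecMul u N) : ∃ G : Matrix l n S, M = G * N := by
  choose u hu using h
  refine ⟨u, ?_⟩
  ext i j
  exact congrFun (hu i) j

theorem exists_mul_of_columns {m n l : Type} [Fintype n] (M : Matrix m l S) (N : Matrix m n S)
    (h : ∀ i, ∃ u : n → S, (fun j => M j i) = Matrix.mulVec N u) :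
    ∃ G : Matrix n l S, M = N * G := by
  choose u hu using h
  refine ⟨fun i j => u j i, ?_⟩
  ext i j
  exact congrFun (hu j) i

variable (X) in
-- The comparison theorem: right multiplication by `β` descends to `S / I` and lifts step by step
-- along the free modules, by exactness on rows.
theorem exists_lifts {β : S} (hβ : ∀ x ∈ I, x * β ∈ I) (j : ℕ) :
    ∃ G, X.Lifts 0 (fun _ _ => β) j G := by
  let := X.unique_one
  -- The induction carries the next matrix as well, since its commutation relation is what makes the
  -- following lift possible.
  suffices ∃ G : Matrix (X.ι (j + 1)) (X.ι (j + 1)) S, X.Lifts 0 (fun _ _ => β) j G ∧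
      ∃ G' : Matrix (X.ι (j + 2)) (X.ι (j + 2)) S, X.D (j + 1) * G = G' * X.D (j + 1) from
    ⟨_, this.choose_spec.1⟩
  induction j with
  | zero =>
    classical
    refine ⟨_, Lifts.refl _ _, exists_mul_of_rows _ _ fun i => ?_⟩
    obtain ⟨u, hu⟩ := (X.left _).1 (hβ (X.D 1 i default) ((X.left _).2 ⟨Pi.single i 1, by
      rw [Matrix.single_one_vecMul]
      funext b
      rw [Subsingleton.elim b default]; rfl⟩))
    refine ⟨u, hu ▸ ?_⟩
    funext b
    rw [Subsingleton.elim b default]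
    exact Fintype.sum_unique _
  | succ j ih =>
    obtain ⟨G, hG, G', h⟩ := ih
    refine ⟨G', Lifts.tail hG h, exists_mul_of_rows _ _ fun i => ?_⟩
    refine (X.exact_left j _).1 ?_
    change (X.D (j + 2) * G' * X.D (j + 1)) i = 0
    rw [Matrix.mul_assoc, ← h, ← Matrix.mul_assoc, D_mul_D, Matrix.zero_mul]
    rfl

variable (X) in
-- The comparison theorem for the transposed resolution: from `γ` in the top degree a chain map is
-- built downwards by exactness on columns.
theorem exists_lifts_top {γ : S} (hγ : ∀ x ∈ J, γ * x ∈ J) :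
    ∃ β : S, X.Lifts 0 (fun _ _ => β) d (fun _ _ => γ) := by
  let := X.unique_one
  let := X.unique_top
  suffices ∀ m j, m + j = d → ∃ G : Matrix (X.ι (j + 1)) (X.ι (j + 1)) S,
      X.Lifts j G d (fun _ _ => γ) ∧ ∃ G' : Matrix (X.ι j) (X.ι j) S, G * X.D j = X.D j * G' by
    obtain ⟨G, hG, -⟩ := this d 0 rfl
    refine ⟨G default default, ?_⟩
    have : (fun _ _ => G default default : Matrix (X.ι 1) (X.ι 1) S) = G := by
      funext a b
      rw [Subsingleton.elim a default, Subsingleton.elim b default]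
    rwa [this]
  intro m
  induction m with
  | zero =>
    intro j hj
    obtain rfl : j = d := by lia
    refine ⟨_, Lifts.refl _ _, ?_⟩
    classical
    refine exists_mul_of_columns _ _ fun i => ?_
    obtain ⟨u, hu⟩ := (X.right _).1 (hγ (X.D j default i) ((X.right _).2 ⟨Pi.single i 1, by
      rw [Matrix.mulVec_single_one]
      funext b
      rw [Subsingleton.elim b default]; rfl⟩))
    refine ⟨u, hu ▸ ?_⟩
    funext b
    exact Fintype.sum_unique _
  | succ m ih =>
    intro j hj
    obtain ⟨G', hG', G, h⟩ := ih (j + 1) (by lia)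
    refine ⟨G, Lifts.head h.symm hG', exists_mul_of_columns _ _ fun i => ?_⟩
    refine (X.exact_right j (by lia) _).1 ?_
    have : X.D (j + 1) * (G * X.D j) = 0 := by
      rw [← Matrix.mul_assoc, ← h, Matrix.mul_assoc, D_mul_D, Matrix.mul_zero]
    funext a
    exact congrFun (congrFun this a) i

/-- If `γ ∈ J`, the chain map is null-homotopic in the top degree. Exactness of the transpose
carries the homotopy down to degree zero, where it writes `β` as a combination of the entries of `D
1`. -/
theorem mem_of_lifts {β γ : S} (h : X.Lifts 0 (fun _ _ => β) d (fun _ _ => γ)) (hγ : γ ∈ J) :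
    β ∈ I := by
  have key : ∀ i G j G', X.Lifts i G j G' → j ≤ d →
      (∃ (H : Matrix (X.ι (j + 1)) (X.ι (j + 2)) S) (K : Matrix (X.ι j) (X.ι (j + 1)) S),
        G' = H * X.D (j + 1) + X.D j * K) →
      ∃ (H : Matrix (X.ι (i + 1)) (X.ι (i + 2)) S) (K : Matrix (X.ι i) (X.ι (i + 1)) S),
        G = H * X.D (i + 1) + X.D i * K := by
    intro i G j G' h
    induction h with
    | refl => exact fun _ h => h
    | @tail j G' G'' _ hc ih =>
      rintro hj ⟨H, K, hG⟩
      refine ih (by lia) ⟨K, ?_⟩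
      suffices ∃ K' : Matrix (X.ι j) (X.ι (j + 1)) S, G' - K * X.D (j + 1) = X.D j * K' by
        obtain ⟨K', hK'⟩ := this
        exact ⟨K', by rw [← hK', add_sub_cancel]⟩
      refine exists_mul_of_columns _ _ fun i => (X.exact_right j (by lia) _).1 ?_
      have : X.D (j + 1) * (G' - K * X.D (j + 1)) = 0 := by
        rw [Matrix.mul_sub, hc, hG, Matrix.add_mul, Matrix.mul_assoc, D_mul_D, Matrix.mul_zero,
          zero_add, Matrix.mul_assoc, sub_self]
      funext a
      exact congrFun (congrFun this a) i
  let := X.unique_one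
  obtain ⟨u, hu⟩ := (X.right γ).1 hγ
  -- In the top degree the homotopy consists of the column that expresses `γ` through `D d`; its
  -- other half is zero.
  obtain ⟨H, K, hG⟩ := key _ _ _ _ h le_rfl ⟨0, fun a _ => u a, by
    rw [Matrix.zero_mul, zero_add]
    funext a b
    exact congrFun hu a⟩
  refine (X.left β).2 ⟨H default, ?_⟩
  have h0 : X.D 0 * K = 0 := by
    funext a b
    exact Finset.sum_of_isEmpty _
  rw [h0, add_zero] at hG
  funext b
  exact congrFun (congrFun hG default) b

section Ext

variable {𝒟 : Type*} [Category 𝒟] [Abelian 𝒟] [HasExt.{u} 𝒟] (F : ModuleCat.{u} S ⥤ 𝒟)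
  [F.Additive] [Limits.PreservesFiniteLimits F] [Limits.PreservesFiniteColimits F] {N : 𝒟} {c : ℕ}

/-- A chain map induces maps of syzygies and of the short exact sequences between them, and
extension classes are natural for such maps. -/
theorem Lifts.exists_hom {β : S} {f : X.Y 0 ⟶ X.Y 0}
    (hf : X.proj 0 ≫ f = rowHom (fun _ _ => β) ≫ X.proj 0) {j : ℕ}
    {G : Matrix (X.ι (j + 1)) (X.ι (j + 1)) S} (h : X.Lifts 0 (fun _ _ => β) j G) :
    ∃ g : X.Y j ⟶ X.Y j, X.proj j ≫ g = rowHom G ≫ X.proj j ∧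
      (Ext.mk₀ (F.map f)).comp (X.delta F j) (zero_add j) =
        (X.delta F j).comp (Ext.mk₀ (F.map g)) (add_zero j) := by
  induction h with
  | refl => exact ⟨f, hf, by simp [delta]⟩
  | @tail j G' G'' _ hc ih =>
    obtain ⟨g, hg, hg'⟩ := ih
    let g' : X.Y (j + 1) ⟶ X.Y (j + 1) := ModuleCat.ofHom
      (Submodule.mapQ _ _ G''.vecMulLinear fun v hv => by
        rw [Submodule.mem_comap, mem_boundaries_succ]
        rw [mem_boundaries_succ] at hv
        change Matrix.vecMul (Matrix.vecMul v G'') (X.D (j + 1)) = 0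
        rw [Matrix.vecMul_vecMul, ← hc, ← Matrix.vecMul_vecMul, hv, Matrix.zero_vecMul])
    have h1 : X.proj (j + 1) ≫ g' = rowHom G'' ≫ X.proj (j + 1) := by
      ext v
      rfl
    have hrow : rowHom G'' ≫ rowHom (X.D (j + 1)) = rowHom (X.D (j + 1)) ≫ rowHom G' := by
      refine ModuleCat.hom_ext (LinearMap.ext fun v => ?_)
      change Matrix.vecMul (Matrix.vecMul v G'') (X.D (j + 1)) =
        Matrix.vecMul (Matrix.vecMul v (X.D (j + 1))) G'
      rw [Matrix.vecMul_vecMul, ← hc, ← Matrix.vecMul_vecMul]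
    have h2 : g' ≫ X.incl j = X.incl j ≫ rowHom G' := by
      rw [← cancel_epi (X.proj (j + 1)), ← Category.assoc, h1, Category.assoc, proj_incl,
        ← Category.assoc, proj_incl, hrow]
    let φ : X.sc j ⟶ X.sc j := { τ₁ := g', τ₂ := rowHom G', τ₃ := g, comm₁₂ := h2, comm₂₃ := hg.symm }
    have h3 : (X.cls F j).comp (Ext.mk₀ (F.map g')) (add_zero 1) =
        (Ext.mk₀ (F.map g)).comp (X.cls F j) (zero_add 1) :=
      ShortComplex.ShortExact.extClass_naturality ((X.sc_shortExact j).map_of_exact F)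
        ((X.sc_shortExact j).map_of_exact F) (F.mapShortComplex.map φ)
    refine ⟨g', h1, ?_⟩
    rw [delta, Ext.comp_assoc (a₂₃ := 1) _ _ _ _ (by lia) (by lia), h3,
      ← Ext.comp_assoc (a₁₂ := j) _ _ _ (by lia) (by lia) (by lia), hg',
      ← Ext.comp_assoc (a₁₂ := j) _ _ _ (by lia) (by lia) (by lia)]

variable {F} in
/-- Endomorphisms of the resolved module act on the top class through the last matrix of a
chain map. -/
theorem Lifts.comp_topClass {e : Ext (F.obj (ModuleCat.of S S)) N c} {β γ : S}
    {f : X.Y 0 ⟶ X.Y 0} (hf : X.proj 0 ≫ f = rowHom (fun _ _ => β) ≫ X.proj 0)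
    (h : X.Lifts 0 (fun _ _ => β) d (fun _ _ => γ)) (s : S) :
    (Ext.mk₀ (F.map f)).comp (X.topClass e s) (zero_add _) = X.topClass e (γ * s) := by
  obtain ⟨g, hg, hg'⟩ := h.exists_hom F hf
  have : g ≫ X.topHom ≫ mulRightHom s = X.topHom ≫ mulRightHom (γ * s) := by
    rw [← cancel_epi (X.proj d), ← Category.assoc, hg, Category.assoc, proj_topHom_mulRight,
      proj_topHom_mulRight]
    refine (rowHom_comp_columnHom _ _).trans (congrArg columnHom ?_)
    let := X.unique_top
    funext a
    exact Fintype.sum_unique _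
  rw [topClass, ← Ext.comp_assoc (a₁₂ := d) _ _ _ (by lia) (by lia) (by lia), hg',
    Ext.comp_assoc (a₂₃ := c) _ _ _ (by lia) (by lia) (by lia), Ext.mk₀_comp_mk₀_assoc, ← F.map_comp,
    this, topClass]

end Ext

end ChainMaps

/-! ### Base change along a ring map that is free on both sides. -/

section BaseChange

variable {A R : Type u} [Ring A] [Ring R] {K : Type*} (f : A →+* R)

/-- `Ψ` splits `R` into copies of the right module `A`. Matrices with entries from `A` multiply rows
on the right, so they act on each coordinate separately. -/
theorem coord_vecMul (Ψ : R ≃+ (K →₀ A)) (hΨ : ∀ r a k, Ψ (r * f a) k = Ψ r k * a)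
    {m n : Type} [Fintype m] (M : Matrix m n A) (u : m → R) (k : K) :
    (fun i => Ψ (Matrix.vecMul u (M.map f) i) k) = Matrix.vecMul (fun j => Ψ (u j) k) M := by
  funext i
  simp [Matrix.vecMul, dotProduct, Finsupp.finsetSum_apply, hΨ]

theorem vecMul_map_eq_zero_iff (Ψ : R ≃+ (K →₀ A)) (hΨ : ∀ r a k, Ψ (r * f a) k = Ψ r k * a)
    {m n : Type} [Fintype m] (M : Matrix m n A) (u : m → R) :
    Matrix.vecMul u (M.map f) = 0 ↔ ∀ k, Matrix.vecMul (fun j => Ψ (u j) k) M = 0 := by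
  simp only [← coord_vecMul f Ψ hΨ]
  constructor
  · intro h k
    funext i
    rw [h]
    simp
  · intro h
    funext i
    apply Ψ.injective
    ext k
    rw [show Ψ (Matrix.vecMul u (M.map f) i) k = 0 from congrFun (h k) i]
    simp

theorem exists_vecMul_map_iff (Ψ : R ≃+ (K →₀ A)) (hΨ : ∀ r a k, Ψ (r * f a) k = Ψ r k * a)
    {m n : Type} [Fintype m] [Fintype n] (M : Matrix m n A) (v : n → R) :
    (∃ u : m → R, v = Matrix.vecMul u (M.map f)) ↔
      ∀ k, ∃ u : m → A, (fun i => Ψ (v i) k) = Matrix.vecMul u M := by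
  classical
  constructor
  · rintro ⟨u, rfl⟩ k
    exact ⟨_, coord_vecMul f Ψ hΨ M u k⟩
  · intro h
    choose u hu using h
    -- Only finitely many coordinates of `v` are nonzero. The chosen solutions are kept there and
    -- replaced by zero elsewhere, to obtain finite support.
    let s : Finset K := Finset.univ.biUnion fun i => (Ψ (v i)).support
    refine ⟨fun j => Ψ.symm (∑ k ∈ s, Finsupp.single k (u k j)), ?_⟩
    funext i
    apply Ψ.injective
    ext k
    refine Eq.trans ?_ (congrFun (coord_vecMul f Ψ hΨ M _ k) i).symm
    simp only [AddEquiv.apply_symm_apply, Finsupp.finsetSum_apply, Finsupp.single_apply]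
    by_cases hk : k ∈ s
    · simp only [Finset.sum_ite_eq', hk, if_true]
      exact congrFun (hu k) i
    · have h0 : Ψ (v i) k = 0 := by
        by_contra h
        exact hk (Finset.mem_biUnion.2 ⟨i, Finset.mem_univ _, Finsupp.mem_support_iff.2 h⟩)
      rw [h0]
      simp only [Finset.sum_ite_eq', hk, if_false]
      exact (congrFun (Matrix.zero_vecMul M) i).symm

theorem coord_mulVec (Ψ : R ≃+ (K →₀ A)) (hΨ : ∀ r a k, Ψ (f a * r) k = a * Ψ r k)
    {m n : Type} [Fintype m] (M : Matrix n m A) (u : m → R) (k : K) :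
    (fun i => Ψ (Matrix.mulVec (M.map f) u i) k) = Matrix.mulVec M (fun j => Ψ (u j) k) := by
  funext i
  simp [Matrix.mulVec, dotProduct, Finsupp.finsetSum_apply, hΨ]

theorem mulVec_map_eq_zero_iff (Ψ : R ≃+ (K →₀ A)) (hΨ : ∀ r a k, Ψ (f a * r) k = a * Ψ r k)
    {m n : Type} [Fintype m] (M : Matrix n m A) (u : m → R) :
    Matrix.mulVec (M.map f) u = 0 ↔ ∀ k, Matrix.mulVec M (fun j => Ψ (u j) k) = 0 := by
  simp only [← coord_mulVec f Ψ hΨ]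
  constructor
  · intro h k
    funext i
    rw [h]
    simp
  · intro h
    funext i
    apply Ψ.injective
    ext k
    rw [show Ψ (Matrix.mulVec (M.map f) u i) k = 0 from congrFun (h k) i]
    simp

theorem exists_mulVec_map_iff (Ψ : R ≃+ (K →₀ A)) (hΨ : ∀ r a k, Ψ (f a * r) k = a * Ψ r k)
    {m n : Type} [Fintype m] [Fintype n] (M : Matrix n m A) (v : n → R) :
    (∃ u : m → R, v = Matrix.mulVec (M.map f) u) ↔
      ∀ k, ∃ u : m → A, (fun i => Ψ (v i) k) = Matrix.mulVec M u := by
  classical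
  constructor
  · rintro ⟨u, rfl⟩ k
    exact ⟨_, coord_mulVec f Ψ hΨ M u k⟩
  · intro h
    choose u hu using h
    let s : Finset K := Finset.univ.biUnion fun i => (Ψ (v i)).support
    refine ⟨fun j => Ψ.symm (∑ k ∈ s, Finsupp.single k (u k j)), ?_⟩
    funext i
    apply Ψ.injective
    ext k
    refine Eq.trans ?_ (congrFun (coord_mulVec f Ψ hΨ M _ k) i).symm
    simp only [AddEquiv.apply_symm_apply, Finsupp.finsetSum_apply, Finsupp.single_apply]
    by_cases hk : k ∈ s
    · simp only [Finset.sum_ite_eq', hk, if_true]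
      exact congrFun (hu k) i
    · have h0 : Ψ (v i) k = 0 := by
        by_contra h
        exact hk (Finset.mem_biUnion.2 ⟨i, Finset.mem_univ _, Finsupp.mem_support_iff.2 h⟩)
      rw [h0]
      simp only [Finset.sum_ite_eq', hk, if_false]
      exact (congrFun (Matrix.mulVec_zero M) i).symm

/-- Base change of a resolution along a ring homomorphism that is free on both sides. -/
def map {I J : Set A} {d : ℕ} (X : FiniteFreeResolution A I J d)
    (Ψ : R ≃+ (K →₀ A)) (hΨ : ∀ r a k, Ψ (r * f a) k = Ψ r k * a)
    {K' : Type*} (Φ : R ≃+ (K' →₀ A)) (hΦ : ∀ r a k, Φ (f a * r) k = a * Φ r k)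
    {I' J' : Set R} (hI : ∀ x, x ∈ I' ↔ ∀ k, Ψ x k ∈ I) (hJ : ∀ x, x ∈ J' ↔ ∀ k, Φ x k ∈ J) :
    FiniteFreeResolution R I' J' d where
  ι := X.ι
  fintype := X.fintype
  D i := (X.D i).map f
  isEmpty_zero := X.isEmpty_zero
  unique_one := X.unique_one
  unique_top := X.unique_top
  isEmpty_of_lt := X.isEmpty_of_lt
  exact_left i v := by
    rw [exists_vecMul_map_iff f Ψ hΨ, vecMul_map_eq_zero_iff f Ψ hΨ]
    exact forall_congr' fun k => X.exact_left i _
  left x := by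
    rw [exists_vecMul_map_iff f Ψ hΨ, hI]
    exact forall_congr' fun k => X.left _
  exact_right i hi w := by
    rw [exists_mulVec_map_iff f Φ hΦ, mulVec_map_eq_zero_iff f Φ hΦ]
    exact forall_congr' fun k => X.exact_right i hi _
  right x := by
    rw [exists_mulVec_map_iff f Φ hΦ, hJ]
    exact forall_congr' fun k => X.right _

end BaseChange

end FiniteFreeResolution

/-! ### A quotient ring with a single Ext group into the ring. -/

section ChangeOfRings

open Abelian

variable {R B : Type u} [Ring R] [Ring B] (π : R →+* B)

theorem restrictScalars_exact_of_shortExact :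
    Limits.PreservesFiniteLimits (ModuleCat.restrictScalars.{u} π) ∧
      Limits.PreservesFiniteColimits (ModuleCat.restrictScalars.{u} π) := by
  refine ((Functor.exact_tfae (ModuleCat.restrictScalars.{u} π)).out 1 3).mp fun S h => ?_
  rw [ShortComplex.ShortExact.moduleCat_exact_iff_function_exact] at h ⊢
  exact h

instance preservesFiniteLimits_restrictScalars :
    Limits.PreservesFiniteLimits (ModuleCat.restrictScalars.{u} π) :=
  (restrictScalars_exact_of_shortExact π).1

instance preservesFiniteColimits_restrictScalars :
    Limits.PreservesFiniteColimits (ModuleCat.restrictScalars.{u} π) :=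
  (restrictScalars_exact_of_shortExact π).2

/-- The starting case `c = 0`: `S` is projective and its endomorphisms are the right
multiplications. -/
theorem isExtGenerator_id (S : Type u) [Ring S] :
    IsExtGenerator (𝟭 (ModuleCat.{u} S)) (ModuleCat.of S S) 0
      (Ext.mk₀ (𝟙 (ModuleCat.of S S))) where
  subsingleton n hn := HasProjectiveDimensionLT.subsingleton
    ((𝟭 (ModuleCat.{u} S)).obj (ModuleCat.of S S)) 1 n (by lia) _
  bijective := by
    have h : ∀ s : S, (Ext.mk₀ ((𝟭 (ModuleCat.{u} S)).map (mulRightHom s))).comp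
        (Ext.mk₀ (𝟙 (ModuleCat.of S S))) (zero_add 0) = Ext.mk₀ (mulRightHom s) := fun s =>
      Ext.comp_mk₀_id _
    simp only [h]
    refine (Ext.mk₀_bijective _ _).comp ⟨fun s t hst => ?_, fun f => ⟨f.hom (1 : S), ?_⟩⟩
    · have := congrArg (fun f : ModuleCat.of S S ⟶ ModuleCat.of S S => f.hom (1 : S)) hst
      simpa [mulRightHom] using this
    · ext
      simp [mulRightHom]

variable {π} {d : ℕ} (X : FiniteFreeResolution R {r | π r = 0} {r | π r = 0} d)

/-- The module resolved by `X` maps to the quotient ring. -/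
def FiniteFreeResolution.toQuotient :
    X.Y 0 ⟶ (ModuleCat.restrictScalars π).obj (ModuleCat.of B B) :=
  ModuleCat.ofHom (Y := (ModuleCat.restrictScalars π).obj (ModuleCat.of B B))
    ((X.boundaries 0).liftQ
    ({ toFun := fun v => π (v X.unique_one.default)
       map_add' := fun v w => map_add π _ _
       map_smul' := fun r v => map_mul π _ _ } :
      (X.ι 1 → R) →ₗ[R] (ModuleCat.restrictScalars π).obj (ModuleCat.of B B)) (by
    rintro _ ⟨u, rfl⟩
    let := X.unique_one
    refine (X.left _).2 ⟨u, ?_⟩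
    funext i
    rw [Subsingleton.elim i default]
    rfl))

theorem FiniteFreeResolution.isIso_toQuotient (hπ : Function.Surjective π) :
    IsIso X.toQuotient := by
  let := X.unique_one
  rw [ConcreteCategory.isIso_iff_bijective]
  constructor
  · rw [injective_iff_map_eq_zero]
    intro v hv
    obtain ⟨v, rfl⟩ := Submodule.mkQ_surjective _ v
    obtain ⟨u, hu⟩ := (X.left (v default)).1 hv
    refine (Submodule.Quotient.mk_eq_zero _).2 ⟨u, hu.symm.trans ?_⟩
    funext i
    rw [Subsingleton.elim i default]
  · intro b
    obtain ⟨r, rfl⟩ := hπ b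
    exact ⟨(X.boundaries 0).mkQ fun _ => r, rfl⟩

include X in
/-- If `X` resolves `B = R / ker π` and its transpose resolves `R / ker π` as well, then `B` has
a single nonvanishing `Ext` into `R`, and it is free of rank one over `B`. -/
theorem FiniteFreeResolution.isExtGenerator (hπ : Function.Surjective π) :
    ∃ e, IsExtGenerator (ModuleCat.restrictScalars.{u} π) (ModuleCat.of R R) d e := by
  have := X.isIso_toQuotient hπ
  let F := ModuleCat.restrictScalars.{u} π
  let e₀ : Ext ((𝟭 (ModuleCat.{u} R)).obj (ModuleCat.of R R)) (ModuleCat.of R R) 0 :=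
    Ext.mk₀ (𝟙 (ModuleCat.of R R))
  have he₀ : IsExtGenerator (𝟭 (ModuleCat.{u} R)) (ModuleCat.of R R) 0 e₀ := isExtGenerator_id R
  let T : R → Ext (X.Y 0) (ModuleCat.of R R) (0 + d) := X.topClass e₀
  have hd : 0 + (0 + d) = d := by lia
  let e : Ext (F.obj (ModuleCat.of B B)) (ModuleCat.of R R) d :=
    (Ext.mk₀ (inv X.toQuotient)).comp (T 1) hd
  -- Right multiplication by `π β` on `B` corresponds to a chain map starting with `β`. On the top
  -- class it acts through the last entry `γ`, so the action of `B` on `e` is read off from pairs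
  -- `(β, γ)`.
  have key : ∀ β γ : R, X.Lifts 0 (fun _ _ => β) d (fun _ _ => γ) →
      (Ext.mk₀ (F.map (mulRightHom (π β)))).comp e (zero_add d) =
        (Ext.mk₀ (inv X.toQuotient)).comp (T γ) hd := by
    intro β γ h
    let f : X.Y 0 ⟶ X.Y 0 := X.toQuotient ≫ F.map (mulRightHom (π β)) ≫ inv X.toQuotient
    have hf : X.proj 0 ≫ f = rowHom (fun _ _ => β) ≫ X.proj 0 := by
      rw [← cancel_mono X.toQuotient]
      simp only [f, Category.assoc, IsIso.inv_hom_id, Category.comp_id]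
      rw [← Category.assoc]
      refine ModuleCat.hom_ext (LinearMap.ext fun v => ?_)
      let := X.unique_one
      change π (v default) * π β = π (∑ i, v i * β)
      rw [Fintype.sum_unique, map_mul]
    have h1 := h.comp_topClass (F := 𝟭 _) (e := e₀) hf 1
    rw [mul_one] at h1
    change _ = (Ext.mk₀ (inv X.toQuotient)).comp (X.topClass e₀ γ) hd
    rw [← h1]
    change _ = (Ext.mk₀ (inv X.toQuotient)).comp ((Ext.mk₀ f).comp (T 1) (zero_add _)) hd
    rw [← Ext.comp_assoc (a₁₂ := 0) _ _ _ (by lia) (by lia) (by lia), Ext.mk₀_comp_mk₀,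
      ← Ext.comp_assoc (a₁₂ := 0) _ _ _ (by lia) (by lia) (by lia), Ext.mk₀_comp_mk₀]
    congr 2
    simp [f]
  have hinj : ∀ y : Ext (X.Y 0) (ModuleCat.of R R) (0 + d),
      (Ext.mk₀ (inv X.toQuotient)).comp y hd = 0 → y = 0 := by
    intro y hy
    have := congrArg (fun z => (Ext.mk₀ X.toQuotient).comp z (rfl : 0 + d = 0 + d)) hy
    rw [Ext.comp_zero, ← Ext.comp_assoc (a₁₂ := 0) _ _ _ (by lia) (by lia) (by lia),
      Ext.mk₀_comp_mk₀, IsIso.hom_inv_id, Ext.mk₀_id_comp] at this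
    exact this
  refine ⟨e, fun n hn => ?_, ?_, ?_⟩
  · have := X.ext_subsingleton he₀ (n := n) (by lia)
    refine subsingleton_of_forall_eq 0 fun y => ?_
    have h2 : (Ext.mk₀ (inv X.toQuotient)).comp ((Ext.mk₀ X.toQuotient).comp y (zero_add n))
        (zero_add n) = y := by
      rw [Ext.mk₀_comp_mk₀_assoc, IsIso.inv_hom_id, Ext.mk₀_id_comp]
    rw [← h2, Subsingleton.elim (α := Ext ((𝟭 (ModuleCat.{u} R)).obj (X.Y 0)) _ n)
      ((Ext.mk₀ X.toQuotient).comp y (zero_add n)) 0, Ext.comp_zero]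
  · have hadd : ∀ b b' : B, (Ext.mk₀ (F.map (mulRightHom (b + b')))).comp e (zero_add d) =
        (Ext.mk₀ (F.map (mulRightHom b))).comp e (zero_add d) +
        (Ext.mk₀ (F.map (mulRightHom b'))).comp e (zero_add d) := by
      intro b b'
      rw [mulRightHom_add, F.map_add, Ext.mk₀_add, Ext.add_comp]
    refine (injective_iff_map_eq_zero (AddMonoidHom.mk' _ hadd)).2 fun b hb => ?_
    obtain ⟨β, rfl⟩ := hπ b
    -- Injectivity: lift `β` upwards to some `γ`. If `π β` kills `e`, then `γ ∈ J`, and the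
    -- descending homotopy gives `π β = 0`.
    obtain ⟨G, hG⟩ := X.exists_lifts (β := β) (fun x (hx : π x = 0) => by
      change π _ = 0
      rw [map_mul, hx, zero_mul]) d
    let := X.unique_top
    have hG' : G = fun _ _ => G default default := by
      funext a b
      rw [Subsingleton.elim a default, Subsingleton.elim b default]
    rw [hG'] at hG
    have h3 := (key _ _ hG).symm.trans hb
    change β ∈ {r | π r = 0}
    exact FiniteFreeResolution.mem_of_lifts hG ((X.topClass_eq_zero_iff he₀ _).1 (hinj _ h3))
  · intro y
    -- Surjectivity: every class comes from some `γ`, and extending it downwards supplies the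
    -- required `β`.
    obtain ⟨γ, hγ⟩ := X.topClass_surjective he₀ ((Ext.mk₀ X.toQuotient).comp y (rfl : 0 + d = 0 + d))
    obtain ⟨β, hβ⟩ := X.exists_lifts_top (γ := γ) (fun x (hx : π x = 0) => by
      change π _ = 0
      rw [map_mul, hx, mul_zero])
    refine ⟨π β, (key _ _ hβ).trans ?_⟩
    change (Ext.mk₀ (inv X.toQuotient)).comp (X.topClass e₀ γ) hd = _
    rw [hγ, ← Ext.comp_assoc (a₁₂ := 0) _ _ _ (by lia) (by lia) (by lia), Ext.mk₀_comp_mk₀,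
      IsIso.inv_hom_id, Ext.mk₀_id_comp]

include X in
theorem FiniteFreeResolution.hasProjectiveDimensionLT_quotient (hπ : Function.Surjective π) :
    HasProjectiveDimensionLT ((ModuleCat.restrictScalars.{u} π).obj (ModuleCat.of B B)) (d + 1) := by
  have := X.isIso_toQuotient hπ
  have h0 := X.hasProjectiveDimensionLT (𝟭 _) (c := 0)
    (inferInstanceAs (HasProjectiveDimensionLT (ModuleCat.of R R) 1))
  rw [zero_add] at h0
  have : HasProjectiveDimensionLT (X.Y 0) (d + 1) := h0
  exact hasProjectiveDimensionLT_of_iso (asIso X.toQuotient) _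

end ChangeOfRings

/-! ### The top Ext group as a vector space. -/

section Linear

open Abelian

variable {k : Type u} [Field k] {S : Type u} [Ring S] [Algebra k S]

theorem map_eq_smul_map {C 𝒟 : Type*} [Category C] [Category 𝒟] [Preadditive C] [Preadditive 𝒟]
    [Linear k C] [Linear k 𝒟] (F : C ⥤ 𝒟) [F.Additive] [F.Linear k] {M N : C} {f g : M ⟶ N} {r : k}
    (h : g = r • f) : F.map g = r • F.map f := by
  rw [h, F.map_smul]

theorem restrictScalars_linear {R : Type u} [Ring R] [Algebra k R] (π : R →ₐ[k] S) :
    (ModuleCat.restrictScalars.{u} (π : R →+* S)).Linear k where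
  map_smul {M N} f c := by
    refine ModuleCat.hom_ext (LinearMap.ext fun x => ?_)
    change algebraMap k S c • f.hom x = π (algebraMap k R c) • f.hom x
    rw [AlgHom.commutes]

variable {𝒟 : Type*} [Category 𝒟] [Abelian 𝒟] [HasExt.{u} 𝒟] [Linear k 𝒟]
  (F : ModuleCat.{u} S ⥤ 𝒟) [F.Additive] [F.Linear k]
  [Limits.PreservesFiniteLimits F] [Limits.PreservesFiniteColimits F] {N : 𝒟} {c : ℕ}

/-- The map `s ↦ topClass e s` is linear and onto with kernel `J`, the kernel of `ε`; both quotients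
of `S` are therefore the same. -/
theorem FiniteFreeResolution.ext_linearEquiv {I J : Set S} {d : ℕ}
    (X : FiniteFreeResolution S I J d) {e : Ext (F.obj (ModuleCat.of S S)) N c}
    (he : IsExtGenerator F N c e) (ε : S →ₐ[k] k) (hJ : ∀ x, x ∈ J ↔ ε x = 0) :
    Nonempty (Ext (F.obj (X.Y 0)) N (c + d) ≃ₗ[k] k) := by
  let T : S →ₗ[k] Ext (F.obj (X.Y 0)) N (c + d) :=
    { toFun := X.topClass e
      map_add' := X.topClass_add
      map_smul' := fun r s => by
        have h : F.map (X.topHom ≫ mulRightHom (r • s)) = r • F.map (X.topHom ≫ mulRightHom s) := by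
          refine map_eq_smul_map F (ModuleCat.hom_ext (LinearMap.ext fun x => ?_))
          change X.topHom.hom x * (r • s) = algebraMap k S r * (X.topHom.hom x * s)
          rw [mul_smul_comm, Algebra.smul_def]
        simp only [topClass, h, Ext.mk₀_smul, Ext.smul_comp, Ext.comp_smul, RingHom.id_apply] }
  have hT : LinearMap.ker T = LinearMap.ker ε.toLinearMap := by
    ext x
    exact (X.topClass_eq_zero_iff he x).trans (hJ x)
  have hε : Function.Surjective ε.toLinearMap := fun r => ⟨algebraMap k S r, ε.commutes r⟩
  exact ⟨(T.quotKerEquivOfSurjective (X.topClass_surjective he)).symm ≪≫ₗ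
    Submodule.quotEquivOfEq _ _ hT ≪≫ₗ ε.toLinearMap.quotKerEquivOfSurjective hε⟩

end Linear

/-! ### Gradings by natural numbers, described by projections. -/

section Gradings

variable {k : Type u} [Field k] {M N : Type u} [AddCommGroup M] [Module k M] [AddCommGroup N]
  [Module k N]

/-- `x` is homogeneous of degree `n` for the family of projections `p`. -/
def Homog (p : ℕ → M →ₗ[k] M) (n : ℕ) (x : M) : Prop := ∀ m, p m x = if m = n then x else 0

/-- The family `p` consists of the projections of an `ℕ`-grading: `M` is spanned by homogeneous
elements. -/
def IsGrading (p : ℕ → M →ₗ[k] M) : Prop := ∀ x, x ∈ Submodule.span k {x | ∃ n, Homog p n x}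

variable {p : ℕ → M →ₗ[k] M} {q : ℕ → N →ₗ[k] N}

theorem Homog.zero (n : ℕ) : Homog p n 0 := fun m => by simp

theorem Homog.add {n : ℕ} {x y : M} (hx : Homog p n x) (hy : Homog p n y) : Homog p n (x + y) := by
  intro m
  rw [map_add, hx, hy]
  split_ifs <;> simp

theorem Homog.smul {n : ℕ} {x : M} (hx : Homog p n x) (c : k) : Homog p n (c • x) := by
  intro m
  rw [map_smul, hx]
  split_ifs <;> simp

theorem Homog.eq_self {n : ℕ} {x : M} (hx : Homog p n x) : p n x = x := by
  rw [hx, if_pos rfl]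

theorem IsGrading.homog (hp : IsGrading p) (n : ℕ) (x : M) : Homog p n (p n x) := by
  induction hp x using Submodule.span_induction with
  | mem x hx =>
    obtain ⟨m, hm⟩ := hx
    rw [hm n]
    split_ifs with h
    · exact h ▸ hm
    · exact Homog.zero n
  | zero => rw [map_zero]; exact Homog.zero n
  | add x y _ _ hx hy => rw [map_add]; exact hx.add hy
  | smul c x _ hx => rw [map_smul]; exact hx.smul c

/-- The sum is claimed for all large `N`, so that the bounds for two summands can be merged. -/
theorem IsGrading.exists_sum (hp : IsGrading p) (x : M) :
    ∃ N₀, ∀ N ≥ N₀, ∑ n ∈ Finset.range N, p n x = x := by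
  induction hp x using Submodule.span_induction with
  | mem x hx =>
    obtain ⟨m, hm⟩ := hx
    refine ⟨m + 1, fun N hN => ?_⟩
    rw [Finset.sum_congr rfl fun n _ => hm n, Finset.sum_ite_eq', if_pos (Finset.mem_range.2 hN)]
  | zero => exact ⟨0, fun N _ => by simp⟩
  | add x y _ _ hx hy =>
    obtain ⟨N₁, h₁⟩ := hx
    obtain ⟨N₂, h₂⟩ := hy
    refine ⟨max N₁ N₂, fun N hN => ?_⟩
    simp only [map_add, Finset.sum_add_distrib]
    rw [h₁ N (le_of_max_le_left hN), h₂ N (le_of_max_le_right hN)]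
  | smul c x _ hx =>
    obtain ⟨N₁, h₁⟩ := hx
    refine ⟨N₁, fun N hN => ?_⟩
    simp only [map_smul, ← Finset.smul_sum]
    rw [h₁ N hN]

theorem IsGrading.mem_of_proj_mem (hp : IsGrading p) {V : Submodule k M} {x : M}
    (h : ∀ n, p n x ∈ V) : x ∈ V := by
  obtain ⟨N, hN⟩ := hp.exists_sum x
  rw [← hN N le_rfl]
  exact V.sum_mem fun n _ => h n

theorem IsGrading.ext (hp : IsGrading p) {x y : M} (h : ∀ n, p n x = p n y) : x = y := by
  rw [← sub_eq_zero, ← Submodule.mem_bot k]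
  exact hp.mem_of_proj_mem fun n => by rw [map_sub, h, sub_self]; exact zero_mem _

/-- The restriction of a family of projections to a stable subspace. -/
def restrictProj (p : ℕ → M →ₗ[k] M) (V : Submodule k M) (hV : ∀ n, ∀ x ∈ V, p n x ∈ V) (n : ℕ) :
    V →ₗ[k] V := (p n).restrict (hV n)

theorem homog_restrictProj_iff {V : Submodule k M} {hV : ∀ n, ∀ x ∈ V, p n x ∈ V} {n : ℕ}
    {x : V} : Homog (restrictProj p V hV) n x ↔ Homog p n (x : M) := by
  refine forall_congr' fun m => ?_
  rw [← Subtype.coe_inj]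
  split_ifs <;> rfl

theorem IsGrading.restrictProj (hp : IsGrading p) {V : Submodule k M}
    (hV : ∀ n, ∀ x ∈ V, p n x ∈ V) : IsGrading (restrictProj p V hV) := by
  intro x
  obtain ⟨N, hN⟩ := hp.exists_sum x
  have : x = ∑ n ∈ Finset.range N, _root_.restrictProj p V hV n x := by
    ext
    rw [AddSubmonoidClass.coe_finsetSum]
    exact (hN N le_rfl).symm
  rw [this]
  exact Submodule.sum_mem _ fun n _ => Submodule.subset_span
    ⟨n, homog_restrictProj_iff.2 (hp.homog n x)⟩

/-- The projections of the tensor product grading. -/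
def tensorProj (p : ℕ → M →ₗ[k] M) (q : ℕ → N →ₗ[k] N) (n : ℕ) : M ⊗[k] N →ₗ[k] M ⊗[k] N :=
  ∑ ij ∈ Finset.HasAntidiagonal.antidiagonal n, TensorProduct.map (p ij.1) (q ij.2)

theorem Homog.tmul {i j : ℕ} {x : M} {y : N} (hx : Homog p i x) (hy : Homog q j y) :
    Homog (tensorProj p q) (i + j) (x ⊗ₜ[k] y) := by
  intro n
  simp only [tensorProj, LinearMap.sum_apply, TensorProduct.map_tmul, hx _, hy _]
  have : ∀ ab : ℕ × ℕ, (if ab.1 = i then x else 0) ⊗ₜ[k] (if ab.2 = j then y else 0) =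
      if ab = (i, j) then x ⊗ₜ[k] y else 0 := by
    rintro ⟨a, b⟩
    simp only [Prod.mk.injEq]
    split_ifs <;> simp_all
  rw [Finset.sum_congr rfl fun ab _ => this ab, Finset.sum_ite_eq']
  simp [eq_comm]

theorem IsGrading.tensorProj (hp : IsGrading p) (hq : IsGrading q) :
    IsGrading (tensorProj p q) := by
  intro z
  induction z with
  | zero => exact zero_mem _
  | add x y hx hy => exact add_mem hx hy
  | tmul x y =>
    obtain ⟨N₁, h₁⟩ := hp.exists_sum x
    obtain ⟨N₂, h₂⟩ := hq.exists_sum y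
    rw [← h₁ N₁ le_rfl, ← h₂ N₂ le_rfl, TensorProduct.sum_tmul]
    refine Submodule.sum_mem _ fun i _ => ?_
    rw [TensorProduct.tmul_sum]
    exact Submodule.sum_mem _ fun j _ => Submodule.subset_span
      ⟨i + j, (hp.homog i x).tmul (hq.homog j y)⟩

end Gradings

/-! ### Graded modules, the graded Nakayama lemma and minimal generators. -/

section GradedModules

variable {k : Type u} [Field k] {A : Type u} [Ring A] [Algebra k A]

/-- `pA` are the projections of a connected `ℕ`-grading of the algebra `A` with augmentation
`ε`. -/
structure IsConnectedProj (pA : ℕ → A →ₗ[k] A) (ε : A →ₐ[k] k) : Prop where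
  isGrading : IsGrading pA
  mul : ∀ {i j a b}, Homog pA i a → Homog pA j b → Homog pA (i + j) (a * b)
  zero : ∀ a, pA 0 a = algebraMap k A (ε a)

variable {pA : ℕ → A →ₗ[k] A} {ε : A →ₐ[k] k}

theorem IsConnectedProj.homog_algebraMap (hA : IsConnectedProj pA ε) (c : k) :
    Homog pA 0 (algebraMap k A c) := by
  have h : pA 0 (algebraMap k A c) = algebraMap k A c := by
    rw [hA.zero]
    exact congrArg _ (ε.commutes c)
  rw [← h]
  exact hA.isGrading.homog _ _

theorem IsConnectedProj.aug_eq_zero (hA : IsConnectedProj pA ε) {n : ℕ} (hn : n ≠ 0) {a : A}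
    (ha : Homog pA n a) : ε a = 0 := by
  have h := hA.zero a
  rw [ha, if_neg hn.symm] at h
  have := congrArg ε h
  rw [map_zero] at this
  exact this.trans (ε.commutes _) |>.symm

theorem IsConnectedProj.eq_of_aug_eq_zero (hA : IsConnectedProj pA ε) {a : A} (ha : ε a = 0) :
    pA 0 a = 0 := by
  rw [hA.zero, ha, map_zero]

variable (pA) in
/-- A graded left module over `A`. -/
structure GradedMod where
  carrier : Type u
  [addCommGroup : AddCommGroup carrier]
  [moduleBase : Module k carrier]
  [module : Module A carrier]
  [isScalarTower : IsScalarTower k A carrier]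
  p : ℕ → carrier →ₗ[k] carrier
  isGrading : IsGrading p
  smul : ∀ {i j a x}, Homog pA i a → Homog p j x → Homog p (i + j) (a • x)

namespace GradedMod

attribute [instance] addCommGroup moduleBase module isScalarTower

variable (G : GradedMod pA)

variable (ε) in
/-- The submodule `A_{≥ 1} G`. -/
def aug : Submodule A G.carrier := Submodule.span A {y | ∃ a x, ε a = 0 ∧ y = a • x}

/-- An element with `ε a = 0` has only components of positive degree. Degree arguments therefore
apply to `A_{≥ 1} G` through products with a homogeneous first factor of degree at least one. -/
theorem aug_le_span (hA : IsConnectedProj pA ε) {y : G.carrier} (hy : y ∈ G.aug ε) :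
    y ∈ Submodule.span k {y : G.carrier | ∃ i j a x, 1 ≤ i ∧ Homog pA i a ∧ Homog G.p j x ∧
      y = a • x} := by
  have key : ∀ (a : A) (x : G.carrier), ε a = 0 → a • x ∈ Submodule.span k
      {y : G.carrier | ∃ i j a x, 1 ≤ i ∧ Homog pA i a ∧ Homog G.p j x ∧ y = a • x} := by
    intro a x ha
    obtain ⟨N₁, h₁⟩ := hA.isGrading.exists_sum a
    obtain ⟨N₂, h₂⟩ := G.isGrading.exists_sum x
    rw [← h₁ N₁ le_rfl, ← h₂ N₂ le_rfl, Finset.sum_smul]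
    refine Submodule.sum_mem _ fun i _ => ?_
    rw [Finset.smul_sum]
    refine Submodule.sum_mem _ fun j _ => ?_
    rcases Nat.eq_zero_or_pos i with rfl | hi
    · rw [hA.eq_of_aug_eq_zero ha, zero_smul]
      exact zero_mem _
    · exact Submodule.subset_span ⟨i, j, _, _, hi, hA.isGrading.homog _ _,
        G.isGrading.homog _ _, rfl⟩
  induction hy using Submodule.span_induction with
  | mem y hy =>
    obtain ⟨a, x, ha, rfl⟩ := hy
    exact key a x ha
  | zero => exact zero_mem _
  | add x y _ _ hx hy => exact add_mem hx hy
  | smul b y hy' hy =>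
    have h1 : b = algebraMap k A (ε b) + (b - algebraMap k A (ε b)) := by abel
    rw [h1, add_smul]
    refine add_mem ?_ (key _ _ ?_)
    · rw [algebraMap_smul]
      exact Submodule.smul_mem _ _ hy
    · rw [map_sub]
      exact sub_eq_zero.2 (ε.commutes _).symm

theorem smul_mem_aug {a : A} (ha : ε a = 0) (x : G.carrier) : a • x ∈ G.aug ε :=
  Submodule.subset_span ⟨a, x, ha, rfl⟩

theorem proj_mem_aug (hA : IsConnectedProj pA ε) (n : ℕ) {y : G.carrier} (hy : y ∈ G.aug ε) :
    G.p n y ∈ G.aug ε := by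
  have h := G.aug_le_span hA hy
  clear hy
  induction h using Submodule.span_induction with
  | mem y hy =>
    obtain ⟨i, j, a, x, hi, ha, hx, rfl⟩ := hy
    rw [G.smul ha hx]
    split_ifs
    · exact G.smul_mem_aug (hA.aug_eq_zero (by lia) ha) x
    · exact zero_mem _
  | zero => rw [map_zero]; exact zero_mem _
  | add x y _ _ hx hy => rw [map_add]; exact add_mem hx hy
  | smul c x _ hx =>
    rw [map_smul, ← algebraMap_smul A c]
    exact Submodule.smul_mem _ _ hx

/-- The graded Nakayama lemma. -/
theorem eq_top_of_sup_aug (hA : IsConnectedProj pA ε) (N : Submodule A G.carrier)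
    (hN : ∀ n, ∀ x ∈ N, G.p n x ∈ N) (h : ∀ x, ∃ y ∈ N, x - y ∈ G.aug ε) : N = ⊤ := by
  -- Modulo `N`, a component of degree `n` is a combination of products `a • z` with `a` of positive
  -- degree, so `z` has degree below `n` and the induction applies.
  have key : ∀ n, ∀ x, G.p n x ∈ N := by
    intro n
    induction n using Nat.strong_induction_on with
    | _ n ih =>
      have hk : ∀ c : k, ∀ y ∈ N, c • y ∈ N := fun c y hy => by
        rw [← algebraMap_smul A c]
        exact Submodule.smul_mem _ _ hy
      intro x
      obtain ⟨y, hy, hxy⟩ := h x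
      have h1 : G.p n (x - y) ∈ N := by
        have h := G.aug_le_span hA hxy
        clear hxy
        generalize x - y = z at h ⊢
        induction h using Submodule.span_induction with
        | mem z hz =>
          obtain ⟨i, j, a, z, hi, ha, hz, rfl⟩ := hz
          rw [G.smul ha hz]
          split_ifs with h
          · rw [← hz.eq_self]
            exact Submodule.smul_mem _ _ (ih j (by lia) z)
          · exact zero_mem _
        | zero => rw [map_zero]; exact zero_mem _
        | add x y _ _ hx hy => rw [map_add]; exact add_mem hx hy
        | smul c x _ hx => rw [map_smul]; exact hk _ _ hx
      rw [map_sub] at h1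
      have := add_mem h1 (hN n y hy)
      rwa [sub_add_cancel] at this
  refine eq_top_iff.2 fun x _ => ?_
  obtain ⟨N₀, hN₀⟩ := G.isGrading.exists_sum x
  rw [← hN₀ N₀ le_rfl]
  exact Submodule.sum_mem _ fun n _ => key n x

theorem subsingleton_of_aug (hA : IsConnectedProj pA ε) (h : ∀ x, x ∈ G.aug ε) :
    Subsingleton G.carrier := by
  have := G.eq_top_of_sup_aug hA ⊥ (fun n x hx => by
    rw [(Submodule.mem_bot A).1 hx, map_zero]; exact zero_mem _)
    fun x => ⟨0, zero_mem _, by rw [sub_zero]; exact h x⟩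
  exact subsingleton_of_forall_eq 0 fun x => (Submodule.mem_bot A).1 (this ▸ Submodule.mem_top)

/-- In every degree, a linear complement of the part of `A_{≥ 1} G` is chosen inside the homogeneous
part. -/
theorem exists_generators (hA : IsConnectedProj pA ε) :
    ∃ V : Submodule k G.carrier, (∀ n, ∀ x ∈ V, G.p n x ∈ V) ∧ (∀ x ∈ V, x ∈ G.aug ε → x = 0) ∧
      ∀ x, ∃ v ∈ V, x - v ∈ G.aug ε := by
  have h1 : ∀ n, ∃ V : Submodule k G.carrier, V ≤ LinearMap.range (G.p n) ∧
      (∀ x ∈ V, x ∈ G.aug ε → x = 0) ∧ ∀ x, ∃ v ∈ V, G.p n x - v ∈ G.aug ε := by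
    intro n
    let a : Submodule k G.carrier := (G.aug ε).restrictScalars k
    let L := LinearMap.range (G.p n)
    obtain ⟨W, hW⟩ := Submodule.exists_isCompl (a.comap L.subtype)
    refine ⟨W.map L.subtype, ?_, ?_, ?_⟩
    · rintro _ ⟨x, -, rfl⟩
      exact x.2
    · rintro _ ⟨x, hx, rfl⟩ hxa
      have : x = 0 := (Submodule.mem_bot k).1 (hW.disjoint.le_bot ⟨hxa, hx⟩)
      rw [this, map_zero]
    · intro x
      obtain ⟨y, hy, z, hz, hyz⟩ := Submodule.mem_sup.1
        (hW.codisjoint.eq_top ▸ Submodule.mem_top :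
          (⟨G.p n x, x, rfl⟩ : L) ∈ a.comap L.subtype ⊔ W)
      refine ⟨z, ⟨z, hz, rfl⟩, ?_⟩
      have : G.p n x - z = y := by
        rw [sub_eq_iff_eq_add]
        exact (congrArg Subtype.val hyz).symm
      rw [this]
      exact hy
  choose V hV1 hV2 hV3 using h1
  have hVh : ∀ n, ∀ x ∈ V n, Homog G.p n x := by
    intro n x hx
    obtain ⟨y, rfl⟩ := hV1 n hx
    exact G.isGrading.homog n y
  have hproj : ∀ n, ∀ x ∈ ⨆ n, V n, G.p n x ∈ V n := by
    intro n x hx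
    induction hx using Submodule.iSup_induction' with
    | mem m x hx =>
      rw [hVh m x hx n]
      split_ifs with h
      · exact h ▸ hx
      · exact zero_mem _
    | zero => rw [map_zero]; exact zero_mem _
    | add x y _ _ hx hy => rw [map_add]; exact add_mem hx hy
  refine ⟨⨆ n, V n, fun n x hx => (le_iSup V n) (hproj n x hx), fun x hx hxa => ?_, fun x => ?_⟩
  · refine G.isGrading.ext fun n => ?_
    rw [map_zero]
    exact hV2 n _ (hproj n x hx) (G.proj_mem_aug hA n hxa)
  · choose v hv hv' using fun n => hV3 n x
    obtain ⟨N, hN⟩ := G.isGrading.exists_sum x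
    refine ⟨∑ n ∈ Finset.range N, v n, Submodule.sum_mem _ fun n _ => le_iSup V n (hv n), ?_⟩
    conv => enter [2, 1]; rw [← hN N le_rfl]
    rw [← Finset.sum_sub_distrib]
    exact Submodule.sum_mem _ fun n _ => hv' n

end GradedMod

end GradedModules

/-! ### Covers of graded modules by free modules and their kernels. -/

section Covers

variable {k : Type u} [Field k] {A : Type u} [Ring A] [Algebra k A]

/-- The `A`-linear map `A ⊗ V → M`, `a ⊗ v ↦ a f(v)`, induced by a linear map `f : V → M`. -/
def actionMap (A : Type u) [Ring A] [Algebra k A] {V M : Type u} [AddCommGroup V] [Module k V]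
    [AddCommGroup M] [Module k M] [Module A M] [IsScalarTower k A M] (f : V →ₗ[k] M) :
    A ⊗[k] V →ₗ[A] M :=
  TensorProduct.AlgebraTensorModule.lift
    { toFun := fun a =>
        { toFun := fun v => a • f v
          map_add' := fun v w => by rw [map_add, smul_add]
          map_smul' := fun c v => by rw [map_smul, RingHom.id_apply, smul_comm] }
      map_add' := fun a b => LinearMap.ext fun v => add_smul a b (f v)
      map_smul' := fun a b => LinearMap.ext fun v => mul_smul a b (f v) }

@[simp] theorem actionMap_tmul {V M : Type u} [AddCommGroup V] [Module k V]
    [AddCommGroup M] [Module k M] [Module A M] [IsScalarTower k A M] (f : V →ₗ[k] M) (a : A)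
    (v : V) : actionMap A f (a ⊗ₜ v) = a • f v := rfl

variable {pA : ℕ → A →ₗ[k] A} {ε : A →ₐ[k] k}

theorem tensorProj_mem_span {V : Type u} [AddCommGroup V] [Module k V] {q : ℕ → V →ₗ[k] V}
    (hA : IsGrading pA) (hq : IsGrading q) (n : ℕ) (z : A ⊗[k] V) :
    tensorProj pA q n z ∈ Submodule.span k {z : A ⊗[k] V | ∃ i j a v, i + j = n ∧ Homog pA i a ∧
      Homog q j v ∧ z = a ⊗ₜ v} := by
  induction z with
  | zero => rw [map_zero]; exact zero_mem _
  | add x y hx hy => rw [map_add]; exact add_mem hx hy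
  | tmul a v =>
    simp only [tensorProj, LinearMap.sum_apply, TensorProduct.map_tmul]
    exact Submodule.sum_mem _ fun ij hij => Submodule.subset_span ⟨ij.1, ij.2, _, _,
      Finset.HasAntidiagonal.mem_antidiagonal.1 hij, hA.homog _ _, hq.homog _ _, rfl⟩

theorem Homog.smul_tensor {V : Type u} [AddCommGroup V] [Module k V] {q : ℕ → V →ₗ[k] V}
    (hA : IsConnectedProj pA ε) (hq : IsGrading q) {i n : ℕ} {a : A} {z : A ⊗[k] V}
    (ha : Homog pA i a) (hz : Homog (tensorProj pA q) n z) :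
    Homog (tensorProj pA q) (i + n) (a • z) := by
  have h := tensorProj_mem_span hA.isGrading hq n z
  rw [hz.eq_self] at h
  clear hz
  induction h using Submodule.span_induction with
  | mem z hz =>
    obtain ⟨l, j, b, v, rfl, hb, hv, rfl⟩ := hz
    rw [TensorProduct.smul_tmul', smul_eq_mul, ← add_assoc]
    exact (hA.mul ha hb).tmul hv
  | zero => rw [smul_zero]; exact Homog.zero _
  | add x y _ _ hx hy => rw [smul_add]; exact hx.add hy
  | smul c x _ hx => rw [smul_comm]; exact hx.smul c

namespace GradedMod

variable (G : GradedMod pA)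

theorem actionMap_tensorProj (hA : IsConnectedProj pA ε) {V : Type u} [AddCommGroup V] [Module k V]
    {q : ℕ → V →ₗ[k] V} (hq : IsGrading q) {f : V →ₗ[k] G.carrier}
    (hf : ∀ n v, Homog q n v → Homog G.p n (f v)) (n : ℕ) (z : A ⊗[k] V) :
    actionMap A f (tensorProj pA q n z) = G.p n (actionMap A f z) := by
  induction hA.isGrading.tensorProj hq z using Submodule.span_induction with
  | mem z hz =>
    obtain ⟨m, hm⟩ := hz
    have h := tensorProj_mem_span hA.isGrading hq m z
    rw [hm.eq_self] at h
    clear hm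
    induction h using Submodule.span_induction with
    | mem z hz =>
      obtain ⟨l, j, b, v, rfl, hb, hv, rfl⟩ := hz
      rw [hb.tmul hv, actionMap_tmul, G.smul hb (hf _ _ hv)]
      split_ifs <;> simp
    | zero => simp
    | add x y _ _ hx hy => simp only [map_add, hx, hy]
    | smul c x _ hx =>
      rw [map_smul, LinearMap.map_smul_of_tower, hx, LinearMap.map_smul_of_tower, map_smul]
  | zero => simp
  | add x y _ _ hx hy => simp only [map_add, hx, hy]
  | smul c x _ hx =>
    rw [map_smul, LinearMap.map_smul_of_tower, hx, LinearMap.map_smul_of_tower, map_smul]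

theorem tensorProj_mem_ker (hA : IsConnectedProj pA ε) {V : Type u} [AddCommGroup V] [Module k V]
    {q : ℕ → V →ₗ[k] V} (hq : IsGrading q) {f : V →ₗ[k] G.carrier}
    (hf : ∀ n v, Homog q n v → Homog G.p n (f v)) (n : ℕ) (z : A ⊗[k] V)
    (hz : z ∈ (LinearMap.ker (actionMap A f)).restrictScalars k) :
    tensorProj pA q n z ∈ (LinearMap.ker (actionMap A f)).restrictScalars k := by
  change actionMap A f _ = 0
  rw [actionMap_tensorProj G hA hq hf, show actionMap A f z = 0 from hz, map_zero]

/-- The kernel of the action map `A ⊗ V → G` as a graded module. -/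
def kerAction (hA : IsConnectedProj pA ε) {V : Type u} [AddCommGroup V] [Module k V]
    (q : ℕ → V →ₗ[k] V) (hq : IsGrading q) (f : V →ₗ[k] G.carrier)
    (hf : ∀ n v, Homog q n v → Homog G.p n (f v)) : GradedMod pA where
  carrier := LinearMap.ker (actionMap A f)
  p := restrictProj (tensorProj pA q) _ (G.tensorProj_mem_ker hA hq hf)
  isGrading := (hA.isGrading.tensorProj hq).restrictProj _
  smul {i j a x} ha hx := by
    exact homog_restrictProj_iff.2 (Homog.smul_tensor hA hq ha (homog_restrictProj_iff.1 hx))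

theorem homog_kerAction_iff {hA : IsConnectedProj pA ε} {V : Type u} [AddCommGroup V] [Module k V]
    {q : ℕ → V →ₗ[k] V} {hq : IsGrading q} {f : V →ₗ[k] G.carrier}
    {hf : ∀ n v, Homog q n v → Homog G.p n (f v)} {n : ℕ} (z : LinearMap.ker (actionMap A f)) :
    Homog (M := (G.kerAction hA q hq f hf).carrier) (G.kerAction hA q hq f hf).p n z ↔
      Homog (tensorProj pA q) n z.1 :=
  homog_restrictProj_iff (hV := G.tensorProj_mem_ker hA hq hf)

/-- The short complex `ker → A ⊗ V → G`. -/
def coverComplex (hA : IsConnectedProj pA ε) {V : Type u} [AddCommGroup V] [Module k V]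
    (q : ℕ → V →ₗ[k] V) (hq : IsGrading q) (f : V →ₗ[k] G.carrier)
    (hf : ∀ n v, Homog q n v → Homog G.p n (f v)) : ShortComplex (ModuleCat.{u} A) where
  X₁ := ModuleCat.of A (G.kerAction hA q hq f hf).carrier
  X₂ := ModuleCat.of A (A ⊗[k] V)
  X₃ := ModuleCat.of A G.carrier
  f := ModuleCat.ofHom (LinearMap.ker (actionMap A f)).subtype
  g := ModuleCat.ofHom (actionMap A f)
  zero := by
    refine ModuleCat.hom_ext (LinearMap.ext fun x => ?_)
    exact x.2

theorem coverComplex_shortExact (hA : IsConnectedProj pA ε) {V : Type u} [AddCommGroup V]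
    [Module k V] (q : ℕ → V →ₗ[k] V) (hq : IsGrading q) (f : V →ₗ[k] G.carrier)
    (hf : ∀ n v, Homog q n v → Homog G.p n (f v)) (hs : Function.Surjective (actionMap A f)) :
    (G.coverComplex hA q hq f hf).ShortExact := by
  refine ModuleCat.shortComplex_shortExact _ ?_ (Submodule.subtype_injective _) hs
  intro x
  constructor
  · intro hx
    exact ⟨⟨x, hx⟩, rfl⟩
  · rintro ⟨x, rfl⟩
    exact x.2

instance projective_tensor {V : Type u} [AddCommGroup V] [Module k V] :
    Projective (ModuleCat.of A (A ⊗[k] V)) :=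
  ModuleCat.projective_of_categoryTheory_projective _

end GradedMod
end Covers

/-! ### Modules that are deformations of graded modules. -/

section Deformation

variable {k : Type u} [Field k] {A : Type u} [Ring A] [Algebra k A]
variable {pA : ℕ → A →ₗ[k] A} {ε : A →ₐ[k] k}

/-- All components of `x` in degrees `≥ n` vanish. -/
def Below {M : Type u} [AddCommGroup M] [Module k M] (p : ℕ → M →ₗ[k] M) (n : ℕ) (x : M) : Prop :=
  ∀ m, n ≤ m → p m x = 0

section Below

variable {M : Type u} [AddCommGroup M] [Module k M] {p : ℕ → M →ₗ[k] M}

theorem Below.zero (n : ℕ) : Below p n 0 := fun _ _ => map_zero _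

theorem Below.add {n : ℕ} {x y : M} (hx : Below p n x) (hy : Below p n y) : Below p n (x + y) :=
  fun m hm => by rw [map_add, hx m hm, hy m hm, add_zero]

theorem Below.neg {n : ℕ} {x : M} (hx : Below p n x) : Below p n (-x) :=
  fun m hm => by rw [map_neg, hx m hm, neg_zero]

theorem Below.smul {n : ℕ} {x : M} (hx : Below p n x) (c : k) : Below p n (c • x) :=
  fun m hm => by rw [map_smul, hx m hm, smul_zero]

theorem Below.mono {n m : ℕ} {x : M} (hx : Below p n x) (h : n ≤ m) : Below p m x :=
  fun l hl => hx l (h.trans hl)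

theorem Homog.below {n : ℕ} {x : M} (hx : Homog p n x) : Below p (n + 1) x :=
  fun m hm => by rw [hx, if_neg (by lia)]

theorem IsGrading.exists_below (hp : IsGrading p) (x : M) : ∃ n, Below p n x := by
  obtain ⟨N, hN⟩ := hp.exists_sum x
  refine ⟨N, fun m hm => ?_⟩
  rw [← hN N le_rfl, map_sum]
  refine Finset.sum_eq_zero fun n hn => ?_
  rw [hp.homog n x m, if_neg (by have := Finset.mem_range.1 hn; lia)]

theorem Below.sub_proj (hp : IsGrading p) {n : ℕ} {x : M} (hx : Below p (n + 1) x) :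
    Below p n (x - p n x) := by
  intro m hm
  rw [map_sub, hp.homog n x m]
  split_ifs with h
  · rw [h, sub_self]
  · rw [hx m (by lia), sub_zero]

theorem Below.eq_sum (hp : IsGrading p) {n : ℕ} {x : M} (hx : Below p n x) :
    x = ∑ i ∈ Finset.range n, p i x := by
  refine hp.ext fun m => ?_
  rw [map_sum, Finset.sum_congr rfl fun i _ => hp.homog i x m, Finset.sum_ite_eq]
  split_ifs with h
  · rfl
  · exact hx m (by simpa using h)

/-- An endomorphism that is the identity up to terms of lower degree is bijective. -/
theorem bijective_of_sub_below (hp : IsGrading p) (T : M →ₗ[k] M)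
    (hT : ∀ n x, Homog p n x → Below p n (T x - x)) : Function.Bijective T := by
  -- The hypothesis extends to inhomogeneous elements: `T` is the identity on the associated graded
  -- space of the degree filtration.
  have hT' : ∀ n x, Below p (n + 1) x → Below p n (T x - x) := by
    intro n x hx
    rw [hx.eq_sum hp, map_sum, ← Finset.sum_sub_distrib]
    refine Finset.sum_induction _ (Below p n) (fun _ _ => Below.add) (Below.zero n) fun i hi => ?_
    exact (hT i _ (hp.homog i x)).mono (by have := Finset.mem_range.1 hi; lia)
  constructor
  · rw [injective_iff_map_eq_zero]
    intro x hx
    obtain ⟨n, hn⟩ := hp.exists_below x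
    induction n with
    | zero => exact hp.ext fun m => by rw [hn m (Nat.zero_le m), map_zero]
    | succ n ih =>
      apply ih
      have := hT' n x hn
      rw [hx, zero_sub] at this
      simpa using this.neg
  · intro y
    obtain ⟨n, hn⟩ := hp.exists_below y
    induction n generalizing y with
    | zero => exact ⟨0, by rw [map_zero]; exact hp.ext fun m => by rw [hn m (Nat.zero_le m), map_zero]⟩
    | succ n ih =>
      have h1 : Below p n (y - T (p n y)) := by
        have h2 := (hn.sub_proj hp).add (hT n _ (hp.homog n y)).neg
        rwa [neg_sub, sub_add_sub_cancel] at h2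
      obtain ⟨x, hx⟩ := ih _ h1
      exact ⟨x + p n y, by rw [map_add, hx, sub_add_cancel]⟩

end Below

variable (G : GradedMod pA) {K : Type u} [AddCommGroup K] [Module k K] [Module A K]
  [IsScalarTower k A K] (θ : G.carrier ≃ₗ[k] K)

/-- `θ` is `A`-linear up to terms of lower degree. -/
def GradedMod.IsDeformation : Prop := ∀ i j a x, Homog pA i a → Homog G.p j x →
  Below G.p (i + j) (θ.symm (a • θ x) - a • x)

variable {G θ}

/-- The same generators, carried over by `θ`, give a map onto the deformed module that agrees with
the graded one in leading degree. -/
theorem GradedMod.IsDeformation.actionMap (hA : IsConnectedProj pA ε) (hθ : G.IsDeformation θ)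
    {V : Type u} [AddCommGroup V] [Module k V]
    {q : ℕ → V →ₗ[k] V} (hq : IsGrading q) {f : V →ₗ[k] G.carrier}
    (hf : ∀ n v, Homog q n v → Homog G.p n (f v)) {n : ℕ} {z : A ⊗[k] V}
    (hz : Homog (tensorProj pA q) n z) :
    Below G.p n (θ.symm (actionMap A (θ.toLinearMap ∘ₗ f) z) - actionMap A f z) := by
  have h := tensorProj_mem_span hA.isGrading hq n z
  rw [hz.eq_self] at h
  clear hz
  induction h using Submodule.span_induction with
  | mem z hz =>
    obtain ⟨l, j, b, v, rfl, hb, hv, rfl⟩ := hz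
    rw [actionMap_tmul, actionMap_tmul]
    exact hθ _ _ _ _ hb (hf _ _ hv)
  | zero => simpa using Below.zero n
  | add x y _ _ hx hy =>
    simp only [map_add, add_sub_add_comm]
    exact hx.add hy
  | smul c x _ hx =>
    rw [LinearMap.map_smul_of_tower, LinearMap.map_smul_of_tower, map_smul, ← smul_sub]
    exact hx.smul c

end Deformation

/-! ### Projective dimension of direct sums. -/

section Finsupp

variable {A : Type u} [Ring A]

theorem hasProjectiveDimensionLT_iff_of_exact {X Y Z : Type u} [AddCommGroup X] [Module A X]
    [AddCommGroup Y] [Module A Y] [AddCommGroup Z] [Module A Z] [Module.Projective A Y]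
    {f : X →ₗ[A] Y} {g : Y →ₗ[A] Z} (hf : Function.Injective f) (hfg : Function.Exact f g)
    (hg : Function.Surjective g) (d : ℕ) :
    HasProjectiveDimensionLT (ModuleCat.of A Z) (d + 2) ↔
      HasProjectiveDimensionLT (ModuleCat.of A X) (d + 1) := by
  let S : ShortComplex (ModuleCat.{u} A) :=
    { X₁ := ModuleCat.of A X
      X₂ := ModuleCat.of A Y
      X₃ := ModuleCat.of A Z
      f := ModuleCat.ofHom f
      g := ModuleCat.ofHom g
      zero := ModuleCat.hom_ext (LinearMap.ext fun x => hfg.apply_apply_eq_zero x) }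
  have hS : S.ShortExact := ModuleCat.shortComplex_shortExact _ hfg hf hg
  exact hS.hasProjectiveDimensionLT_X₃_iff d (ModuleCat.projective_of_categoryTheory_projective
    (ModuleCat.of A Y))

theorem exact_mapRange {X Y Z : Type u} [AddCommGroup X] [Module A X]
    [AddCommGroup Y] [Module A Y] [AddCommGroup Z] [Module A Z] (I : Type u)
    {f : X →ₗ[A] Y} {g : Y →ₗ[A] Z} (hf : Function.Injective f) (hfg : Function.Exact f g) :
    Function.Exact (Finsupp.mapRange.linearMap (α := I) f) (Finsupp.mapRange.linearMap g) := by
  intro y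
  constructor
  · intro hy
    have hy' : ∀ i, f (Function.invFun f (y i)) = y i := fun i =>
      Function.invFun_eq ((hfg _).1 (DFunLike.congr_fun hy i))
    exact ⟨y.mapRange (Function.invFun f) (hf (Function.invFun_eq ⟨0, map_zero f⟩ |>.trans
      (map_zero f).symm)), Finsupp.ext hy'⟩
  · rintro ⟨x, rfl⟩
    exact Finsupp.ext fun i => hfg.apply_apply_eq_zero (x i)

instance projective_finsupp (I X : Type u) [AddCommGroup X] [Module A X] [Module.Projective A X] :
    Module.Projective A (I →₀ X) := by
  classical
  exact Module.Projective.of_equiv (finsuppLequivDFinsupp A).symm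

/-- Copies of a free cover form a projective cover of the direct sum, with kernel the copies of the
kernel; dimension shifting reduces to sums of projectives. -/
theorem hasProjectiveDimensionLT_finsupp (I : Type u) (d : ℕ) :
    ∀ (X : Type u) [AddCommGroup X] [Module A X],
      HasProjectiveDimensionLT (ModuleCat.of A X) (d + 1) →
      HasProjectiveDimensionLT (ModuleCat.of A (I →₀ X)) (d + 1) := by
  induction d with
  | zero =>
    intro X _ _ h
    rw [zero_add, ← projective_iff_hasProjectiveDimensionLT_one,
      ← IsProjective.iff_projective] at h ⊢
    exact projective_finsupp I X
  | succ d ih =>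
    intro X _ _ h
    obtain ⟨Y, _, _, _, g, hg⟩ : ∃ (Y : Type u) (_ : AddCommGroup Y) (_ : Module A Y)
        (_ : Module.Projective A Y) (g : Y →ₗ[A] X), Function.Surjective g :=
      ⟨X →₀ A, _, _, inferInstance, _, Finsupp.linearCombination_id_surjective A X⟩
    have hf := Submodule.subtype_injective (LinearMap.ker g)
    have he := LinearMap.exact_subtype_ker_map g
    exact (hasProjectiveDimensionLT_iff_of_exact (Finsupp.mapRange_injective _ (map_zero _) hf)
      (exact_mapRange I hf he) (Finsupp.mapRange_surjective _ (map_zero _) hg) d).2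
      (ih _ ((hasProjectiveDimensionLT_iff_of_exact hf he hg d).1 h))

end Finsupp

/-! ### Minimal covers, and projective dimension of deformations. -/

section GlobalDimension

variable {k : Type u} [Field k] {A : Type u} [Ring A] [Algebra k A]
variable {pA : ℕ → A →ₗ[k] A} {ε : A →ₐ[k] k}

variable (ε) in
/-- The linear map `A ⊗ V → V`, `a ⊗ v ↦ ε(a) v`. -/
def augTensor (V : Type u) [AddCommGroup V] [Module k V] : A ⊗[k] V →ₗ[k] V :=
  (TensorProduct.lid k V).toLinearMap ∘ₗ LinearMap.rTensor V ε.toLinearMap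

@[simp] theorem augTensor_tmul {V : Type u} [AddCommGroup V] [Module k V] (a : A) (v : V) :
    augTensor ε V (a ⊗ₜ v) = ε a • v := by
  simp [augTensor]

/-- On pure tensors the difference is `(a - ε(a)) • (1 ⊗ v)`. -/
theorem sub_augTensor_mem_span {V : Type u} [AddCommGroup V] [Module k V] (z : A ⊗[k] V) :
    z - 1 ⊗ₜ augTensor ε V z ∈
      Submodule.span A {y : A ⊗[k] V | ∃ a x, ε a = 0 ∧ y = a • x} := by
  induction z with
  | zero => simp
  | add x y hx hy =>
    rw [map_add, TensorProduct.tmul_add, add_sub_add_comm]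
    exact add_mem hx hy
  | tmul a v =>
    refine Submodule.subset_span ⟨a - algebraMap k A (ε a), 1 ⊗ₜ v, ?_, ?_⟩
    · rw [map_sub]
      exact sub_eq_zero.2 (ε.commutes _).symm
    · rw [augTensor_tmul, TensorProduct.smul_tmul', smul_eq_mul, mul_one, TensorProduct.sub_tmul,
        Algebra.algebraMap_eq_smul_one, TensorProduct.smul_tmul]

namespace GradedMod

variable (G : GradedMod pA)

theorem actionMap_sub_mem_aug {V : Type u} [AddCommGroup V] [Module k V] (f : V →ₗ[k] G.carrier)
    (z : A ⊗[k] V) : actionMap A f z - f (augTensor ε V z) ∈ G.aug ε := by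
  have h := Submodule.mem_map_of_mem (f := actionMap A f) (sub_augTensor_mem_span (ε := ε) z)
  rw [map_sub, actionMap_tmul, one_smul, Submodule.map_span] at h
  refine Submodule.span_mono ?_ h
  rintro _ ⟨_, ⟨a, x, ha, rfl⟩, rfl⟩
  exact ⟨a, actionMap A f x, ha, map_smul _ _ _⟩

/-- Nakayama gives surjectivity. Minimality is the last clause: a relation reduces to a generator
lying in `A_{≥ 1} G`, which is zero by the choice of `V`. -/
theorem exists_minimal_cover (hA : IsConnectedProj pA ε) :
    ∃ (V : Submodule k G.carrier) (hV : ∀ n, ∀ x ∈ V, G.p n x ∈ V),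
      IsGrading (restrictProj G.p V hV) ∧
      (∀ n v, Homog (restrictProj G.p V hV) n v → Homog G.p n (V.subtype v)) ∧
      (∀ x ∈ V, x ∈ G.aug ε → x = 0) ∧
      Function.Surjective (actionMap A V.subtype) ∧
      ∀ z, actionMap A V.subtype z = 0 → augTensor ε V z = 0 := by
  obtain ⟨V, hV, hV0, hVs⟩ := G.exists_generators hA
  have hg := G.isGrading.restrictProj hV
  have hh : ∀ n v, Homog (restrictProj G.p V hV) n v → Homog G.p n (V.subtype v) :=
    fun n v hv => homog_restrictProj_iff.1 hv
  refine ⟨V, hV, hg, hh, hV0, ?_, ?_⟩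
  · rw [← LinearMap.range_eq_top]
    refine G.eq_top_of_sup_aug hA _ ?_ fun x => ?_
    · rintro n _ ⟨z, rfl⟩
      exact ⟨_, G.actionMap_tensorProj hA hg hh n z⟩
    · obtain ⟨v, hv, hxv⟩ := hVs x
      exact ⟨v, ⟨1 ⊗ₜ ⟨v, hv⟩, by simp⟩, hxv⟩
  · intro z hz
    have h := G.actionMap_sub_mem_aug (ε := ε) V.subtype z
    rw [hz, zero_sub] at h
    exact Subtype.ext (hV0 _ (augTensor ε V z).2 (by simpa using neg_mem h))

/-- A minimal cover of a projective graded module is an isomorphism. -/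
theorem bijective_of_projective (hA : IsConnectedProj pA ε) {V : Type u} [AddCommGroup V]
    [Module k V] {q : ℕ → V →ₗ[k] V} (hq : IsGrading q) (f : V →ₗ[k] G.carrier)
    (hf : ∀ n v, Homog q n v → Homog G.p n (f v)) (hs : Function.Surjective (actionMap A f))
    (hm : ∀ z, actionMap A f z = 0 → augTensor ε V z = 0) [Module.Projective A G.carrier] :
    Function.Bijective (actionMap A f) := by
  -- A section `s` splits the cover, so that `r = id - s ∘ cover` retracts onto the kernel.
  -- Minimality places the kernel inside `A_{≥ 1} (A ⊗ V)`; applying `r` places it inside `A_{≥ 1}`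
  -- times itself, and Nakayama makes it zero.
  obtain ⟨s, hs'⟩ := Module.projective_lifting_property (actionMap A f) LinearMap.id hs
  refine ⟨?_, hs⟩
  have hr : ∀ z, (LinearMap.id - s ∘ₗ actionMap A f : A ⊗[k] V →ₗ[A] A ⊗[k] V) z ∈ LinearMap.ker (actionMap A f) := by
    intro z
    rw [LinearMap.mem_ker, LinearMap.sub_apply, map_sub]
    exact sub_eq_zero.2 (LinearMap.congr_fun hs' (actionMap A f z)).symm
  let r : A ⊗[k] V →ₗ[A] LinearMap.ker (actionMap A f) := LinearMap.codRestrict _ _ hr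
  have hL : Subsingleton (G.kerAction hA q hq f hf).carrier := by
    refine subsingleton_of_aug _ hA fun (z : LinearMap.ker (actionMap A f)) => ?_
    have h := Submodule.mem_map_of_mem (f := r) (sub_augTensor_mem_span (ε := ε) z.1)
    rw [hm z.1 z.2, TensorProduct.tmul_zero, sub_zero, Submodule.map_span] at h
    have hz : r z.1 = z := by
      refine Subtype.ext ?_
      change z.1 - s (actionMap A f z.1) = z.1
      rw [show actionMap A f z.1 = 0 from z.2, map_zero, sub_zero]
    rw [hz] at h
    refine Submodule.span_mono ?_ h
    rintro _ ⟨_, ⟨a, x, ha, rfl⟩, rfl⟩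
    exact ⟨a, r x, ha, map_smul _ _ _⟩
  rw [injective_iff_map_eq_zero]
  intro z hz
  have := @Subsingleton.elim (LinearMap.ker (actionMap A f)) hL ⟨z, hz⟩ 0
  exact congrArg Subtype.val this

end GradedMod

theorem Below.smul_of_homog {G : GradedMod pA} {i j : ℕ} {a : A} {y : G.carrier}
    (ha : Homog pA i a) (hy : Below G.p j y) : Below G.p (i + j) (a • y) := by
  rw [hy.eq_sum G.isGrading, Finset.smul_sum]
  refine Finset.sum_induction _ (Below G.p (i + j)) (fun _ _ => Below.add) (Below.zero _)
    fun l hl => ?_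
  exact (G.smul ha (G.isGrading.homog l y)).below.mono
    (by have := Finset.mem_range.1 hl; lia)

theorem Below.tmul {V : Type u} [AddCommGroup V] [Module k V] {q : ℕ → V →ₗ[k] V}
    (hq : IsGrading q) {i j : ℕ} {a : A} {y : V} (ha : Homog pA i a) (hy : Below q j y) :
    Below (tensorProj pA q) (i + j) (a ⊗ₜ[k] y) := by
  rw [hy.eq_sum hq, TensorProduct.tmul_sum]
  refine Finset.sum_induction _ (Below (tensorProj pA q) (i + j)) (fun _ _ => Below.add)
    (Below.zero _) fun l hl => ?_
  exact (ha.tmul (hq.homog l y)).below.mono (by have := Finset.mem_range.1 hl; lia)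

section Syzygy

variable (A) in
/-- The projection of `A ⊗ K` onto the kernel of the action map `A ⊗ K → K`. -/
def toKerAction (K : Type u) [AddCommGroup K] [Module k K] [Module A K] [IsScalarTower k A K] :
    A ⊗[k] K →ₗ[k] LinearMap.ker (actionMap A (LinearMap.id : K →ₗ[k] K)) where
  toFun w := ⟨w - 1 ⊗ₜ actionMap A LinearMap.id w, by
    rw [LinearMap.mem_ker, map_sub, actionMap_tmul, one_smul, LinearMap.id_apply, sub_self]⟩
  map_add' x y := Subtype.ext <| by
    change x + y - 1 ⊗ₜ (actionMap A LinearMap.id (x + y)) =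
      (x - 1 ⊗ₜ actionMap A LinearMap.id x) + (y - 1 ⊗ₜ actionMap A LinearMap.id y)
    rw [map_add, TensorProduct.tmul_add, add_sub_add_comm]
  map_smul' c x := Subtype.ext <| by
    change c • x - 1 ⊗ₜ (actionMap A LinearMap.id (c • x)) =
      c • (x - 1 ⊗ₜ actionMap A LinearMap.id x)
    rw [LinearMap.map_smul_of_tower, TensorProduct.tmul_smul, smul_sub]

variable {K L : Type u} [AddCommGroup K] [Module k K] [Module A K] [IsScalarTower k A K]
  [AddCommGroup L] [Module k L] [Module A L] [IsScalarTower k A L]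

variable (A) in
/-- The linear map between first syzygies induced by a linear map of modules. -/
def syzygyMap (θ : K →ₗ[k] L) : LinearMap.ker (actionMap A (LinearMap.id : K →ₗ[k] K)) →ₗ[k]
    LinearMap.ker (actionMap A (LinearMap.id : L →ₗ[k] L)) :=
  toKerAction A L ∘ₗ (LinearMap.lTensor A θ) ∘ₗ
    (LinearMap.ker (actionMap A (LinearMap.id : K →ₗ[k] K))).subtype.restrictScalars k

omit [Module A K] [IsScalarTower k A K] in
theorem actionMap_lTensor (θ : K →ₗ[k] L) (z : A ⊗[k] K) :
    actionMap A LinearMap.id (LinearMap.lTensor A θ z) = actionMap A θ z := by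
  induction z with
  | zero => simp
  | add x y hx hy => simp only [map_add, hx, hy]
  | tmul a v => simp

theorem coe_syzygyMap (θ : K →ₗ[k] L)
    (z : LinearMap.ker (actionMap A (LinearMap.id : K →ₗ[k] K))) :
    (syzygyMap A θ z : A ⊗[k] L) = LinearMap.lTensor A θ z - 1 ⊗ₜ actionMap A θ z.1 := by
  rw [← actionMap_lTensor]
  rfl

theorem syzygyMap_syzygyMap (θ : K ≃ₗ[k] L)
    (z : LinearMap.ker (actionMap A (LinearMap.id : K →ₗ[k] K))) :
    syzygyMap A θ.symm.toLinearMap (syzygyMap A θ.toLinearMap z) = z := by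
  have h : ∀ z : A ⊗[k] K, LinearMap.lTensor A θ.symm.toLinearMap
      (LinearMap.lTensor A θ.toLinearMap z) = z := fun z => by
    rw [← LinearMap.comp_apply, ← LinearMap.lTensor_comp]
    simp
  refine Subtype.ext ?_
  rw [coe_syzygyMap, ← actionMap_lTensor, coe_syzygyMap, map_sub, h, map_sub]
  have hz : actionMap A LinearMap.id z.1 = 0 := z.2
  rw [hz]
  simp [TensorProduct.tmul_neg]

variable (A) in
/-- A linear equivalence of modules induces one of first syzygies. -/
def syzygyEquiv (θ : K ≃ₗ[k] L) : LinearMap.ker (actionMap A (LinearMap.id : K →ₗ[k] K)) ≃ₗ[k]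
    LinearMap.ker (actionMap A (LinearMap.id : L →ₗ[k] L)) where
  __ := syzygyMap A θ.toLinearMap
  invFun := syzygyMap A θ.symm.toLinearMap
  left_inv := syzygyMap_syzygyMap θ
  right_inv := syzygyMap_syzygyMap θ.symm

end Syzygy

variable {G : GradedMod pA} {K : Type u} [AddCommGroup K] [Module k K] [Module A K]
  [IsScalarTower k A K] {θ : G.carrier ≃ₗ[k] K}

namespace GradedMod.IsDeformation

/-- Since `id ⊗ θ` is linear over `A`, only the correction term `1 ⊗ m`, with `m` the image of `z`
in `K`, obstructs linearity on syzygies. As `z` is a relation in `G`, the element `θ⁻¹ m` has degree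
below that of `z`, so both error terms have degree below `i + j`. -/
theorem syzygy (hA : IsConnectedProj pA ε) (hθ : G.IsDeformation θ) :
    (G.kerAction hA G.p G.isGrading LinearMap.id fun _ _ h => h).IsDeformation
      (K := LinearMap.ker (_root_.actionMap A (LinearMap.id : K →ₗ[k] K)))
      (show (G.kerAction hA G.p G.isGrading LinearMap.id fun _ _ h => h).carrier ≃ₗ[k]
        LinearMap.ker (_root_.actionMap A (LinearMap.id : K →ₗ[k] K)) from syzygyEquiv A θ) := by
  intro i j a (z : LinearMap.ker (_root_.actionMap A LinearMap.id)) ha hz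
  have hz' : Homog (tensorProj pA G.p) j z.1 := (G.homog_kerAction_iff z).1 hz
  have hz0 : _root_.actionMap A LinearMap.id z.1 = 0 := z.2
  obtain ⟨m, hm⟩ : ∃ m, m = _root_.actionMap A θ.toLinearMap z.1 := ⟨_, rfl⟩
  have hb : Below G.p j (θ.symm m) := by
    have := hθ.actionMap hA G.isGrading (f := LinearMap.id) (fun _ _ h => h) hz'
    rwa [hz0, sub_zero, LinearMap.comp_id, ← hm] at this
  have key : ((syzygyEquiv A θ).symm (a • syzygyEquiv A θ z) - a • z).1 =
      1 ⊗ₜ (a • θ.symm m) - a ⊗ₜ θ.symm m := by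
    obtain ⟨w, hw⟩ : ∃ w : LinearMap.ker (_root_.actionMap A (LinearMap.id : K →ₗ[k] K)),
        w.1 = a ⊗ₜ m - 1 ⊗ₜ (a • m) := ⟨⟨_, by
          rw [LinearMap.mem_ker, map_sub, actionMap_tmul, actionMap_tmul, one_smul,
            LinearMap.id_apply, LinearMap.id_apply, sub_self]⟩, rfl⟩
    have h1 : syzygyEquiv A θ (a • z) - a • syzygyEquiv A θ z = w := by
      refine Subtype.ext ?_
      rw [hw]
      change (syzygyMap A θ.toLinearMap (a • z)).1 - a • (syzygyMap A θ.toLinearMap z).1 =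
        a ⊗ₜ m - 1 ⊗ₜ (a • m)
      rw [coe_syzygyMap, coe_syzygyMap]
      have h2 : LinearMap.lTensor A θ.toLinearMap (a • z.1) =
          a • LinearMap.lTensor A θ.toLinearMap z.1 := by
        generalize z.1 = w
        induction w with
        | zero => simp
        | add x y hx hy => simp only [map_add, smul_add, hx, hy]
        | tmul b v => simp [TensorProduct.smul_tmul']
      change LinearMap.lTensor A θ.toLinearMap (a • z.1) -
        1 ⊗ₜ (_root_.actionMap A θ.toLinearMap (a • z.1)) - _ = _
      rw [h2, map_smul, ← hm, smul_sub, TensorProduct.smul_tmul', smul_eq_mul, mul_one]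
      abel
    have h3 : a • z - syzygyMap A θ.symm.toLinearMap (a • syzygyMap A θ.toLinearMap z) =
        syzygyMap A θ.symm.toLinearMap w := by
      rw [← h1]
      refine (Eq.trans (map_sub (syzygyMap A θ.symm.toLinearMap) (syzygyMap A θ.toLinearMap (a • z))
        _) ?_).symm
      rw [syzygyMap_syzygyMap]
      rfl
    have h5 : (syzygyEquiv A θ).symm (a • syzygyEquiv A θ z) - a • z =
        -syzygyMap A θ.symm.toLinearMap w := by
      rw [← h3]
      exact Subtype.ext (neg_sub (a • z).1
        (syzygyMap A θ.symm.toLinearMap (a • syzygyMap A θ.toLinearMap z)).1).symm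
    rw [h5]
    change -(syzygyMap A θ.symm.toLinearMap w).1 = _
    rw [coe_syzygyMap, hw]
    simp only [map_sub, LinearMap.lTensor_tmul, actionMap_tmul, LinearEquiv.coe_coe, one_smul,
      TensorProduct.tmul_sub]
    abel
  intro n hn
  refine Subtype.ext ?_
  change tensorProj pA G.p n ((syzygyEquiv A θ).symm (a • syzygyEquiv A θ z) - a • z).1 = 0
  rw [key, map_sub]
  have h4 := (Below.tmul G.isGrading (hA.homog_algebraMap 1) (hb.smul_of_homog ha)) n
    (by simpa using hn)
  rw [map_one] at h4
  rw [h4, Below.tmul G.isGrading ha hb n hn, sub_zero]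

/-- A projective graded module is `A ⊗ V` by its minimal cover. Comparing with the map `A ⊗ V → K`
through `θ` gives an endomorphism of `G` that is the identity up to lower degree, hence bijective,
so `K` is isomorphic to `A ⊗ V`. -/
theorem projective (hA : IsConnectedProj pA ε) (hθ : G.IsDeformation θ)
    [Module.Projective A G.carrier] : Module.Projective A K := by
  obtain ⟨V, hV, hg, hh, -, hs, hm⟩ := G.exists_minimal_cover hA
  have hb := G.bijective_of_projective hA hg V.subtype hh hs hm
  let e := LinearEquiv.ofBijective _ hb
  let T : G.carrier →ₗ[k] G.carrier := θ.symm.toLinearMap ∘ₗ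
    (_root_.actionMap A (θ.toLinearMap ∘ₗ V.subtype)).restrictScalars k ∘ₗ
    e.symm.toLinearMap.restrictScalars k
  have hT : Function.Bijective T := by
    refine bijective_of_sub_below G.isGrading T fun n x hx => ?_
    have he : ∀ x, _root_.actionMap A V.subtype (e.symm x) = x := e.apply_symm_apply
    have hz : Homog (tensorProj pA (restrictProj G.p V hV)) n (e.symm x) := by
      intro m
      apply hb.1
      rw [G.actionMap_tensorProj hA hg hh, he, hx m]
      split_ifs
      · exact (he x).symm
      · rw [map_zero]
    have := hθ.actionMap hA hg hh hz
    rwa [he] at this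
  have h2 : Function.Bijective (_root_.actionMap A (θ.toLinearMap ∘ₗ V.subtype)) := by
    have : ⇑(_root_.actionMap A (θ.toLinearMap ∘ₗ V.subtype)) = θ ∘ T ∘ e := by
      funext z
      change _ = θ (θ.symm (_root_.actionMap A (θ.toLinearMap ∘ₗ V.subtype) (e.symm (e z))))
      rw [e.symm_apply_apply, θ.apply_symm_apply]
    rw [this]
    exact θ.bijective.comp (hT.comp e.bijective)
  exact Module.Projective.of_equiv (LinearEquiv.ofBijective _ h2)

/-- Dimension shifting on both sides at once. The covers by `A ⊗ G` and `A ⊗ K` are used rather than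
minimal ones, because they are matched by `θ`. -/
theorem hasProjectiveDimensionLT (hA : IsConnectedProj pA ε) (d : ℕ) :
    ∀ {G : GradedMod pA} {K : Type u} [AddCommGroup K] [Module k K] [Module A K]
      [IsScalarTower k A K] {θ : G.carrier ≃ₗ[k] K}, G.IsDeformation θ →
      HasProjectiveDimensionLT (ModuleCat.of A G.carrier) (d + 1) →
      HasProjectiveDimensionLT (ModuleCat.of A K) (d + 1) := by
  induction d with
  | zero =>
    intro G K _ _ _ _ θ hθ h
    rw [zero_add, ← projective_iff_hasProjectiveDimensionLT_one,
      ← IsProjective.iff_projective] at h ⊢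
    exact hθ.projective hA
  | succ d ih =>
    intro G K _ _ _ _ θ hθ h
    have hsG := G.coverComplex_shortExact hA G.p G.isGrading LinearMap.id (fun _ _ h => h)
      fun x => ⟨1 ⊗ₜ x, by simp⟩
    have hK := ih (hθ.syzygy hA)
      ((hsG.hasProjectiveDimensionLT_X₃_iff d (inferInstanceAs (Projective
        (ModuleCat.of A (A ⊗[k] G.carrier))))).1 h)
    have hs : Function.Surjective (_root_.actionMap A (LinearMap.id : K →ₗ[k] K)) := fun x =>
      ⟨1 ⊗ₜ x, by rw [actionMap_tmul, one_smul, LinearMap.id_apply]⟩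
    exact (hasProjectiveDimensionLT_iff_of_exact (Submodule.subtype_injective _)
      (LinearMap.exact_subtype_ker_map _) hs d).2 hK

end GradedMod.IsDeformation

end GlobalDimension


/-! ### Reduction of the global dimension to the trivial module. -/

section Trivial

variable {k : Type u} [Field k] {A : Type u} [Ring A] [Algebra k A]

/-- A vector space `M` with the action of `A` through the augmentation `ε`. -/
def TrivialMod (_ : A →ₐ[k] k) (M : Type u) : Type u := M

namespace TrivialMod

variable (ε : A →ₐ[k] k) (M : Type u) [AddCommGroup M] [Module k M]

instance : AddCommGroup (TrivialMod ε M) := inferInstanceAs (AddCommGroup M)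

instance : Module k (TrivialMod ε M) := inferInstanceAs (Module k M)

instance : Module A (TrivialMod ε M) := Module.compHom M (ε : A →+* k)

variable {M} in
theorem smul_def (a : A) (x : TrivialMod ε M) : a • x = ε a • x := rfl

instance : IsScalarTower k A (TrivialMod ε M) where
  smul_assoc c a x := by rw [smul_def, smul_def, map_smul, smul_assoc]

/-- The trivial module concentrated in degree `0`. -/
def gradedMod {pA : ℕ → A →ₗ[k] A} {ε : A →ₐ[k] k} (hA : IsConnectedProj pA ε) :
    GradedMod pA where
  carrier := TrivialMod ε M
  p n := if n = 0 then LinearMap.id else 0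
  isGrading x := Submodule.subset_span ⟨0, fun m => by
    dsimp only
    split_ifs <;> rfl⟩
  smul {i j a x} ha hx n := by
    rw [smul_def]
    by_cases hi : i = 0
    · subst hi
      rw [map_smul, hx n, zero_add]
      split_ifs <;> simp
    · rw [hA.aug_eq_zero hi ha, zero_smul, map_zero, ite_self]

end TrivialMod

/-- The vector space of `M` with the trivial action is a direct sum of copies of `k`, so it has the
same bound. Placed in degree zero it deforms to `M` along the identity map: scalars act equally, and
for `a` of positive degree every error term is of lower degree. -/
theorem hasProjectiveDimensionLT_of_trivialMod {pA : ℕ → A →ₗ[k] A} {ε : A →ₐ[k] k}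
    (hA : IsConnectedProj pA ε) {d : ℕ}
    (h : HasProjectiveDimensionLT (ModuleCat.of A (TrivialMod ε k)) (d + 1))
    (M : ModuleCat.{u} A) : HasProjectiveDimensionLT M (d + 1) := by
  let := Module.compHom M (algebraMap k A)
  have : IsScalarTower k A M := ⟨fun c a x => by
    change (c • a) • x = algebraMap k A c • a • x
    rw [Algebra.smul_def, mul_smul]⟩
  let b := Module.Basis.ofVectorSpace k M
  have h1 := hasProjectiveDimensionLT_finsupp (Module.Basis.ofVectorSpaceIndex k M) d _ h
  let e : (Module.Basis.ofVectorSpaceIndex k M →₀ TrivialMod ε k) ≃ₗ[A] TrivialMod ε M :=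
    { __ := b.repr.symm
      map_smul' := fun a x => by
        have : a • x = ε a • x := Finsupp.ext fun i => rfl
        rw [this]
        exact map_smul b.repr.symm (ε a) x }
  have h2 : HasProjectiveDimensionLT (ModuleCat.of A (TrivialMod ε M)) (d + 1) :=
    hasProjectiveDimensionLT_of_iso e.toModuleIso (d + 1)
  refine GradedMod.IsDeformation.hasProjectiveDimensionLT hA d (G := TrivialMod.gradedMod M hA)
    (K := M) (θ := (show (TrivialMod.gradedMod M hA).carrier ≃ₗ[k] M from LinearEquiv.refl k M)) ?_ h2
  intro i j a x ha hx n hn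
  by_cases hi : i = 0
  · subst hi
    have h3 : a = algebraMap k A (ε a) := by rw [← hA.zero, ha.eq_self]
    refine (congrArg _ ?_).trans (map_zero _)
    refine sub_eq_zero.2 ?_
    change (a • (show M from x) : M) = ε a • (show M from x)
    conv_lhs => rw [h3]
    exact algebraMap_smul A _ _
  · change (if n = 0 then LinearMap.id else 0 : TrivialMod ε M →ₗ[k] TrivialMod ε M) _ = 0
    rw [if_neg (by lia)]
    rfl

end Trivial

/-! ### Low-degree Ext and dimension shifting for one short exact sequence. -/

section ExtSequences

open Abelian

variable {k : Type u} [Field k] {A : Type u} [Ring A] [Algebra k A]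
  {X Y Z : Type u} [AddCommGroup X] [Module A X] [AddCommGroup Y] [Module A Y] [AddCommGroup Z]
  [Module A Z] {f : X →ₗ[A] Y} {g : Y →ₗ[A] Z}

theorem exists_linearMap_comp_eq (hf : Function.Injective f) (hfg : Function.Exact f g)
    (hg : Function.Surjective g) (N : ModuleCat.{u} A)
    (h : Subsingleton (Ext (ModuleCat.of A Z) N 1)) (u : X →ₗ[A] N) :
    ∃ v : Y →ₗ[A] N, v ∘ₗ f = u := by
  let S : ShortComplex (ModuleCat.{u} A) :=
    { X₁ := ModuleCat.of A X
      X₂ := ModuleCat.of A Y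
      X₃ := ModuleCat.of A Z
      f := ModuleCat.ofHom f
      g := ModuleCat.ofHom g
      zero := ModuleCat.hom_ext (LinearMap.ext fun x => hfg.apply_apply_eq_zero x) }
  have hS : S.ShortExact := ModuleCat.shortComplex_shortExact _ hfg hf hg
  obtain ⟨x, hx⟩ := Ext.contravariant_sequence_exact₁ hS N
    (Ext.mk₀ (ModuleCat.ofHom u : S.X₁ ⟶ N)) (add_zero 1) (h.elim _ _)
  obtain ⟨w, rfl⟩ := Ext.mk₀_bijective _ _ |>.2 x
  rw [Ext.mk₀_comp_mk₀] at hx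
  have := (Ext.mk₀_bijective _ _).1 hx
  exact ⟨w.hom, congrArg ModuleCat.Hom.hom this⟩

/-- As `Y` is projective, `Ext^1(Z, A)` is the cokernel of `Hom(Y, A) → Hom(X, A)`; the functional
is the connecting map followed by `e`. -/
theorem exists_functional_of_ext_linearEquiv [Module.Projective A Y] (hf : Function.Injective f)
    (hfg : Function.Exact f g) (hg : Function.Surjective g)
    (e : Ext (ModuleCat.of A Z) (ModuleCat.of A A) 1 ≃ₗ[k] k) :
    ∃ φ : (X →ₗ[A] A) →ₗ[k] k, Function.Surjective φ ∧
      ∀ u, φ u = 0 ↔ ∃ v : Y →ₗ[A] A, v ∘ₗ f = u := by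
  let S : ShortComplex (ModuleCat.{u} A) :=
    { X₁ := ModuleCat.of A X
      X₂ := ModuleCat.of A Y
      X₃ := ModuleCat.of A Z
      f := ModuleCat.ofHom f
      g := ModuleCat.ofHom g
      zero := ModuleCat.hom_ext (LinearMap.ext fun x => hfg.apply_apply_eq_zero x) }
  have hS : S.ShortExact := ModuleCat.shortComplex_shortExact _ hfg hf hg
  have hP : Projective S.X₂ := ModuleCat.projective_of_categoryTheory_projective (ModuleCat.of A Y)
  let φ : (X →ₗ[A] A) →ₗ[k] k :=
    { toFun := fun u => e (hS.extClass.comp (Ext.mk₀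
        (ModuleCat.ofHom u : S.X₁ ⟶ ModuleCat.of A A)) (add_zero 1))
      map_add' := fun u v => by
        rw [← map_add, ← Ext.comp_add, ← Ext.mk₀_add]
        rfl
      map_smul' := fun c u => by
        rw [RingHom.id_apply, ← map_smul, ← Ext.comp_smul, ← Ext.mk₀_smul]
        congr 3
        refine ModuleCat.hom_ext (LinearMap.ext fun x => ?_)
        exact Algebra.smul_def c (u x) }
  refine ⟨φ, fun c => ?_, fun u => ⟨fun hu => ?_, ?_⟩⟩
  · obtain ⟨x, hx⟩ := Ext.contravariant_sequence_exact₃ hS (ModuleCat.of A A) (e.symm c)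
      (Ext.eq_zero_of_projective _) (add_zero 1)
    obtain ⟨w, rfl⟩ := Ext.mk₀_bijective _ _ |>.2 x
    exact ⟨w.hom, by rw [← e.apply_symm_apply c, ← hx]; rfl⟩
  · obtain ⟨x, hx⟩ := Ext.contravariant_sequence_exact₁ hS (ModuleCat.of A A)
      (Ext.mk₀ (ModuleCat.ofHom u : S.X₁ ⟶ ModuleCat.of A A)) (add_zero 1)
      (e.map_eq_zero_iff.1 hu)
    obtain ⟨w, rfl⟩ := Ext.mk₀_bijective _ _ |>.2 x
    rw [Ext.mk₀_comp_mk₀] at hx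
    have := (Ext.mk₀_bijective _ _).1 hx
    exact ⟨w.hom, congrArg ModuleCat.Hom.hom this⟩
  · rintro ⟨v, rfl⟩
    change e (hS.extClass.comp (Ext.mk₀ (S.f ≫ (ModuleCat.ofHom v : S.X₂ ⟶ ModuleCat.of A A)))
      (add_zero 1)) = 0
    rw [← Ext.mk₀_comp_mk₀, hS.extClass_comp_assoc, map_zero]

theorem nonempty_ext_linearEquiv_succ [Module.Projective A Y] (hf : Function.Injective f)
    (hfg : Function.Exact f g) (hg : Function.Surjective g) (N : ModuleCat.{u} A) (n : ℕ) :
    Nonempty (Ext (ModuleCat.of A X) N (n + 1) ≃ₗ[k] Ext (ModuleCat.of A Z) N (n + 2)) := by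
  let S : ShortComplex (ModuleCat.{u} A) :=
    { X₁ := ModuleCat.of A X
      X₂ := ModuleCat.of A Y
      X₃ := ModuleCat.of A Z
      f := ModuleCat.ofHom f
      g := ModuleCat.ofHom g
      zero := ModuleCat.hom_ext (LinearMap.ext fun x => hfg.apply_apply_eq_zero x) }
  have hS : S.ShortExact := ModuleCat.shortComplex_shortExact _ hfg hf hg
  have hP : Projective S.X₂ := ModuleCat.projective_of_categoryTheory_projective (ModuleCat.of A Y)
  refine ⟨LinearEquiv.ofBijective (hS.extClass.precompOfLinear k N
    (show 1 + (n + 1) = n + 2 by lia)) ⟨?_, fun y => ?_⟩⟩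
  · rw [injective_iff_map_eq_zero]
    intro x hx
    obtain ⟨y, rfl⟩ := Ext.contravariant_sequence_exact₁ hS N x
      (show 1 + (n + 1) = n + 2 by lia) hx
    rw [Ext.eq_zero_of_projective y, Ext.comp_zero]
  · exact Ext.contravariant_sequence_exact₃ hS N y (Ext.eq_zero_of_projective _)
      (show 1 + (n + 1) = n + 2 by lia)

end ExtSequences

/-- The map `ψ` factors through the one-dimensional quotient `φ`, and its image `F` is nonzero. -/
theorem finrank_eq_one_of_ker_le {k E F : Type*} [Field k] [AddCommGroup E] [Module k E]
    [AddCommGroup F] [Module k F] [Nontrivial F] {φ : E →ₗ[k] k} {ψ : E →ₗ[k] F}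
    (hφ : Function.Surjective φ) (hψ : Function.Surjective ψ) (h : ∀ x, φ x = 0 → ψ x = 0) :
    Module.finrank k F = 1 ∧ ∀ x, φ x = 0 ↔ ψ x = 0 := by
  obtain ⟨x₀, hx₀⟩ := hφ 1
  have key : ∀ x, ψ x = φ x • ψ x₀ := fun x => by
    rw [← sub_eq_zero, ← map_smul, ← map_sub]
    apply h
    rw [map_sub, map_smul, hx₀, smul_eq_mul, mul_one, sub_self]
  have h0 : ψ x₀ ≠ 0 := fun h0 => by
    obtain ⟨y, hy⟩ := exists_ne (0 : F)
    obtain ⟨x, rfl⟩ := hψ y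
    exact hy (by rw [key, h0, smul_zero])
  refine ⟨finrank_eq_one (ψ x₀) h0 fun w => ?_, fun x => ⟨h x, fun hx => ?_⟩⟩
  · obtain ⟨x, rfl⟩ := hψ w
    exact ⟨φ x, (key x).symm⟩
  · rw [key] at hx
    exact (smul_eq_zero.1 hx).resolve_right h0

/-! ### The minimal graded resolution of the trivial module. -/

section MinimalResolution

variable {k : Type u} [Field k] {A : Type u} [Ring A] [Algebra k A]
variable {pA : ℕ → A →ₗ[k] A} {ε : A →ₐ[k] k}

namespace GradedMod

/-- The generators of a minimal cover. -/
def gen (hA : IsConnectedProj pA ε) (G : GradedMod pA) : Submodule k G.carrier :=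
  (G.exists_minimal_cover hA).choose

/-- The minimal cover. -/
def cover (hA : IsConnectedProj pA ε) (G : GradedMod pA) : A ⊗[k] G.gen hA →ₗ[A] G.carrier :=
  actionMap A (G.gen hA).subtype

/-- The first syzygy of the minimal cover. -/
def syz (hA : IsConnectedProj pA ε) (G : GradedMod pA) : GradedMod pA :=
  G.kerAction hA _ (G.exists_minimal_cover hA).choose_spec.choose_spec.1 (G.gen hA).subtype
    (G.exists_minimal_cover hA).choose_spec.choose_spec.2.1

/-- The inclusion of the first syzygy. -/
def syzIncl (hA : IsConnectedProj pA ε) (G : GradedMod pA) :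
    (G.syz hA).carrier →ₗ[A] A ⊗[k] G.gen hA :=
  (LinearMap.ker (actionMap A (G.gen hA).subtype)).subtype

variable (hA : IsConnectedProj pA ε) (G : GradedMod pA)

theorem syzIncl_injective : Function.Injective (G.syzIncl hA) := Subtype.val_injective

theorem exact_syzIncl_cover : Function.Exact (G.syzIncl hA) (G.cover hA) := fun z =>
  ⟨fun hz => ⟨⟨z, hz⟩, rfl⟩, by rintro ⟨z, rfl⟩; exact z.2⟩

theorem cover_surjective : Function.Surjective (G.cover hA) :=
  (G.exists_minimal_cover hA).choose_spec.choose_spec.2.2.2.1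

theorem augTensor_syzIncl (x : (G.syz hA).carrier) : augTensor ε _ (G.syzIncl hA x) = 0 :=
  (G.exists_minimal_cover hA).choose_spec.choose_spec.2.2.2.2 _ x.2

theorem cover_bijective [Module.Projective A G.carrier] : Function.Bijective (G.cover hA) := by
  obtain ⟨h1, h2, -, h3, h4⟩ := (G.exists_minimal_cover hA).choose_spec.choose_spec
  exact G.bijective_of_projective hA h1 _ h2 h3 h4

theorem subsingleton_syz [Subsingleton G.carrier] : Subsingleton (G.syz hA).carrier := by
  have : Subsingleton (A ⊗[k] G.gen hA) := inferInstance
  exact (G.syzIncl_injective hA).subsingleton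

/-- The terms of the minimal resolution of the trivial module. -/
def minSyz : ℕ → GradedMod pA
  | 0 => TrivialMod.gradedMod k hA
  | j + 1 => (minSyz j).syz hA

/-- The generators of the minimal resolution of the trivial module. -/
abbrev minGen (j : ℕ) : Submodule k (minSyz hA j).carrier := (minSyz hA j).gen hA

/-- The inclusion of the syzygies of the minimal resolution of the trivial module. -/
def minIncl (j : ℕ) : (minSyz hA (j + 1)).carrier →ₗ[A] A ⊗[k] minGen hA j :=
  (minSyz hA j).syzIncl hA

theorem minIncl_injective (j : ℕ) : Function.Injective (minIncl hA j) :=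
  (minSyz hA j).syzIncl_injective hA

theorem exact_minIncl_cover (j : ℕ) : Function.Exact (minIncl hA j) ((minSyz hA j).cover hA) :=
  (minSyz hA j).exact_syzIncl_cover hA

theorem augTensor_minIncl (j : ℕ) (x : (minSyz hA (j + 1)).carrier) :
    augTensor ε _ (minIncl hA j x) = 0 :=
  (minSyz hA j).augTensor_syzIncl hA x

/-- The differential of the minimal resolution of the trivial module. -/
def diff (j : ℕ) : A ⊗[k] minGen hA (j + 1) →ₗ[A] A ⊗[k] minGen hA j :=
  minIncl hA j ∘ₗ (minSyz hA (j + 1)).cover hA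

theorem diff_eq_zero_iff (j : ℕ) (z : A ⊗[k] minGen hA (j + 1)) :
    diff hA j z = 0 ↔ ∃ y, z = diff hA (j + 1) y := by
  rw [diff, LinearMap.comp_apply, map_eq_zero_iff _ (minIncl_injective hA j),
    exact_minIncl_cover hA (j + 1) z]
  constructor
  · rintro ⟨x, rfl⟩
    obtain ⟨y, rfl⟩ := (minSyz hA (j + 2)).cover_surjective hA x
    exact ⟨y, rfl⟩
  · rintro ⟨y, rfl⟩
    exact ⟨_, rfl⟩

theorem mem_range_diff_iff (j : ℕ) (z : A ⊗[k] minGen hA j) :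
    (∃ y, z = diff hA j y) ↔ (minSyz hA j).cover hA z = 0 := by
  rw [exact_minIncl_cover hA j z]
  constructor
  · rintro ⟨y, rfl⟩
    exact ⟨_, rfl⟩
  · rintro ⟨x, rfl⟩
    obtain ⟨y, rfl⟩ := (minSyz hA (j + 1)).cover_surjective hA x
    exact ⟨y, rfl⟩

variable (ε) in
/-- The functional `v ↦ ε(u(1 ⊗ v))`. -/
def leading (V : Type u) [AddCommGroup V] [Module k V] :
    (A ⊗[k] V →ₗ[A] A) →ₗ[k] Module.Dual k V where
  toFun u := ε.toLinearMap ∘ₗ u.restrictScalars k ∘ₗ TensorProduct.mk k A V 1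
  map_add' u v := by ext; simp
  map_smul' c u := by ext; simp

theorem leading_apply {V : Type u} [AddCommGroup V] [Module k V] (u : A ⊗[k] V →ₗ[A] A) (v : V) :
    leading ε V u v = ε (u (1 ⊗ₜ v)) := rfl

theorem leading_surjective (V : Type u) [AddCommGroup V] [Module k V] :
    Function.Surjective (leading (A := A) ε V) := by
  intro l
  refine ⟨actionMap A (Algebra.linearMap k A ∘ₗ l), LinearMap.ext fun v => ?_⟩
  rw [leading_apply, actionMap_tmul, one_smul]
  exact ε.commutes (l v)

/-- Modulo the augmentation ideal, a linear map on `A ⊗ V` sees only the reduction of its argument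
to `V`. -/
theorem aug_apply (V : Type u) [AddCommGroup V] [Module k V] (u : A ⊗[k] V →ₗ[A] A)
    (z : A ⊗[k] V) : ε (u z) = leading ε V u (augTensor ε V z) := by
  induction z with
  | zero => simp
  | add x y hx hy => simp only [map_add, hx, hy]
  | tmul a v =>
    have : (a ⊗ₜ v : A ⊗[k] V) = a • (1 ⊗ₜ v) := by
      rw [TensorProduct.smul_tmul', smul_eq_mul, mul_one]
    rw [augTensor_tmul, map_smul, leading_apply, this, map_smul, smul_eq_mul, map_mul, smul_eq_mul]

/-- Maps that extend along a minimal syzygy have values in the augmentation ideal. -/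
theorem aug_apply_minIncl (j : ℕ) (v : A ⊗[k] minGen hA j →ₗ[A] A)
    (x : (minSyz hA (j + 1)).carrier) : ε (v (minIncl hA j x)) = 0 := by
  rw [aug_apply, augTensor_minIncl, map_zero]

end GradedMod

end MinimalResolution

/-! ### Duality and finiteness of the minimal resolution of a regular algebra. -/

section Regular

open Abelian GradedMod

variable {k : Type u} [Field k] {A : Type u} [Ring A] [Algebra k A]
variable {pA : ℕ → A →ₗ[k] A} {ε : A →ₐ[k] k}

variable (A) in
theorem hasProjectiveDimensionLT_minSyz (hA : IsConnectedProj pA ε) {d : ℕ}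
    (h : HasProjectiveDimensionLT (ModuleCat.of A (TrivialMod ε k)) (d + 1)) (j n : ℕ)
    (hjn : j + n = d) : HasProjectiveDimensionLT (ModuleCat.of A (minSyz hA j).carrier) (n + 1) := by
  induction j generalizing n with
  | zero =>
    obtain rfl : n = d := by lia
    exact h
  | succ j ih =>
    exact (hasProjectiveDimensionLT_iff_of_exact (minIncl_injective hA j)
      (exact_minIncl_cover hA j) ((minSyz hA j).cover_surjective hA) n).1
      (ih (n + 1) (by lia))

theorem nonempty_ext_minSyz_linearEquiv (hA : IsConnectedProj pA ε) (N : ModuleCat.{u} A)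
    (j n : ℕ) : Nonempty (Ext (ModuleCat.of A (minSyz hA j).carrier) N (n + 1) ≃ₗ[k]
      Ext (ModuleCat.of A (TrivialMod ε k)) N (j + n + 1)) := by
  induction j generalizing n with
  | zero =>
    rw [zero_add]
    exact ⟨LinearEquiv.refl k _⟩
  | succ j ih =>
    obtain ⟨e⟩ := nonempty_ext_linearEquiv_succ (k := k) (minIncl_injective hA j)
      (exact_minIncl_cover hA j) ((minSyz hA j).cover_surjective hA) N n
    obtain ⟨e'⟩ := ih (n + 1)
    rw [show j + 1 + n + 1 = j + (n + 1) + 1 by lia]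
    exact ⟨e.trans e'⟩

theorem projective_minSyz (hA : IsConnectedProj pA ε) {d : ℕ}
    (h : HasProjectiveDimensionLT (ModuleCat.of A (TrivialMod ε k)) (d + 1)) :
    Module.Projective A (minSyz hA d).carrier := by
  have := hasProjectiveDimensionLT_minSyz A hA h d 0 rfl
  rwa [zero_add, ← projective_iff_hasProjectiveDimensionLT_one,
    ← IsProjective.iff_projective] at this

/-- The `d`-th syzygy is projective, so its minimal cover is bijective and the next syzygy is zero.
-/
theorem subsingleton_minSyz (hA : IsConnectedProj pA ε) {d : ℕ}
    (h : HasProjectiveDimensionLT (ModuleCat.of A (TrivialMod ε k)) (d + 1)) (j : ℕ) (hj : d < j) :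
    Subsingleton (minSyz hA j).carrier := by
  induction j, hj using Nat.le_induction with
  | base =>
    have := projective_minSyz hA h
    refine subsingleton_of_forall_eq 0 fun x => minIncl_injective hA d ?_
    rw [map_zero]
    refine ((minSyz hA d).cover_bijective hA).1 ?_
    rw [map_zero]
    exact (exact_minIncl_cover hA d).apply_apply_eq_zero x
  | succ j _ ih => exact (minSyz hA j).subsingleton_syz hA

theorem minGen_zero_eq_top (hA : IsConnectedProj pA ε) : minGen hA 0 = ⊤ := by
  have haug : ∀ x ∈ (minSyz hA 0).aug ε, x = 0 := by
    intro x hx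
    induction hx using Submodule.span_induction with
    | mem x hx =>
      obtain ⟨a, y, ha, rfl⟩ := hx
      change ε a • (show k from y) = 0
      rw [ha, zero_smul]
    | zero => rfl
    | add x y _ _ hx hy => rw [hx, hy, add_zero]
    | smul a x _ hx => rw [hx, smul_zero]
  refine eq_top_iff.2 fun x _ => ?_
  obtain ⟨z, rfl⟩ := (minSyz hA 0).cover_surjective hA x
  have h := haug _ ((minSyz hA 0).actionMap_sub_mem_aug (ε := ε) (minGen hA 0).subtype z)
  rw [sub_eq_zero] at h
  change actionMap A _ z ∈ _
  rw [h]
  exact Subtype.property _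

theorem finrank_minGen_zero (hA : IsConnectedProj pA ε) : Module.finrank k (minGen hA 0) = 1 := by
  rw [minGen_zero_eq_top, finrank_top]
  exact Module.finrank_self k

theorem cover_zero_tmul (hA : IsConnectedProj pA ε) (a : A) (v : minGen hA 0) :
    (minSyz hA 0).cover hA (a ⊗ₜ v) = ε a • (v : (minSyz hA 0).carrier) := by
  rw [cover, actionMap_tmul]
  rfl

theorem mem_range_diff_zero_iff (hA : IsConnectedProj pA ε) {v : minGen hA 0} (hv : v ≠ 0) (a : A) :
    ε a = 0 ↔ ∃ y, a ⊗ₜ v = diff hA 0 y := by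
  rw [mem_range_diff_iff, cover_zero_tmul, smul_eq_zero, or_iff_left]
  exact fun h => hv (Subtype.ext h)

theorem ext_apply_of_cover {hA : IsConnectedProj pA ε} {j : ℕ} {N : Type u} [AddCommGroup N]
    [Module A N] {u v : (minSyz hA j).carrier →ₗ[A] N}
    (h : u ∘ₗ (minSyz hA j).cover hA = v ∘ₗ (minSyz hA j).cover hA) : u = v := by
  refine LinearMap.ext fun x => ?_
  obtain ⟨z, rfl⟩ := (minSyz hA j).cover_surjective hA x
  exact LinearMap.congr_fun h z

/-- A map that vanishes on the image of the differential factors through the next syzygy. -/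
theorem exists_factor {hA : IsConnectedProj pA ε} {j : ℕ} (u : A ⊗[k] minGen hA j →ₗ[A] A)
    (h : u ∘ₗ minIncl hA j = 0) :
    ∃ g : (minSyz hA j).carrier →ₗ[A] A, g ∘ₗ (minSyz hA j).cover hA = u := by
  have hs := (minSyz hA j).cover_surjective hA
  have hk : LinearMap.ker ((minSyz hA j).cover hA) ≤ LinearMap.ker u := by
    intro z hz
    obtain ⟨x, rfl⟩ := (exact_minIncl_cover hA j z).1 hz
    exact LinearMap.congr_fun h x
  refine ⟨(Submodule.liftQ _ u hk) ∘ₗ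
    (LinearMap.quotKerEquivOfSurjective _ hs).symm.toLinearMap, LinearMap.ext fun z => ?_⟩
  have : (LinearMap.quotKerEquivOfSurjective _ hs).symm ((minSyz hA j).cover hA z) =
      Submodule.Quotient.mk z := by
    rw [LinearEquiv.symm_apply_eq]
    rfl
  rw [LinearMap.comp_apply, LinearMap.comp_apply, LinearEquiv.coe_coe, this]
  rfl

theorem comp_minIncl_eq_zero_iff {hA : IsConnectedProj pA ε} {j : ℕ}
    (u : A ⊗[k] minGen hA j →ₗ[A] A) : u ∘ₗ minIncl hA j = 0 ↔ u ∘ₗ diff hA j = 0 := by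
  constructor
  · intro h
    rw [diff, ← LinearMap.comp_assoc, h, LinearMap.zero_comp]
  · intro h
    exact ext_apply_of_cover (by rw [LinearMap.zero_comp, LinearMap.comp_assoc]; exact h)

variable {d : ℕ}

theorem linearMap_trivialMod_eq_zero
    (h0 : Subsingleton (Ext (ModuleCat.of A (TrivialMod ε k)) (ModuleCat.of A A) 0))
    (u : TrivialMod ε k →ₗ[A] A) : u = 0 := by
  have := (Ext.mk₀_bijective (ModuleCat.of A (TrivialMod ε k)) (ModuleCat.of A A)).1
    (h0.elim (Ext.mk₀ (ModuleCat.ofHom u)) (Ext.mk₀ 0))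
  exact congrArg ModuleCat.Hom.hom this

/-- The hypotheses on the extension groups of the trivial module. -/
structure IsRegularAug (A : Type u) [Ring A] [Algebra k A] (ε : A →ₐ[k] k) (d : ℕ) : Prop where
  projectiveDimension : HasProjectiveDimensionLT (ModuleCat.of A (TrivialMod ε k)) (d + 1)
  ext_eq_zero : ∀ i, i ≠ d →
    Subsingleton (Ext (ModuleCat.of A (TrivialMod ε k)) (ModuleCat.of A A) i)
  ext_equiv : Nonempty (Ext (ModuleCat.of A (TrivialMod ε k)) (ModuleCat.of A A) d ≃ₗ[k] k)

variable (hA : IsConnectedProj pA ε) (hR : IsRegularAug A ε d)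
include hA hR

/-- The obstruction lies in `Ext^1` of the `j`-th syzygy, which is `Ext^{j+1}(k, A) = 0`. -/
theorem IsRegularAug.exists_extension (j : ℕ) (hj : j + 1 ≠ d)
    (u : (minSyz hA (j + 1)).carrier →ₗ[A] A) :
    ∃ v : A ⊗[k] minGen hA j →ₗ[A] A, v ∘ₗ minIncl hA j = u := by
  obtain ⟨e⟩ := nonempty_ext_minSyz_linearEquiv hA (ModuleCat.of A A) j 0
  have := hR.ext_eq_zero (j + 1) hj
  exact exists_linearMap_comp_eq (minIncl_injective hA j) (exact_minIncl_cover hA j)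
    ((minSyz hA j).cover_surjective hA) (ModuleCat.of A A) (e.toEquiv.subsingleton) u

/-- For `j = 0` there are no nonzero maps from `k` to `A`. Otherwise `u` extends to the preceding
free module, and minimality forces its values into the augmentation ideal. -/
theorem IsRegularAug.aug_apply_eq_zero (j : ℕ) (hj : j < d)
    (u : (minSyz hA j).carrier →ₗ[A] A) (x : (minSyz hA j).carrier) : ε (u x) = 0 := by
  cases j with
  | zero =>
    rw [linearMap_trivialMod_eq_zero (hR.ext_eq_zero 0 (by lia)) u]
    exact map_zero ε
  | succ j =>
    obtain ⟨v, rfl⟩ := hR.exists_extension hA j (by lia) u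
    exact aug_apply_minIncl hA j v x

theorem IsRegularAug.comp_diff_eq_zero_iff (j : ℕ) (hj : j + 1 < d)
    (u : A ⊗[k] minGen hA (j + 1) →ₗ[A] A) :
    u ∘ₗ diff hA (j + 1) = 0 ↔ ∃ v, u = v ∘ₗ diff hA j := by
  rw [← comp_minIncl_eq_zero_iff]
  constructor
  · intro h
    obtain ⟨g, rfl⟩ := exists_factor u h
    obtain ⟨v, rfl⟩ := hR.exists_extension hA j (by lia) g
    exact ⟨v, rfl⟩
  · rintro ⟨v, rfl⟩
    refine LinearMap.ext fun x => ?_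
    change v (minIncl hA j _) = 0
    rw [(exact_minIncl_cover hA (j + 1)).apply_apply_eq_zero x, map_zero, map_zero]

theorem IsRegularAug.comp_diff_zero_eq_zero_iff (hd : 0 < d) (u : A ⊗[k] minGen hA 0 →ₗ[A] A) :
    u ∘ₗ diff hA 0 = 0 ↔ u = 0 := by
  rw [← comp_minIncl_eq_zero_iff]
  constructor
  · intro h
    obtain ⟨g, rfl⟩ := exists_factor u h
    rw [linearMap_trivialMod_eq_zero (hR.ext_eq_zero 0 (by lia)) g]
    exact LinearMap.zero_comp _
  · rintro rfl
    exact LinearMap.zero_comp _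

/-- In dimension zero `k` is projective, so its minimal cover `A ⊗ k → k` is bijective. -/
theorem IsRegularAug.aug_eq_zero_iff (hd : d = 0) (a : A) : ε a = 0 ↔ a = 0 := by
  subst hd
  refine ⟨fun ha => ?_, fun ha => by rw [ha, map_zero]⟩
  have := projective_minSyz hA hR.projectiveDimension
  have : Nontrivial (minGen hA 0) :=
    Module.nontrivial_of_finrank_pos (R := k) (by rw [finrank_minGen_zero]; exact one_pos)
  obtain ⟨v, hv⟩ := exists_ne (0 : minGen hA 0)
  have h : a ⊗ₜ[k] v = 0 := ((minSyz hA 0).cover_bijective hA).1 (by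
    rw [cover_zero_tmul, ha, zero_smul, map_zero])
  obtain ⟨l, hl⟩ : ∃ l : Module.Dual k (minGen hA 0), l v ≠ 0 := by
    by_contra! hl
    exact hv ((Module.forall_dual_apply_eq_zero_iff k v).1 hl)
  have h2 := congrArg (actionMap A (Algebra.linearMap k A ∘ₗ l)) h
  rw [actionMap_tmul, map_zero, LinearMap.comp_apply, Algebra.linearMap_apply, smul_eq_mul,
    ← Algebra.commutes, ← Algebra.smul_def] at h2
  exact (smul_eq_zero.1 h2).resolve_left hl

/-- The last syzygy is `A ⊗ V`, and `Ext^d(k, A) ≅ k` is the quotient of `Hom(A ⊗ V, A)` by the maps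
that extend. By minimality such maps have zero leading part, so the dual of `V` is a quotient of
`k`. It is nonzero, whence `V` is a line and the two kernels coincide. -/
theorem IsRegularAug.top (e : ℕ) (hd : d = e + 1) :
    Module.finrank k (minGen hA (e + 1)) = 1 ∧ ∀ u : A ⊗[k] minGen hA (e + 1) →ₗ[A] A,
      (∃ v, u = v ∘ₗ diff hA e) ↔ ∀ x, ε (u (1 ⊗ₜ x)) = 0 := by
  subst hd
  have := projective_minSyz hA hR.projectiveDimension
  obtain ⟨e₁⟩ := nonempty_ext_minSyz_linearEquiv hA (ModuleCat.of A A) e 0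
  obtain ⟨e₂⟩ := hR.ext_equiv
  obtain ⟨φ, hφ, hφ0⟩ := exists_functional_of_ext_linearEquiv (minIncl_injective hA e)
    (exact_minIncl_cover hA e) ((minSyz hA e).cover_surjective hA) (e₁.trans e₂)
  let c := LinearEquiv.ofBijective _ ((minSyz hA (e + 1)).cover_bijective hA)
  let φ' : (A ⊗[k] minGen hA (e + 1) →ₗ[A] A) →ₗ[k] k :=
    φ ∘ₗ
      { toFun := fun u => u ∘ₗ c.symm.toLinearMap
        map_add' := fun u v => LinearMap.add_comp _ _ _
        map_smul' := fun r u => LinearMap.smul_comp _ _ _ }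
  have hφ' : ∀ u, φ' u = 0 ↔ ∃ v, u = v ∘ₗ diff hA e := by
    intro u
    refine (hφ0 _).trans (exists_congr fun v => ⟨fun h => ?_, fun h => ?_⟩)
    · rw [diff, ← LinearMap.comp_assoc, h]
      refine LinearMap.ext fun z => ?_
      exact congrArg u (c.symm_apply_apply z).symm
    · rw [h]
      refine LinearMap.ext fun z => ?_
      exact congrArg (v ∘ₗ minIncl hA e) (c.apply_symm_apply z).symm
  have hφs : Function.Surjective φ' := fun r => by
    obtain ⟨u, rfl⟩ := hφ r
    refine ⟨u ∘ₗ c.toLinearMap, congrArg φ (LinearMap.ext fun z => ?_)⟩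
    exact congrArg u (c.apply_symm_apply z)
  have hker : ∀ u, φ' u = 0 → leading ε _ u = 0 := by
    intro u hu
    obtain ⟨v, rfl⟩ := (hφ' u).1 hu
    exact LinearMap.ext fun x => aug_apply_minIncl hA e v _
  have : Nontrivial (Module.Dual k (minGen hA (e + 1))) := by
    by_contra hn
    rw [not_nontrivial_iff_subsingleton] at hn
    have h1 : Subsingleton (minGen hA (e + 1)) := subsingleton_of_forall_eq 0 fun x =>
      (Module.forall_dual_apply_eq_zero_iff k x).1 fun l => by
        rw [hn.elim l 0, LinearMap.zero_apply]
    obtain ⟨u, hu⟩ := hφs 1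
    have h2 : Subsingleton (A ⊗[k] minGen hA (e + 1)) := inferInstance
    have h3 : u = 0 := LinearMap.ext fun z => by rw [h2.elim z 0, map_zero, map_zero]
    rw [h3, map_zero] at hu
    exact zero_ne_one hu
  obtain ⟨h1, h2⟩ := finrank_eq_one_of_ker_le hφs (leading_surjective (A := A) (ε := ε) _) hker
  refine ⟨?_, fun u => (hφ' u).symm.trans ((h2 u).trans ⟨fun h x => ?_, fun h => ?_⟩)⟩
  · rwa [Subspace.dual_finrank_eq] at h1
  · exact LinearMap.congr_fun h x
  · exact LinearMap.ext h

/-- Finitely many generators in degree `j + 1` have differentials in `A ⊗ V'` for some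
finite-dimensional `V'`. A nonzero functional vanishing on `V'` would give a map on the `j`-th
syzygy with values outside the augmentation ideal, which is impossible for `j < d`; so `V'` is
everything. -/
theorem IsRegularAug.finiteDimensional_of_succ (j : ℕ) (hj : j < d)
    [FiniteDimensional k (minGen hA (j + 1))] : FiniteDimensional k (minGen hA j) := by
  let b := Module.finBasis k (minGen hA (j + 1))
  obtain ⟨V', hV', hs⟩ := TensorProduct.exists_finite_submodule_right_of_setFinite
    (Set.range fun i => diff hA j (1 ⊗ₜ b i)) (Set.finite_range _)
  have hrange : ∀ v, diff hA j (1 ⊗ₜ v) ∈ LinearMap.range (V'.subtype.lTensor A) := by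
    intro v
    induction b.mem_span v using Submodule.span_induction with
    | mem v hv =>
      obtain ⟨i, rfl⟩ := hv
      exact hs ⟨i, rfl⟩
    | zero => rw [TensorProduct.tmul_zero, map_zero]; exact zero_mem _
    | add x y _ _ hx hy => rw [TensorProduct.tmul_add, map_add]; exact add_mem hx hy
    | smul c x _ hx =>
      rw [TensorProduct.tmul_smul, LinearMap.map_smul_of_tower]
      exact Submodule.smul_mem _ c hx
  have htop : V' = ⊤ := by
    by_contra hne
    obtain ⟨l, hl0, hl⟩ := Submodule.exists_le_ker_of_lt_top V' (lt_top_iff_ne_top.2 hne)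
    obtain ⟨v, hv⟩ : ∃ v, l v ≠ 0 := by
      by_contra! h
      exact hl0 (LinearMap.ext h)
    let u := actionMap A (Algebra.linearMap k A ∘ₗ l)
    have hu : ∀ z ∈ LinearMap.range (V'.subtype.lTensor A), u z = 0 := by
      rintro _ ⟨z, rfl⟩
      induction z with
      | zero => simp
      | add x y hx hy => rw [map_add, map_add, hx, hy, add_zero]
      | tmul a x =>
        rw [LinearMap.lTensor_tmul, actionMap_tmul, LinearMap.comp_apply, Submodule.subtype_apply,
          LinearMap.mem_ker.1 (hl x.2), map_zero, smul_zero]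
    obtain ⟨g, hg⟩ := exists_factor u <| (comp_minIncl_eq_zero_iff u).2 <| LinearMap.ext fun z => by
      induction z with
      | zero => simp
      | add x y hx hy => rw [map_add, hx, hy, map_add]
      | tmul a x =>
        have : (a ⊗ₜ x : A ⊗[k] minGen hA (j + 1)) = a • (1 ⊗ₜ x) := by
          rw [TensorProduct.smul_tmul', smul_eq_mul, mul_one]
        rw [this, map_smul, map_smul, LinearMap.comp_apply, hu _ (hrange x), LinearMap.zero_apply]
    have h1 := hR.aug_apply_eq_zero hA j hj g ((minSyz hA j).cover hA (1 ⊗ₜ v))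
    rw [← LinearMap.comp_apply, hg, actionMap_tmul, one_smul] at h1
    exact hv ((ε.commutes (l v)).symm.trans h1)
  rw [htop] at hV'
  exact Module.Finite.equiv (Submodule.topEquiv (R := k) (M := minGen hA j))

theorem IsRegularAug.finiteDimensional (j : ℕ) : FiniteDimensional k (minGen hA j) := by
  have htop : FiniteDimensional k (minGen hA d) := by
    rcases Nat.eq_zero_or_pos d with hd | hd
    · rw [hd]
      exact Module.finite_of_finrank_eq_succ (finrank_minGen_zero hA)
    · obtain ⟨e, rfl⟩ : ∃ e, d = e + 1 := ⟨d - 1, by lia⟩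
      exact Module.finite_of_finrank_eq_succ (hR.top hA e rfl).1
  rcases le_or_gt j d with hj | hj
  · induction hj using Nat.decreasingInduction with
    | self => exact htop
    | of_succ j hj ih => exact hR.finiteDimensional_of_succ hA j hj
  · have := subsingleton_minSyz hA hR.projectiveDimension j hj
    infer_instance

end Regular

/-! ### Matrices of maps between free modules. -/

section BasisMatrix

variable {A M N : Type*} [Ring A] [AddCommGroup M] [Module A M] [AddCommGroup N] [Module A N]
  {m n : Type*} [Fintype m] [Fintype n]

/-- The matrix acting on rows of a linear map between free left modules. -/
def rowMatrix (b : Module.Basis m A M) (c : Module.Basis n A N) (f : M →ₗ[A] N) : Matrix m n A :=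
  fun i j => c.equivFun (f (b i)) j

theorem vecMul_rowMatrix (b : Module.Basis m A M) (c : Module.Basis n A N) (f : M →ₗ[A] N)
    (z : M) : Matrix.vecMul (b.equivFun z) (rowMatrix b c f) = c.equivFun (f z) := by
  conv_rhs => rw [← b.sum_equivFun z]
  rw [map_sum, map_sum]
  ext j
  rw [Finset.sum_apply]
  refine Finset.sum_congr rfl fun i _ => ?_
  rw [map_smul, map_smul]
  rfl

omit [Fintype m] in
theorem rowMatrix_mulVec (b : Module.Basis m A M) (c : Module.Basis n A N) (f : M →ₗ[A] N)
    (u : N →ₗ[A] A) : Matrix.mulVec (rowMatrix b c f) (fun j => u (c j)) =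
      fun i => (u ∘ₗ f) (b i) := by
  ext i
  rw [LinearMap.comp_apply]
  conv_rhs => rw [← c.sum_equivFun (f (b i))]
  rw [map_sum]
  refine Finset.sum_congr rfl fun j _ => ?_
  rw [map_smul, smul_eq_mul]
  rfl

omit [Fintype n] in
theorem Module.Basis.exists_linearMap (c : Module.Basis n A N) (w : n → A) :
    ∃ u : N →ₗ[A] A, (fun j => u (c j)) = w :=
  ⟨c.constr ℕ w, funext fun j => c.constr_basis ℕ w j⟩

end BasisMatrix

/-! ### The two-sided finite free resolution of a regular algebra. -/

section Resolution

open Abelian GradedMod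

variable {k : Type u} [Field k] {A : Type u} [Ring A] [Algebra k A]
variable {pA : ℕ → A →ₗ[k] A} {ε : A →ₐ[k] k} {d : ℕ}

/-- The index types of the bases of the minimal resolution. -/
def minIndex (hA : IsConnectedProj pA ε) : ℕ → Type
  | 0 => Empty
  | j + 1 => Fin (Module.finrank k (minGen hA j))

instance (hA : IsConnectedProj pA ε) : ∀ j, Fintype (minIndex hA j)
  | 0 => inferInstanceAs (Fintype Empty)
  | _ + 1 => inferInstanceAs (Fintype (Fin _))

instance (hA : IsConnectedProj pA ε) : IsEmpty (minIndex hA 0) := inferInstanceAs (IsEmpty Empty)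

variable (hA : IsConnectedProj pA ε) (hR : IsRegularAug A ε d)

/-- The bases of the generators of the minimal resolution. -/
def IsRegularAug.genBasis (j : ℕ) : Module.Basis (minIndex hA (j + 1)) k (minGen hA j) :=
  have := hR.finiteDimensional hA j
  Module.finBasis k (minGen hA j)

/-- The bases of the minimal resolution. -/
def IsRegularAug.basis (j : ℕ) : Module.Basis (minIndex hA (j + 1)) A (A ⊗[k] minGen hA j) :=
  Algebra.TensorProduct.basis A (hR.genBasis hA j)

theorem IsRegularAug.basis_apply (j : ℕ) (i : minIndex hA (j + 1)) :
    hR.basis hA j i = 1 ⊗ₜ hR.genBasis hA j i :=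
  Algebra.TensorProduct.basis_apply _ _

/-- The matrices of the minimal resolution. -/
def IsRegularAug.matrix : ∀ j, Matrix (minIndex hA (j + 1)) (minIndex hA j) A
  | 0 => fun _ x => x.elim
  | j + 1 => rowMatrix (hR.basis hA (j + 1)) (hR.basis hA j) (diff hA j)

theorem IsRegularAug.matrix_zero_mulVec (u : minIndex hA 0 → A) :
    Matrix.mulVec (hR.matrix hA 0) u = 0 :=
  funext fun _ => by simp [Matrix.mulVec, dotProduct]

theorem IsRegularAug.exists_vecMul_iff (j : ℕ) (z : A ⊗[k] minGen hA j) :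
    (∃ y, z = diff hA j y) ↔
      ∃ u, (hR.basis hA j).equivFun z = Matrix.vecMul u (hR.matrix hA (j + 1)) := by
  rw [(hR.basis hA (j + 1)).equivFun.surjective.exists]
  refine exists_congr fun y => ?_
  rw [matrix, vecMul_rowMatrix, EmbeddingLike.apply_eq_iff_eq]

theorem IsRegularAug.exists_mulVec_iff (j : ℕ) (v : A ⊗[k] minGen hA (j + 1) →ₗ[A] A) :
    (∃ y, v = y ∘ₗ diff hA j) ↔
      ∃ u, (fun i => v (hR.basis hA (j + 1) i)) = Matrix.mulVec (hR.matrix hA (j + 1)) u := by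
  constructor
  · rintro ⟨y, rfl⟩
    exact ⟨fun i => y (hR.basis hA j i), by rw [matrix, rowMatrix_mulVec]⟩
  · rintro ⟨u, hu⟩
    obtain ⟨y, rfl⟩ := (hR.basis hA j).exists_linearMap u
    rw [matrix, rowMatrix_mulVec] at hu
    exact ⟨y, (hR.basis hA (j + 1)).ext fun i => congrFun hu i⟩

theorem IsRegularAug.mulVec_eq_zero_iff (j : ℕ) (u : A ⊗[k] minGen hA j →ₗ[A] A) :
    Matrix.mulVec (hR.matrix hA (j + 1)) (fun i => u (hR.basis hA j i)) = 0 ↔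
      u ∘ₗ diff hA j = 0 := by
  rw [matrix, rowMatrix_mulVec]
  exact ⟨fun h => (hR.basis hA (j + 1)).ext fun i => congrFun h i, fun h => by rw [h]; rfl⟩

theorem finrank_eq_zero_iff_minIndex (j : ℕ) (h : Module.finrank k (minGen hA j) = 0) :
    IsEmpty (minIndex hA (j + 1)) := by
  rw [minIndex, h]
  infer_instance

/-- A minimal index type of size one. -/
@[reducible]
def uniqueMinIndex (j : ℕ) (h : Module.finrank k (minGen hA j) = 1) : Unique (minIndex hA (j + 1)) :=
  (finCongr h).unique

include hR in
theorem IsRegularAug.finrank_top : Module.finrank k (minGen hA d) = 1 := by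
  cases d with
  | zero => exact finrank_minGen_zero hA
  | succ e => exact (hR.top hA e rfl).1

/-- The finite free resolution of the trivial module of a regular algebra. -/
def IsRegularAug.resolution : FiniteFreeResolution A {a | ε a = 0} {a | ε a = 0} d where
  ι := minIndex hA
  fintype := inferInstance
  D := hR.matrix hA
  isEmpty_zero := inferInstanceAs (IsEmpty Empty)
  unique_one := uniqueMinIndex hA 0 (finrank_minGen_zero hA)
  unique_top := uniqueMinIndex hA d (hR.finrank_top hA)
  isEmpty_of_lt i hi := by
    obtain ⟨j, rfl⟩ : ∃ j, i = j + 1 := ⟨i - 1, by lia⟩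
    have := subsingleton_minSyz hA hR.projectiveDimension j (by lia)
    exact finrank_eq_zero_iff_minIndex hA j (Module.finrank_zero_of_subsingleton)
  exact_left i v := by
    obtain ⟨z, rfl⟩ := (hR.basis hA (i + 1)).equivFun.surjective v
    rw [← hR.exists_vecMul_iff, ← diff_eq_zero_iff, matrix, vecMul_rowMatrix,
      LinearEquiv.map_eq_zero_iff]
  left x := by
    let := uniqueMinIndex hA 0 (finrank_minGen_zero hA)
    rw [Set.mem_ofPred_eq, mem_range_diff_zero_iff hA ((hR.genBasis hA 0).ne_zero default),
      hR.exists_vecMul_iff]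
    have : (hR.basis hA 0).equivFun (x ⊗ₜ hR.genBasis hA 0 default) = fun _ => x := by
      have h1 : (x ⊗ₜ hR.genBasis hA 0 default : A ⊗[k] minGen hA 0) =
          x • hR.basis hA 0 default := by
        rw [hR.basis_apply, TensorProduct.smul_tmul', smul_eq_mul, mul_one]
      rw [h1, map_smul]
      funext i
      rw [Subsingleton.elim i default]
      simp
    rw [this]
  exact_right i hi w := by
    obtain ⟨u, rfl⟩ := (hR.basis hA i).exists_linearMap w
    rw [hR.mulVec_eq_zero_iff]
    -- For `i = 0` the matrix `D 0` has no columns, and exactness is injectivity of the dual of the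
    -- first differential, that is, `Hom(k, A) = 0`.
    cases i with
    | zero =>
      rw [hR.comp_diff_zero_eq_zero_iff hA hi]
      simp only [hR.matrix_zero_mulVec]
      constructor
      · rintro rfl
        exact ⟨isEmptyElim, rfl⟩
      · rintro ⟨_, hy⟩
        exact (hR.basis hA 0).ext fun j => congrFun hy j
    | succ j => rw [hR.comp_diff_eq_zero_iff hA j hi, hR.exists_mulVec_iff]
  right x := by
    rw [Set.mem_ofPred_eq]
    -- For `d = 0` the image of `D 0` is zero, and so is the augmentation ideal. For `d > 0` the
    -- image of the last transposed differential is described by `IsRegularAug.top`.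
    cases d with
    | zero =>
      rw [hR.aug_eq_zero_iff hA rfl]
      let := uniqueMinIndex hA 0 (finrank_minGen_zero hA)
      simp only [hR.matrix_zero_mulVec]
      constructor
      · rintro rfl
        exact ⟨isEmptyElim, rfl⟩
      · rintro ⟨_, hy⟩
        exact congrFun hy default
    | succ e =>
      let := uniqueMinIndex hA (e + 1) (hR.finrank_top hA)
      obtain ⟨u, hu⟩ := (hR.basis hA (e + 1)).exists_linearMap fun _ => x
      rw [← hu, ← hR.exists_mulVec_iff, (hR.top hA e rfl).2]
      have h1 : u (1 ⊗ₜ hR.genBasis hA (e + 1) default) = x := by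
        rw [← hR.basis_apply]
        exact congrFun hu default
      constructor
      · intro hx v
        have h2 : v = (hR.genBasis hA (e + 1)).repr v default • hR.genBasis hA (e + 1) default := by
          conv_lhs => rw [← (hR.genBasis hA (e + 1)).sum_repr v]
          exact Fintype.sum_unique _
        rw [h2, TensorProduct.tmul_smul, LinearMap.map_smul_of_tower, map_smul, h1, hx, smul_zero]
      · intro h
        rw [← h1]
        exact h _

end Resolution

/-! ### Invariance of Ext under isomorphism. -/

section ExtIso

open Abelian

variable {k : Type u} [Field k] {R : Type u} [Ring R] [Algebra k R]

/-- Isomorphic modules have isomorphic `Ext`. -/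
def extLinearEquivOfIso {X Y : ModuleCat.{u} R} (e : X ≅ Y) (N : ModuleCat.{u} R) (n : ℕ) :
    Ext Y N n ≃ₗ[k] Ext X N n where
  __ := (Ext.mk₀ e.hom).precompOfLinear k N (zero_add n)
  invFun := (Ext.mk₀ e.inv).precompOfLinear k N (zero_add n)
  left_inv x := by
    change (Ext.mk₀ e.inv).comp ((Ext.mk₀ e.hom).comp x (zero_add n)) (zero_add n) = x
    rw [Ext.mk₀_comp_mk₀_assoc, e.inv_hom_id, Ext.mk₀_id_comp]
  right_inv x := by
    change (Ext.mk₀ e.hom).comp ((Ext.mk₀ e.inv).comp x (zero_add n)) (zero_add n) = x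
    rw [Ext.mk₀_comp_mk₀_assoc, e.hom_inv_id, Ext.mk₀_id_comp]

end ExtIso

/-! ### Twisted tensor products and their regularity. -/

section Twisted

open Abelian

variable {k : Type u} [Field k] {A B R : Type u} [Ring A] [Algebra k A] [Ring B] [Algebra k B]
  [Ring R] [Algebra k R]

/-- The map `A ⊗ B → R`, `a ⊗ b ↦ f(a) g(b)`. -/
def mulMap (f : A →ₐ[k] R) (g : B →ₐ[k] R) : A ⊗[k] B →ₗ[k] R :=
  LinearMap.mul' k R ∘ₗ TensorProduct.map f.toLinearMap g.toLinearMap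

@[simp] theorem mulMap_tmul (f : A →ₐ[k] R) (g : B →ₐ[k] R) (a : A) (b : B) :
    mulMap f g (a ⊗ₜ b) = f a * g b := rfl

/-- `R` is a twisted tensor product of `A` and `B`, with a projection `R → B` that extends the
augmentation of `A`. -/
structure IsTwistedTensor (f : A →ₐ[k] R) (g : B →ₐ[k] R) (π : R →ₐ[k] B) (ε : A →ₐ[k] k) :
    Prop where
  proj_right : ∀ b, π (g b) = b
  proj_left : ∀ a, π (f a) = algebraMap k B (ε a)
  bijective_left : Function.Bijective (mulMap f g)
  bijective_right : Function.Bijective (mulMap g f)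

namespace IsTwistedTensor

variable {f : A →ₐ[k] R} {g : B →ₐ[k] R} {π : R →ₐ[k] B} {ε : A →ₐ[k] k}
  (h : IsTwistedTensor f g π ε)

/-- `R` is free as a left `A`-module. -/
def leftEquiv {K : Type*} [DecidableEq K] (b : Module.Basis K k B) : R ≃ₗ[k] (K →₀ A) :=
  (LinearEquiv.ofBijective _ h.bijective_left).symm ≪≫ₗ
    TensorProduct.equivFinsuppOfBasisRight b

/-- `R` is free as a right `A`-module. -/
def rightEquiv {K : Type*} [DecidableEq K] (b : Module.Basis K k B) : R ≃ₗ[k] (K →₀ A) :=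
  (LinearEquiv.ofBijective _ h.bijective_right).symm ≪≫ₗ
    TensorProduct.equivFinsuppOfBasisLeft b

theorem leftEquiv_mul {K : Type*} [DecidableEq K] (b : Module.Basis K k B) (x : A) (y : B) (i : K) :
    h.leftEquiv b (f x * g y) i = b.repr y i • x := by
  have : (LinearEquiv.ofBijective _ h.bijective_left).symm (f x * g y) = x ⊗ₜ y := by
    rw [LinearEquiv.symm_apply_eq]
    rfl
  rw [leftEquiv, LinearEquiv.trans_apply, this, TensorProduct.equivFinsuppOfBasisRight_apply_tmul_apply]

theorem rightEquiv_mul {K : Type*} [DecidableEq K] (b : Module.Basis K k B) (x : A) (y : B) (i : K) :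
    h.rightEquiv b (g y * f x) i = b.repr y i • x := by
  have : (LinearEquiv.ofBijective _ h.bijective_right).symm (g y * f x) = y ⊗ₜ x := by
    rw [LinearEquiv.symm_apply_eq]
    rfl
  rw [rightEquiv, LinearEquiv.trans_apply, this, TensorProduct.equivFinsuppOfBasisLeft_apply_tmul_apply]

include h in
theorem induction_left {p : R → Prop} (h0 : p 0) (hadd : ∀ x y, p x → p y → p (x + y))
    (hmul : ∀ a b, p (f a * g b)) (r : R) : p r := by
  obtain ⟨z, rfl⟩ := h.bijective_left.2 r
  induction z with
  | zero => rwa [map_zero]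
  | add x y hx hy => rw [map_add]; exact hadd _ _ hx hy
  | tmul a b => exact hmul a b

include h in
theorem induction_right {p : R → Prop} (h0 : p 0) (hadd : ∀ x y, p x → p y → p (x + y))
    (hmul : ∀ a b, p (g b * f a)) (r : R) : p r := by
  obtain ⟨z, rfl⟩ := h.bijective_right.2 r
  induction z with
  | zero => rwa [map_zero]
  | add x y hx hy => rw [map_add]; exact hadd _ _ hx hy
  | tmul b a => exact hmul a b

theorem leftEquiv_smul {K : Type*} [DecidableEq K] (b : Module.Basis K k B) (r : R) (a : A) (i : K) :
    h.leftEquiv b (f a * r) i = a * h.leftEquiv b r i := by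
  induction r using h.induction_left with
  | h0 => simp
  | hadd x y hx hy => simp only [mul_add, map_add, Finsupp.add_apply, hx, hy]
  | hmul x y => rw [← mul_assoc, ← map_mul, leftEquiv_mul, leftEquiv_mul, mul_smul_comm]

theorem rightEquiv_smul {K : Type*} [DecidableEq K] (b : Module.Basis K k B) (r : R) (a : A) (i : K) :
    h.rightEquiv b (r * f a) i = h.rightEquiv b r i * a := by
  induction r using h.induction_right with
  | h0 => simp
  | hadd x y hx hy => simp only [add_mul, map_add, Finsupp.add_apply, hx, hy]
  | hmul x y => rw [mul_assoc, ← map_mul, rightEquiv_mul, rightEquiv_mul, smul_mul_assoc]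

/-- This describes the kernel of `π` in coordinates: it consists of the elements whose coordinates
over `A` all lie in the augmentation ideal. The same holds for the other decomposition. -/
theorem repr_proj_left {K : Type*} [DecidableEq K] (b : Module.Basis K k B) (r : R) (i : K) :
    b.repr (π r) i = ε (h.leftEquiv b r i) := by
  induction r using h.induction_left with
  | h0 => simp
  | hadd x y hx hy => simp only [map_add, Finsupp.add_apply, hx, hy]
  | hmul x y =>
    rw [map_mul, h.proj_right, h.proj_left, leftEquiv_mul, ← Algebra.smul_def, map_smul, map_smul,
      Finsupp.smul_apply, smul_eq_mul, smul_eq_mul, mul_comm]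

theorem repr_proj_right {K : Type*} [DecidableEq K] (b : Module.Basis K k B) (r : R) (i : K) :
    b.repr (π r) i = ε (h.rightEquiv b r i) := by
  induction r using h.induction_right with
  | h0 => simp
  | hadd x y hx hy => simp only [map_add, Finsupp.add_apply, hx, hy]
  | hmul x y =>
    rw [map_mul, h.proj_right, h.proj_left, rightEquiv_mul, ← Algebra.commutes, ← Algebra.smul_def,
      map_smul, map_smul, Finsupp.smul_apply, smul_eq_mul, smul_eq_mul, mul_comm]

/-- The base change to `R` of a resolution of the trivial `A`-module resolves `B`. -/
def baseChange {d : ℕ} (X : FiniteFreeResolution A {a | ε a = 0} {a | ε a = 0} d) :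
    FiniteFreeResolution R {r | (π : R →+* B) r = 0} {r | (π : R →+* B) r = 0} d :=
  let _ := Classical.decEq (Module.Basis.ofVectorSpaceIndex k B)
  let b := Module.Basis.ofVectorSpace k B
  -- Row vectors are multiplied by matrices on the right, so the resolution of left modules uses `R`
  -- as a right `A`-module, and the transpose uses it as a left one.
  X.map (f : A →+* R) (h.rightEquiv b).toAddEquiv (h.rightEquiv_smul b)
    (h.leftEquiv b).toAddEquiv (h.leftEquiv_smul b)
    (fun x => by
      change π x = 0 ↔ ∀ i, ε (h.rightEquiv b x i) = 0
      rw [← b.repr.map_eq_zero_iff, Finsupp.ext_iff]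
      simp only [h.repr_proj_right, Finsupp.zero_apply])
    (fun x => by
      change π x = 0 ↔ ∀ i, ε (h.leftEquiv b x i) = 0
      rw [← b.repr.map_eq_zero_iff, Finsupp.ext_iff]
      simp only [h.repr_proj_left, Finsupp.zero_apply])

include h in
/-- Twisted tensor products of regular algebras are regular. -/
theorem isRegularAug {d₁ d₂ : ℕ} (X : FiniteFreeResolution A {a | ε a = 0} {a | ε a = 0} d₁)
    {ε' : B →ₐ[k] k} (Y : FiniteFreeResolution B {b | ε' b = 0} {b | ε' b = 0} d₂) :
    IsRegularAug R (ε'.comp π) (d₁ + d₂) := by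
  have hπ : Function.Surjective (π : R →+* B) := fun b => ⟨g b, h.proj_right b⟩
  have hε' : Function.Surjective (ε' : B →+* k) := fun c => ⟨algebraMap k B c, ε'.commutes c⟩
  -- The module `B` over `R` now plays the part of the free module of rank one, with its `Ext` into
  -- `R` in degree `d₁`; the resolution `Y`, restricted to `R`, contributes the remaining `d₂`.
  obtain ⟨e, he⟩ := (h.baseChange X).isExtGenerator hπ
  have hpd := Y.hasProjectiveDimensionLT (ModuleCat.restrictScalars (π : R →+* B)) (c := d₁)
    ((h.baseChange X).hasProjectiveDimensionLT_quotient hπ)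
  have := restrictScalars_linear π
  obtain ⟨e₁⟩ := Y.ext_linearEquiv (ModuleCat.restrictScalars (π : R →+* B)) he ε' fun x => Iff.rfl
  have h0 := fun n hn => Y.ext_subsingleton he (n := n) hn
  let Y' : FiniteFreeResolution B {b | (ε' : B →+* k) b = 0} {b | (ε' : B →+* k) b = 0} d₂ := Y
  have := Y'.isIso_toQuotient hε'
  let i₁ := (ModuleCat.restrictScalars (π : R →+* B)).mapIso (asIso Y'.toQuotient)
  let M : ModuleCat.{u} R := (ModuleCat.restrictScalars (π : R →+* B)).obj
    ((ModuleCat.restrictScalars (ε' : B →+* k)).obj (ModuleCat.of k k))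
  -- Restricting `k` along `ε'` and then along `π` gives the trivial module of the composite
  -- augmentation, with the same action by definition.
  let l : M ≃ₗ[R] TrivialMod (ε'.comp π) k :=
    { toFun := fun x => x
      map_add' := fun x y => rfl
      map_smul' := fun r x => rfl
      invFun := fun x => x
      left_inv := fun x => rfl
      right_inv := fun x => rfl }
  let i₂ : M ≅ ModuleCat.of R (TrivialMod (ε'.comp π) k) := l.toModuleIso
  let i := i₁ ≪≫ i₂
  refine ⟨hasProjectiveDimensionLT_of_iso i _, fun n hn => ?_, ⟨?_⟩⟩
  · have := h0 n hn
    exact (extLinearEquivOfIso (k := k) i (ModuleCat.of R R) n).toEquiv.subsingleton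
  · exact extLinearEquivOfIso (k := k) i (ModuleCat.of R R) (d₁ + d₂) ≪≫ₗ e₁

end IsTwistedTensor

end Twisted

/-! ### Internal gradings by integers. -/

section IntegerGradings

variable {k : Type u} [Field k] {M : Type u} [AddCommGroup M] [Module k M] {ℳ : ℤ → Submodule k M}

/-- The projections of an internal direct sum. -/
def gradedProj (h : DirectSum.IsInternal ℳ) (n : ℤ) : M →ₗ[k] M :=
  (ℳ n).subtype ∘ₗ DirectSum.component k ℤ (fun i => ℳ i) n ∘ₗ
    (LinearEquiv.ofBijective (DirectSum.coeLinearMap ℳ) h).symm.toLinearMap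

theorem gradedProj_mem (h : DirectSum.IsInternal ℳ) (n : ℤ) (x : M) : gradedProj h n x ∈ ℳ n :=
  Subtype.property _

theorem gradedProj_of_mem (h : DirectSum.IsInternal ℳ) {m : ℤ} {x : M} (hx : x ∈ ℳ m) (n : ℤ) :
    gradedProj h n x = if n = m then x else 0 := by
  have : (LinearEquiv.ofBijective (DirectSum.coeLinearMap ℳ) h).symm x =
      DirectSum.lof k ℤ (fun i => ℳ i) m ⟨x, hx⟩ := by
    rw [LinearEquiv.symm_apply_eq]
    exact (DirectSum.coeLinearMap_lof ℳ m (⟨x, hx⟩ : ℳ m)).symm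
  rw [gradedProj, LinearMap.comp_apply, LinearMap.comp_apply, LinearEquiv.coe_coe, this]
  split_ifs with hnm
  · subst hnm
    rw [DirectSum.component.lof_self]
    rfl
  · rw [DirectSum.component.of, dif_neg (Ne.symm hnm), map_zero]

theorem mem_of_internal (h : DirectSum.IsInternal ℳ) {p : M → Prop} (h0 : p 0)
    (hadd : ∀ x y, p x → p y → p (x + y)) (hm : ∀ n, ∀ x ∈ ℳ n, p x) (x : M) : p x := by
  have hx : x ∈ ⨆ n, ℳ n := h.submodule_iSup_eq_top ▸ Submodule.mem_top
  induction hx using Submodule.iSup_induction' with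
  | mem n x hx => exact hm n x hx
  | zero => exact h0
  | add x y _ _ hx hy => exact hadd x y hx hy

/-- A criterion for internal direct sums in terms of linear maps that separate degrees. -/
theorem isInternal_of_separating {ι N : Type*} [AddCommGroup N] [Module k N]
    (L : ℤ → ι → M →ₗ[k] N) (h1 : ∀ m n, n ≠ m → ∀ x ∈ ℳ m, ∀ i, L n i x = 0)
    (h2 : ∀ n, ∀ x ∈ ℳ n, (∀ i, L n i x = 0) → x = 0) (h3 : ∀ x, x ∈ ⨆ n, ℳ n) :
    DirectSum.IsInternal ℳ := by
  rw [DirectSum.isInternal_submodule_iff_iSupIndep_and_iSup_eq_top]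
  refine ⟨fun n => Submodule.disjoint_def.2 fun x hx hx' => h2 n x hx fun i => ?_,
    eq_top_iff.2 fun x _ => h3 x⟩
  have hle : (⨆ (m : ℤ) (_ : m ≠ n), ℳ m) ≤ LinearMap.ker (L n i) :=
    iSup₂_le fun m hm y hy => h1 m n hm.symm y hy i
  exact hle hx'

end IntegerGradings

/-! ### Augmentations of connected graded algebras and AS-regularity. -/

section Connected

variable {k : Type u} [Field k] {A : Type u} [Ring A] [Algebra k A] {𝒜 : ℤ → Submodule k A}

namespace IsConnectedGraded

variable (h : IsConnectedGraded 𝒜)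

/-- The projections of a connected graded algebra. -/
def proj (n : ℕ) : A →ₗ[k] A := gradedProj h.isGraded.isInternal n

theorem homog_iff (n : ℕ) (x : A) : Homog h.proj n x ↔ x ∈ 𝒜 n := by
  constructor
  · intro hx
    rw [← hx.eq_self]
    exact gradedProj_mem _ _ _
  · intro hx m
    rw [proj, gradedProj_of_mem _ hx]
    simp only [Nat.cast_inj]

include h in
theorem induction {p : A → Prop} (h0 : p 0) (hadd : ∀ x y, p x → p y → p (x + y))
    (hm : ∀ n : ℕ, ∀ x ∈ 𝒜 n, p x) (x : A) : p x := by
  refine mem_of_internal h.isGraded.isInternal h0 hadd (fun n x hx => ?_) x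
  rcases lt_or_ge n 0 with hn | hn
  · rw [h.neg_eq_bot n hn, Submodule.mem_bot] at hx
    rwa [hx]
  · lift n to ℕ using hn
    exact hm n x hx

include h in
theorem algebraMap_injective : Function.Injective (algebraMap k A) :=
  have := h.nontrivial
  (algebraMap k A).injective

theorem exists_aug (x : A) : ∃ c : k, algebraMap k A c = h.proj 0 x := by
  have := gradedProj_mem h.isGraded.isInternal 0 x
  rw [h.zero_eq] at this
  exact this

theorem proj_zero_mul (x y : A) : h.proj 0 (x * y) = h.proj 0 x * h.proj 0 y := by
  induction x using h.induction with
  | h0 => simp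
  | hadd x x' hx hx' => simp only [add_mul, map_add, hx, hx']
  | hm m x hx =>
    induction y using h.induction with
    | h0 => simp
    | hadd y y' hy hy' => simp only [mul_add, map_add, hy, hy']
    | hm n y hy =>
      have hxy : x * y ∈ 𝒜 (m + n : ℕ) := by
        have := h.isGraded.gradedMonoid.mul_mem hx hy
        rwa [← Nat.cast_add] at this
      rw [(h.homog_iff _ _).2 hx, (h.homog_iff _ _).2 hy, (h.homog_iff _ _).2 hxy]
      by_cases hm : m = 0 <;> by_cases hn : n = 0 <;> simp [hm, hn, eq_comm]

/-- The underlying function of the augmentation. -/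
def augFun (x : A) : k := (h.exists_aug x).choose

theorem algebraMap_augFun (x : A) : algebraMap k A (h.augFun x) = h.proj 0 x :=
  (h.exists_aug x).choose_spec

/-- The augmentation of a connected graded algebra. -/
def aug : A →ₐ[k] k where
  toFun := h.augFun
  map_one' := h.algebraMap_injective (by
    rw [algebraMap_augFun, map_one (algebraMap k A)]
    exact ((h.homog_iff 0 1).2 h.isGraded.gradedMonoid.one_mem).eq_self)
  map_mul' x y := h.algebraMap_injective (by
    rw [map_mul (algebraMap k A), algebraMap_augFun, algebraMap_augFun, algebraMap_augFun,
      h.proj_zero_mul])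
  map_zero' := h.algebraMap_injective (by
    rw [algebraMap_augFun, map_zero, map_zero])
  map_add' x y := h.algebraMap_injective (by
    rw [map_add, algebraMap_augFun, algebraMap_augFun, algebraMap_augFun, map_add])
  commutes' c := h.algebraMap_injective (by
    rw [algebraMap_augFun]
    refine ((h.homog_iff 0 _).2 ?_).eq_self
    rw [Nat.cast_zero, h.zero_eq]
    exact ⟨c, rfl⟩)

theorem isConnectedProj : IsConnectedProj h.proj h.aug where
  isGrading x := by
    induction x using h.induction with
    | h0 => exact zero_mem _
    | hadd x y hx hy => exact add_mem hx hy
    | hm n x hx => exact Submodule.subset_span ⟨n, (h.homog_iff n x).2 hx⟩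
  mul {i j a b} ha hb := by
    rw [homog_iff] at ha hb ⊢
    rw [Nat.cast_add]
    exact h.isGraded.gradedMonoid.mul_mem ha hb
  zero a := (h.algebraMap_augFun a).symm

theorem aug_of_mem {n : ℤ} (hn : n ≠ 0) {x : A} (hx : x ∈ 𝒜 n) : h.aug x = 0 := by
  rcases lt_or_ge n 0 with hn' | hn'
  · rw [h.neg_eq_bot n hn', Submodule.mem_bot] at hx
    rw [hx, map_zero]
  · lift n to ℕ using hn'
    exact h.isConnectedProj.aug_eq_zero (by exact_mod_cast hn) ((h.homog_iff n x).2 hx)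

/-- The part of degree zero consists of scalars, on which algebra maps to `k` agree. -/
theorem aug_unique (φ : A →ₐ[k] k) (hφ : ∀ n : ℕ, n ≠ 0 → ∀ x ∈ 𝒜 n, φ x = 0) : φ = h.aug := by
  refine AlgHom.ext fun x => ?_
  induction x using h.induction with
  | h0 => rw [map_zero, map_zero]
  | hadd x y hx hy => rw [map_add, map_add, hx, hy]
  | hm n x hx =>
    by_cases hn : n = 0
    · subst hn
      rw [Nat.cast_zero, h.zero_eq] at hx
      obtain ⟨c, rfl⟩ := hx
      exact (φ.commutes c).trans (h.aug.commutes c).symm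
    · rw [hφ n hn x hx, h.aug_of_mem (by exact_mod_cast hn) hx]

theorem mem_geOne_iff (x : A) : x ∈ geOne 𝒜 ↔ h.aug x = 0 := by
  constructor
  · intro hx
    have hle : geOne 𝒜 ≤ LinearMap.ker h.aug.toLinearMap :=
      iSup₂_le fun n hn y hy => h.aug_of_mem (by lia) hy
    exact hle hx
  · intro hx
    have key : ∀ x, x - algebraMap k A (h.aug x) ∈ geOne 𝒜 := by
      intro x
      induction x using h.induction with
      | h0 => simp
      | hadd x y hx hy =>
        rw [map_add, map_add, add_sub_add_comm]
        exact add_mem hx hy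
      | hm n x hx =>
        by_cases hn : n = 0
        · subst hn
          rw [Nat.cast_zero, h.zero_eq] at hx
          obtain ⟨c, rfl⟩ := hx
          rw [Algebra.linearMap_apply, AlgHom.commutes, Algebra.algebraMap_self_apply, sub_self]
          exact zero_mem _
        · rw [h.aug_of_mem (by exact_mod_cast hn) hx, map_zero, sub_zero]
          exact Submodule.mem_iSup_of_mem (n : ℤ) (Submodule.mem_iSup_of_mem (by lia) hx)
    simpa [hx] using key x

/-- The trivial module is `k` with the action through the augmentation. -/
def trivialIso : trivialModule 𝒜 ≅ ModuleCat.of A (TrivialMod h.aug k) :=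
  let f : A →ₗ[A] TrivialMod h.aug k :=
    { toFun := h.aug
      map_add' := map_add h.aug
      map_smul' := fun a x => map_mul h.aug a x }
  have hf : Function.Surjective f := fun c => ⟨algebraMap k A c, h.aug.commutes c⟩
  have hk : Ideal.span (geOne 𝒜 : Set A) = LinearMap.ker f := by
    have : (geOne 𝒜 : Set A) = LinearMap.ker f := Set.ext h.mem_geOne_iff
    rw [this]
    exact Submodule.span_eq (LinearMap.ker f)
  (Submodule.quotEquivOfEq _ _ hk ≪≫ₗ f.quotKerEquivOfSurjective hf).toModuleIso

end IsConnectedGraded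

open Abelian

theorem IsASRegular.isRegularAug {d : ℕ} (h : IsASRegular 𝒜 d) :
    IsRegularAug A h.connected.aug d := by
  have e := h.connected.trivialIso
  refine ⟨?_, fun i hi => ?_, ?_⟩
  · have hpd : projectiveDimension (trivialModule 𝒜) ≤ d :=
      (le_iSup (fun M : ModuleCat.{u} A => projectiveDimension M) _).trans h.globalDimension_eq.le
    have : HasProjectiveDimensionLT (trivialModule 𝒜) (d + 1) :=
      (projectiveDimension_le_iff _ _).1 hpd
    exact hasProjectiveDimensionLT_of_iso e _
  · have := h.ext_eq_zero i hi
    exact (extLinearEquivOfIso (k := k) e (ModuleCat.of A A) i).toEquiv.subsingleton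
  · obtain ⟨f⟩ := h.ext_equiv
    exact ⟨extLinearEquivOfIso (k := k) e (ModuleCat.of A A) d ≪≫ₗ f⟩

/-- The upper bound on the global dimension comes from deforming trivial modules. The lower bound
comes from `Ext^d(k, A) ≅ k`, which is nonzero. -/
theorem IsConnectedGraded.isASRegular {d : ℕ} (h : IsConnectedGraded 𝒜)
    (hR : IsRegularAug A h.aug d) : IsASRegular 𝒜 d := by
  have e := h.trivialIso
  have hext : Nonempty (Ext (trivialModule 𝒜) (ModuleCat.of A A) d ≃ₗ[k] k) := by
    obtain ⟨f⟩ := hR.ext_equiv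
    exact ⟨extLinearEquivOfIso (k := k) e.symm (ModuleCat.of A A) d ≪≫ₗ f⟩
  refine ⟨h, le_antisymm (iSup_le fun M => ?_) ?_, fun i hi => ?_, hext⟩
  · exact (projectiveDimension_le_iff _ _).2
      (hasProjectiveDimensionLT_of_trivialMod h.isConnectedProj hR.projectiveDimension M)
  · refine le_trans ?_ (le_iSup (fun M : ModuleCat.{u} A => projectiveDimension M)
      (trivialModule 𝒜))
    rw [projectiveDimension_ge_iff]
    intro hlt
    obtain ⟨f⟩ := hext
    have := HasProjectiveDimensionLT.subsingleton (trivialModule 𝒜) d d le_rfl (ModuleCat.of A A)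
    exact one_ne_zero (f.symm.injective (Subsingleton.elim (f.symm 1) (f.symm 0)))
  · have := hR.ext_eq_zero i hi
    exact (extLinearEquivOfIso (k := k) e.symm (ModuleCat.of A A) i).toEquiv.subsingleton

end Connected

/-! ### The grading of a tensor product. -/

section TensorGrading

variable {k : Type u} [Field k] {V W : Type u} [AddCommGroup V] [Module k V] [AddCommGroup W]
  [Module k W] {𝒱 : ℤ → Submodule k V} {𝒲 : ℤ → Submodule k W}

theorem tmul_mem_tensorGrading {i j n : ℤ} (hn : i + j = n) {v : V} {w : W} (hv : v ∈ 𝒱 i)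
    (hw : w ∈ 𝒲 j) : v ⊗ₜ w ∈ tensorGrading 𝒱 𝒲 n := by
  obtain rfl : j = n - i := by lia
  exact Submodule.mem_iSup_of_mem i ⟨(⟨v, hv⟩ : 𝒱 i) ⊗ₜ (⟨w, hw⟩ : 𝒲 (n - i)), rfl⟩

theorem tensorGrading_induction {n : ℤ} {p : V ⊗[k] W → Prop} (h0 : p 0)
    (hadd : ∀ x y, p x → p y → p (x + y))
    (ht : ∀ i j v w, i + j = n → v ∈ 𝒱 i → w ∈ 𝒲 j → p (v ⊗ₜ w)) (x : V ⊗[k] W)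
    (hx : x ∈ tensorGrading 𝒱 𝒲 n) : p x := by
  induction hx using Submodule.iSup_induction' with
  | mem i x hx =>
    obtain ⟨z, rfl⟩ := hx
    induction z with
    | zero => rwa [map_zero]
    | add x y hx hy => rw [map_add]; exact hadd _ _ hx hy
    | tmul v w => exact ht i (n - i) v w (by lia) v.2 w.2
  | zero => exact h0
  | add x y _ _ hx hy => exact hadd x y hx hy

/-- The maps `pᵢ ⊗ qₙ₋ᵢ` separate the degrees, and a homogeneous element of degree `n` is the finite
sum of its bidegree components. -/
theorem isInternal_tensorGrading (hV : DirectSum.IsInternal 𝒱) (hW : DirectSum.IsInternal 𝒲) :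
    DirectSum.IsInternal (tensorGrading 𝒱 𝒲) := by
  have key : ∀ (n a b i : ℤ) (v : V) (w : W), v ∈ 𝒱 a → w ∈ 𝒲 b →
      TensorProduct.map (gradedProj hV i) (gradedProj hW (n - i)) (v ⊗ₜ w) =
        if i = a then (if n = a + b then v ⊗ₜ w else 0) else 0 := by
    intro n a b i v w hv hw
    rw [TensorProduct.map_tmul, gradedProj_of_mem hV hv, gradedProj_of_mem hW hw]
    by_cases hi : i = a
    · subst hi
      by_cases hn : n = i + b
      · rw [if_pos rfl, if_pos (by lia), if_pos rfl, if_pos hn]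
      · rw [if_pos rfl, if_neg (by lia), if_pos rfl, if_neg hn, TensorProduct.tmul_zero]
    · rw [if_neg hi, if_neg hi, TensorProduct.zero_tmul]
  refine isInternal_of_separating
    (fun n i => TensorProduct.map (gradedProj hV i) (gradedProj hW (n - i))) ?_ ?_ ?_
  · intro m n hmn x hx i
    refine tensorGrading_induction (p := fun x => TensorProduct.map (gradedProj hV i)
      (gradedProj hW (n - i)) x = 0) (map_zero _) (fun x y hx hy => ?_)
      (fun a b v w hab hv hw => ?_) x hx
    · rw [map_add, hx, hy, add_zero]
    · rw [key n a b i v w hv hw, if_neg (by lia : n ≠ a + b), ite_self]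
  · intro n x hx h
    have hs : ∃ s : Finset ℤ, ∀ s', s ⊆ s' →
        ∑ i ∈ s', TensorProduct.map (gradedProj hV i) (gradedProj hW (n - i)) x = x := by
      refine tensorGrading_induction (p := fun x => ∃ s : Finset ℤ, ∀ s', s ⊆ s' →
        ∑ i ∈ s', TensorProduct.map (gradedProj hV i) (gradedProj hW (n - i)) x = x)
        ⟨∅, fun s' _ => by simp⟩ ?_ (fun a b v w hab hv hw => ?_) x hx
      · rintro x y ⟨s, hs⟩ ⟨t, ht⟩
        refine ⟨s ∪ t, fun s' hs' => ?_⟩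
        simp only [map_add, Finset.sum_add_distrib]
        rw [hs s' (Finset.union_subset_left hs'), ht s' (Finset.union_subset_right hs')]
      · refine ⟨{a}, fun s' hs' => ?_⟩
        rw [Finset.sum_congr rfl fun i _ => key n a b i v w hv hw, Finset.sum_ite_eq',
          if_pos (hs' (Finset.mem_singleton_self a)), if_pos hab.symm]
    obtain ⟨s, hs⟩ := hs
    rw [← hs s subset_rfl]
    exact Finset.sum_eq_zero fun i _ => h i
  · intro x
    induction x with
    | zero => exact zero_mem _
    | add x y hx hy => exact add_mem hx hy
    | tmul v w =>
      induction v using mem_of_internal hV with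
      | h0 => rw [TensorProduct.zero_tmul]; exact zero_mem _
      | hadd x y hx hy => rw [TensorProduct.add_tmul]; exact add_mem hx hy
      | hm a v hv =>
        induction w using mem_of_internal hW with
        | h0 => rw [TensorProduct.tmul_zero]; exact zero_mem _
        | hadd x y hx hy => rw [TensorProduct.tmul_add]; exact add_mem hx hy
        | hm b w hw => exact Submodule.mem_iSup_of_mem (a + b) (tmul_mem_tensorGrading rfl hv hw)

end TensorGrading

section WrapUp

variable {k : Type u} [Field k] {A B R : Type u} [Ring A] [Algebra k A] [Ring B] [Algebra k B]
  [Ring R] [Algebra k R] {𝒜 : ℤ → Submodule k A} {ℬ : ℤ → Submodule k B} {ℛ : ℤ → Submodule k R}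

theorem IsTwistedTensor.isASRegular {f : A →ₐ[k] R} {g : B →ₐ[k] R} {π : R →ₐ[k] B} {d₁ d₂ : ℕ}
    (hA : IsASRegular 𝒜 d₁) (h : IsTwistedTensor f g π hA.connected.aug) {ε : B →ₐ[k] k}
    (Y : FiniteFreeResolution B {b | ε b = 0} {b | ε b = 0} d₂) (hR : IsConnectedGraded ℛ)
    (hε : ∀ n : ℕ, n ≠ 0 → ∀ x ∈ ℛ n, ε (π x) = 0) : IsASRegular ℛ (d₁ + d₂) := by
  refine hR.isASRegular ?_
  rw [← hR.aug_unique (ε.comp π) hε]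
  exact h.isRegularAug (hA.isRegularAug.resolution hA.connected.isConnectedProj) Y

end WrapUp

/-! ### The smash product as a twisted tensor product. -/

section TakeuchiRegular

variable {k H A B : Type u} [Field k] [Ring H] [HopfAlgebra k H] [Ring A] [Algebra k A]
  [Ring B] [Algebra k B] [Module H A] [IsScalarTower k H A]

namespace TakeuchiSmash

section Bijective

variable {T : H →ₗ[k] H} (hT : ∀ h, HopfAlgebra.antipode k (T h) = h)
  (hT' : ∀ h, T (HopfAlgebra.antipode k h) = h)
include hT hT'

theorem inverse_antipode_mul (g h : H) : T (g * h) = T h * T g := by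
  conv_lhs => rw [← hT g, ← hT h, ← HopfAlgebra.antipode_mul_antidistrib]
  exact hT' _

omit hT in
theorem inverse_antipode_one : T 1 = 1 := by
  conv_lhs => rw [← HopfAlgebra.antipode_one (R := k) (A := H)]
  exact hT' 1

omit hT in
theorem inverse_antipode_algebraMap (c : k) : T (algebraMap k H c) = algebraMap k H c := by
  rw [Algebra.algebraMap_eq_smul_one, map_smul, inverse_antipode_one hT']

/-- `∑ S⁻¹(h₂) h₁ = ε(h)`. -/
theorem inverse_antipode_mul_comul (h : H) :
    LinearMap.mul' k H (TensorProduct.comm k H H (LinearMap.lTensor H T (Coalgebra.comul h))) =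
      algebraMap k H (Coalgebra.counit h) := by
  have key : ∀ t : H ⊗[k] H,
      LinearMap.mul' k H (TensorProduct.comm k H H (LinearMap.lTensor H T t)) =
        T (LinearMap.mul' k H (LinearMap.rTensor H (HopfAlgebra.antipode k) t)) := by
    intro t
    induction t with
    | zero => simp
    | add x y hx hy => simp only [map_add, hx, hy]
    | tmul x y => simp [inverse_antipode_mul hT hT', hT']
  rw [key, HopfAlgebra.mul_antipode_rTensor_comul_apply, inverse_antipode_algebraMap hT']

/-- `∑ h₂ S⁻¹(h₁) = ε(h)`. -/
theorem mul_inverse_antipode_comul (h : H) :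
    LinearMap.mul' k H (TensorProduct.comm k H H (LinearMap.rTensor H T (Coalgebra.comul h))) =
      algebraMap k H (Coalgebra.counit h) := by
  have key : ∀ t : H ⊗[k] H,
      LinearMap.mul' k H (TensorProduct.comm k H H (LinearMap.rTensor H T t)) =
        T (LinearMap.mul' k H (LinearMap.lTensor H (HopfAlgebra.antipode k) t)) := by
    intro t
    induction t with
    | zero => simp
    | add x y hx hy => simp only [map_add, hx, hy]
    | tmul x y => simp [inverse_antipode_mul hT hT', hT']
  rw [key, HopfAlgebra.mul_antipode_lTensor_comul_apply, inverse_antipode_algebraMap hT']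

end Bijective

variable [HopfComoduleAlgebra k H B]

variable (k H A B) in
/-- The twist `B ⊗ A → A ⊗ B`, `b ⊗ a ↦ ∑ (b₋₁ ⇀ a) ⊗ b₀`. -/
def twist : B ⊗[k] A →ₗ[k] A ⊗[k] B :=
  TensorProduct.lift (LinearMap.flip
    { toFun := fun a => TensorProduct.map (actOn k H a) LinearMap.id ∘ₗ
        (HopfComoduleAlgebra.coaction : B →ₐ[k] H ⊗[k] B).toLinearMap
      map_add' := fun a a' => by
        rw [← LinearMap.add_comp, ← TensorProduct.map_add_left]
        congr 2
        ext h
        simp [actOn_apply]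
      map_smul' := fun c a => by
        rw [RingHom.id_apply, ← LinearMap.smul_comp, ← TensorProduct.map_smul_left]
        congr 2
        ext h
        exact smul_comm h c a })

theorem twist_tmul (b : B) (a : A) : twist k H A B (b ⊗ₜ a) =
    TensorProduct.map (actOn k H a) LinearMap.id
      (HopfComoduleAlgebra.coaction b : H ⊗[k] B) := rfl

/-- The map `a ⊗ b ↦ ∑ b₀ ⊗ (T(b₋₁) ⇀ a)`. -/
def untwist (T : H →ₗ[k] H) : A ⊗[k] B →ₗ[k] B ⊗[k] A :=
  (TensorProduct.comm k A B).toLinearMap ∘ₗ TensorProduct.lift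
    { toFun := fun a => TensorProduct.map (actOn k H a ∘ₗ T) LinearMap.id ∘ₗ
        (HopfComoduleAlgebra.coaction : B →ₐ[k] H ⊗[k] B).toLinearMap
      map_add' := fun a a' => by
        rw [← LinearMap.add_comp, ← TensorProduct.map_add_left]
        congr 2
        ext h
        simp [actOn_apply]
      map_smul' := fun c a => by
        rw [RingHom.id_apply, ← LinearMap.smul_comp, ← TensorProduct.map_smul_left]
        congr 2
        ext h
        exact smul_comm (T h) c a }

theorem untwist_tmul (T : H →ₗ[k] H) (a : A) (b : B) : untwist T (a ⊗ₜ b) =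
    TensorProduct.comm k A B (TensorProduct.map (actOn k H a ∘ₗ T) LinearMap.id
      (HopfComoduleAlgebra.coaction b : H ⊗[k] B)) := rfl

theorem map_actOn_algebraMap (a : A) (b : B) (φ : H →ₗ[k] A)
    (hφ : φ = actOn k H a ∘ₗ Algebra.linearMap k H ∘ₗ Coalgebra.counit) :
    TensorProduct.map φ LinearMap.id (HopfComoduleAlgebra.coaction b : H ⊗[k] B) = a ⊗ₜ b := by
  have key : ∀ t : H ⊗[k] B, TensorProduct.map φ LinearMap.id t =
      a ⊗ₜ TensorProduct.lid k B (LinearMap.rTensor B (Coalgebra.counit : H →ₗ[k] k) t) := by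
    intro t
    subst hφ
    induction t with
    | zero => simp
    | add x y hx hy => simp only [map_add, hx, hy, TensorProduct.tmul_add]
    | tmul h c => simp [actOn_apply, TensorProduct.smul_tmul]
  rw [key, HopfComoduleAlgebra.counit_coaction]

omit [Module H A] [IsScalarTower k H A] in
/-- Coassociativity in the form used to compose the twist with its inverse. -/
theorem map_coassoc (φ : H ⊗[k] H →ₗ[k] A) (b : B) :
    TensorProduct.map φ LinearMap.id ((TensorProduct.assoc k H H B).symm
      (LinearMap.lTensor H (HopfComoduleAlgebra.coaction : B →ₐ[k] H ⊗[k] B).toLinearMap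
        (HopfComoduleAlgebra.coaction b : H ⊗[k] B))) =
    TensorProduct.map (φ ∘ₗ Coalgebra.comul) LinearMap.id
      (HopfComoduleAlgebra.coaction b : H ⊗[k] B) := by
  rw [← HopfComoduleAlgebra.coassoc, LinearEquiv.symm_apply_apply]
  generalize (HopfComoduleAlgebra.coaction b : H ⊗[k] B) = t
  induction t with
  | zero => simp
  | add x y hx hy => simp only [map_add, hx, hy]
  | tmul h c => simp

/-- The inverse is `a ⊗ b ↦ ∑ b₀ ⊗ (S⁻¹(b₋₁) ⇀ a)`. By coassociativity the two composites involve `∑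
S⁻¹(h₂) h₁` and `∑ h₂ S⁻¹(h₁)`, both equal to `ε(h)`, and the counit axiom of the coaction finishes.
-/
theorem twist_bijective (hS : Function.Bijective (HopfAlgebra.antipode k : H →ₗ[k] H)) :
    Function.Bijective (twist k H A B) := by
  let e := LinearEquiv.ofBijective _ hS
  let T : H →ₗ[k] H := e.symm.toLinearMap
  have hT : ∀ h, HopfAlgebra.antipode k (T h) = h := e.apply_symm_apply
  have hT' : ∀ h, T (HopfAlgebra.antipode k h) = h := e.symm_apply_apply
  have h1 : ∀ z : B ⊗[k] A, untwist T (twist k H A B z) = z := by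
    intro z
    induction z with
    | zero => simp
    | add x y hx hy => rw [map_add, map_add, hx, hy]
    | tmul b a =>
      let φ : H ⊗[k] H →ₗ[k] A := actOn k H a ∘ₗ LinearMap.mul' k H ∘ₗ
        (TensorProduct.comm k H H).toLinearMap ∘ₗ LinearMap.lTensor H T
      have key : ∀ t : H ⊗[k] B, untwist T (TensorProduct.map (actOn k H a) LinearMap.id t) =
          TensorProduct.comm k A B (TensorProduct.map φ LinearMap.id
            ((TensorProduct.assoc k H H B).symm (LinearMap.lTensor H
              (HopfComoduleAlgebra.coaction : B →ₐ[k] H ⊗[k] B).toLinearMap t))) := by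
        intro t
        induction t with
        | zero => simp
        | add x y hx hy => simp only [map_add, hx, hy]
        | tmul h c =>
          rw [TensorProduct.map_tmul, LinearMap.id_apply, untwist_tmul, LinearMap.lTensor_tmul,
            AlgHom.toLinearMap_apply]
          generalize (HopfComoduleAlgebra.coaction c : H ⊗[k] B) = s
          induction s with
          | zero => simp
          | add x y hx hy => simp only [map_add, TensorProduct.tmul_add, hx, hy]
          | tmul g d => simp [φ, actOn_apply, mul_smul]
      rw [twist_tmul, key, map_coassoc, map_actOn_algebraMap a b]
      · rfl
      · refine LinearMap.ext fun h => ?_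
        exact congrArg (actOn k H a) (inverse_antipode_mul_comul hT hT' h)
  have h2 : ∀ z : A ⊗[k] B, twist k H A B (untwist T z) = z := by
    intro z
    induction z with
    | zero => simp
    | add x y hx hy => rw [map_add, map_add, hx, hy]
    | tmul a b =>
      let φ : H ⊗[k] H →ₗ[k] A := actOn k H a ∘ₗ LinearMap.mul' k H ∘ₗ
        (TensorProduct.comm k H H).toLinearMap ∘ₗ LinearMap.rTensor H T
      have key : ∀ t : H ⊗[k] B, twist k H A B (TensorProduct.comm k A B
            (TensorProduct.map (actOn k H a ∘ₗ T) LinearMap.id t)) =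
          TensorProduct.map φ LinearMap.id
            ((TensorProduct.assoc k H H B).symm (LinearMap.lTensor H
              (HopfComoduleAlgebra.coaction : B →ₐ[k] H ⊗[k] B).toLinearMap t)) := by
        intro t
        induction t with
        | zero => simp
        | add x y hx hy => simp only [map_add, hx, hy]
        | tmul h c =>
          rw [TensorProduct.map_tmul, LinearMap.id_apply, TensorProduct.comm_tmul, twist_tmul,
            LinearMap.lTensor_tmul, AlgHom.toLinearMap_apply]
          generalize (HopfComoduleAlgebra.coaction c : H ⊗[k] B) = s
          induction s with
          | zero => simp
          | add x y hx hy => simp only [map_add, TensorProduct.tmul_add, hx, hy]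
          | tmul g d => simp [φ, actOn_apply, mul_smul]
      rw [untwist_tmul, key, map_coassoc, map_actOn_algebraMap a b]
      refine LinearMap.ext fun h => ?_
      exact congrArg (actOn k H a) (mul_inverse_antipode_comul hT hT' h)
  exact ⟨Function.LeftInverse.injective h1, Function.RightInverse.surjective h2⟩

variable [IsHopfModuleAlgebra k H A]

theorem opB_tmul_one (b b' : B) : opB k H A B b (1 ⊗ₜ b') = 1 ⊗ₜ (b * b') := by
  have key : ∀ t : H ⊗[k] B, hopfOp k H A B t ((1 : A) ⊗ₜ b') =
      1 ⊗ₜ (TensorProduct.lid k B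
        (LinearMap.rTensor B (Coalgebra.counit : H →ₗ[k] k) t) * b') := by
    intro t
    induction t with
    | zero => simp
    | add s t hs ht =>
      simp only [map_add, LinearMap.add_apply, TensorProduct.tmul_add, hs, ht, add_mul]
    | tmul h c =>
      simp [IsHopfModuleAlgebra.smul_one (k := k), Algebra.algebraMap_eq_smul_one,
        TensorProduct.smul_tmul]
  rw [opB_apply_eq, key, HopfComoduleAlgebra.counit_coaction]

theorem algebraMap_eq (c : k) :
    algebraMap k (TakeuchiSmash k H A B) c = (c • ((1 : A) ⊗ₜ[k] (1 : B)) : A ⊗[k] B) :=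
  Algebra.algebraMap_eq_smul_one c

variable (k H A B) in
/-- The inclusion `a ↦ a # 1`. -/
def inclA : A →ₐ[k] TakeuchiSmash k H A B where
  toFun a := (a ⊗ₜ[k] (1 : B) : A ⊗[k] B)
  map_one' := rfl
  map_mul' a a' := by
    change (a * a') ⊗ₜ[k] (1 : B) = op k H A B (a ⊗ₜ 1) (a' ⊗ₜ 1)
    rw [op_tmul, map_one, mul_one, opA_tmul]
  map_zero' := TensorProduct.zero_tmul _ _
  map_add' a a' := TensorProduct.add_tmul _ _ _
  commutes' c := by
    rw [algebraMap_eq, Algebra.algebraMap_eq_smul_one]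
    rfl

variable (k H A B) in
/-- The inclusion `b ↦ 1 # b`. -/
def inclB : B →ₐ[k] TakeuchiSmash k H A B where
  toFun b := ((1 : A) ⊗ₜ[k] b : A ⊗[k] B)
  map_one' := rfl
  map_mul' b b' := by
    change (1 : A) ⊗ₜ[k] (b * b') = op k H A B (1 ⊗ₜ b) (1 ⊗ₜ b')
    rw [op_tmul, Module.End.mul_apply, opB_tmul_one, opA_tmul, one_mul]
  map_zero' := TensorProduct.tmul_zero _ _
  map_add' b b' := TensorProduct.tmul_add _ _ _
  commutes' c := by
    rw [algebraMap_eq, Algebra.algebraMap_eq_smul_one]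
    exact TensorProduct.tmul_smul _ _ _

theorem mulMap_inclA_inclB_bijective :
    Function.Bijective (mulMap (inclA k H A B) (inclB k H A B)) := by
  have : ∀ z, mulMap (inclA k H A B) (inclB k H A B) z = (show TakeuchiSmash k H A B from z) := by
    intro z
    induction z with
    | zero => exact map_zero _
    | add x y hx hy => rw [map_add, hx, hy]; rfl
    | tmul a b =>
      change op k H A B (a ⊗ₜ 1) (1 ⊗ₜ b) = a ⊗ₜ b
      rw [op_tmul, map_one, mul_one, opA_tmul, mul_one]
  rw [show ⇑(mulMap (inclA k H A B) (inclB k H A B)) = id from funext this]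
  exact Function.bijective_id

theorem mulMap_inclB_inclA_bijective
    (hS : Function.Bijective (HopfAlgebra.antipode k : H →ₗ[k] H)) :
    Function.Bijective (mulMap (inclB k H A B) (inclA k H A B)) := by
  have : ∀ z, mulMap (inclB k H A B) (inclA k H A B) z =
      (show TakeuchiSmash k H A B from twist k H A B z) := by
    intro z
    induction z with
    | zero => exact (map_zero _).trans (map_zero _).symm
    | add x y hx hy => rw [map_add, hx, hy, map_add]; rfl
    | tmul b a =>
      change op k H A B (1 ⊗ₜ b) (a ⊗ₜ 1) = twist k H A B (b ⊗ₜ a)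
      rw [op_tmul, map_one, one_mul, opB_apply_eq, twist_tmul]
      generalize (HopfComoduleAlgebra.coaction b : H ⊗[k] B) = t
      induction t with
      | zero => simp
      | add x y hx hy => simp only [map_add, LinearMap.add_apply, hx, hy]
      | tmul h c => simp [actOn_apply]
  rw [show ⇑(mulMap (inclB k H A B) (inclA k H A B)) = twist k H A B from funext this]
  exact twist_bijective hS

end TakeuchiSmash

end TakeuchiRegular

/-! ### Grading, projections and regularity of the smash product. -/

section TakeuchiRegular

variable {k H A B : Type u} [Field k] [Ring H] [HopfAlgebra k H] [Ring A] [Algebra k A]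
  [Ring B] [Algebra k B] [Module H A] [IsScalarTower k H A] [HopfComoduleAlgebra k H B]
  [IsHopfModuleAlgebra k H A] {ℋ : ℤ → Submodule k H} {𝒜 : ℤ → Submodule k A}
  {ℬ : ℤ → Submodule k B}

namespace TakeuchiSmash

theorem mul_mem_grading (h𝒜 : IsModuleGradedAlgebra ℋ 𝒜) (hℬ : IsComoduleGradedAlgebra ℋ ℬ)
    {m n : ℤ} {x y : TakeuchiSmash k H A B} (hx : x ∈ grading (H := H) 𝒜 ℬ m)
    (hy : y ∈ grading (H := H) 𝒜 ℬ n) : x * y ∈ grading (H := H) 𝒜 ℬ (m + n) := by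
  change op k H A B x y ∈ tensorGrading 𝒜 ℬ (m + n)
  refine tensorGrading_induction (p := fun x => op k H A B x y ∈ tensorGrading 𝒜 ℬ (m + n))
    ?_ (fun x x' hx hx' => ?_) (fun i j a b hij ha hb => ?_) x hx
  · rw [map_zero]
    exact zero_mem _
  · rw [map_add]
    exact add_mem hx hx'
  refine tensorGrading_induction (p := fun y => op k H A B (a ⊗ₜ b) y ∈ tensorGrading 𝒜 ℬ (m + n))
    ?_ (fun y y' hy hy' => ?_) (fun i' j' a' b' hij' ha' hb' => ?_) y hy
  · rw [map_zero]
    exact zero_mem _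
  · rw [map_add]
    exact add_mem hy hy'
  rw [op_tmul, Module.End.mul_apply, opB_apply_eq]
  refine tensorGrading_induction (p := fun t => opA k A B a (hopfOp k H A B t (a' ⊗ₜ b')) ∈
    tensorGrading 𝒜 ℬ (m + n)) ?_ (fun s t hs ht => ?_) (fun p q h c hpq hh hc => ?_) _
    (hℬ.coaction_mem j b hb)
  · rw [map_zero, LinearMap.zero_apply, map_zero]
    exact zero_mem _
  · rw [map_add, LinearMap.add_apply, map_add]
    exact add_mem hs ht
  rw [hopfOp_tmul, opA_tmul]
  exact tmul_mem_tensorGrading (i := i + (p + i')) (j := q + j') (by lia)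
    (h𝒜.isGraded.gradedMonoid.mul_mem ha (h𝒜.smul_mem p i' h hh a' ha'))
    (hℬ.isGraded.gradedMonoid.mul_mem hc hb')

theorem isConnectedGraded_grading (hA : IsConnectedGraded 𝒜) (hB : IsConnectedGraded ℬ)
    (h𝒜 : IsModuleGradedAlgebra ℋ 𝒜) (hℬ : IsComoduleGradedAlgebra ℋ ℬ) :
    IsConnectedGraded (grading (H := H) 𝒜 ℬ) where
  isGraded :=
    { gradedMonoid :=
        { one_mem := tmul_mem_tensorGrading (add_zero 0) hA.isGraded.gradedMonoid.one_mem
            hB.isGraded.gradedMonoid.one_mem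
          mul_mem := fun _ _ _ _ hx hy => mul_mem_grading h𝒜 hℬ hx hy }
      isInternal := isInternal_tensorGrading hA.isGraded.isInternal hB.isGraded.isInternal }
  neg_eq_bot n hn := by
    refine eq_bot_iff.2 fun x hx => (Submodule.mem_bot k).2 ?_
    refine tensorGrading_induction (p := fun x => x = 0) rfl
      (fun x y hx hy => by rw [hx, hy, add_zero]) (fun i j a b hij ha hb => ?_) x hx
    rcases lt_or_ge i 0 with hi | hi
    · rw [hA.neg_eq_bot i hi, Submodule.mem_bot] at ha
      rw [ha, TensorProduct.zero_tmul]
    · rw [hB.neg_eq_bot j (by lia), Submodule.mem_bot] at hb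
      rw [hb, TensorProduct.tmul_zero]
  nontrivial := by
    have := hA.nontrivial
    have := hB.nontrivial
    exact inferInstanceAs (Nontrivial (A ⊗[k] B))
  zero_eq := by
    refine le_antisymm (fun x hx => ?_) ?_
    · refine tensorGrading_induction (p := fun x => x ∈ LinearMap.range
        (Algebra.linearMap k (TakeuchiSmash k H A B))) (zero_mem _) (fun x y => add_mem)
        (fun i j a b hij ha hb => ?_) x hx
      rcases lt_trichotomy i 0 with hi | hi | hi
      · rw [hA.neg_eq_bot i hi, Submodule.mem_bot] at ha
        rw [ha, TensorProduct.zero_tmul]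
        exact zero_mem _
      · obtain rfl : j = 0 := by lia
        rw [hi, hA.zero_eq] at ha
        rw [hB.zero_eq] at hb
        obtain ⟨c, rfl⟩ := ha
        obtain ⟨c', rfl⟩ := hb
        refine ⟨c * c', ?_⟩
        rw [Algebra.linearMap_apply, algebraMap_eq, Algebra.linearMap_apply, Algebra.linearMap_apply,
          Algebra.algebraMap_eq_smul_one, Algebra.algebraMap_eq_smul_one,
          TensorProduct.smul_tmul_smul]
      · rw [hB.neg_eq_bot j (by lia), Submodule.mem_bot] at hb
        rw [hb, TensorProduct.tmul_zero]
        exact zero_mem _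
    · rintro _ ⟨c, rfl⟩
      rw [Algebra.linearMap_apply, algebraMap_eq]
      exact Submodule.smul_mem _ c (tmul_mem_tensorGrading (add_zero 0)
        hA.isGraded.gradedMonoid.one_mem hB.isGraded.gradedMonoid.one_mem)

/-- The projection `A # B → B`, `a # b ↦ ε(a) b`, for an augmentation of `A` that is `H`-linear. -/
def projB (ε : A →ₐ[k] k) (hε : ∀ (h : H) (a : A), ε (h • a) = Coalgebra.counit h * ε a) :
    TakeuchiSmash k H A B →ₐ[k] B :=
  AlgHom.ofLinearMap (TensorProduct.lid k B ∘ₗ LinearMap.rTensor B ε.toLinearMap :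
      A ⊗[k] B →ₗ[k] B)
    (by
      change TensorProduct.lid k B (LinearMap.rTensor B ε.toLinearMap (1 ⊗ₜ 1)) = 1
      simp)
    fun x' y' => by
      obtain ⟨x, rfl⟩ : ∃ x : A ⊗[k] B, x = x' := ⟨x', rfl⟩
      obtain ⟨y, rfl⟩ : ∃ y : A ⊗[k] B, y = y' := ⟨y', rfl⟩
      change TensorProduct.lid k B (LinearMap.rTensor B ε.toLinearMap (op k H A B x y)) =
        TensorProduct.lid k B (LinearMap.rTensor B ε.toLinearMap x) *
          TensorProduct.lid k B (LinearMap.rTensor B ε.toLinearMap y)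
      induction x with
      | zero => simp
      | add x x' hx hx' => simp only [map_add, LinearMap.add_apply, add_mul, hx, hx']
      | tmul a b =>
        induction y with
        | zero => simp
        | add y y' hy hy' => simp only [map_add, mul_add, hy, hy']
        | tmul a' b' =>
          have key : ∀ t : H ⊗[k] B, TensorProduct.lid k B (LinearMap.rTensor B ε.toLinearMap
              (opA k A B a (hopfOp k H A B t (a' ⊗ₜ b')))) =
              ε a • TensorProduct.lid k B
                (LinearMap.rTensor B (Coalgebra.counit : H →ₗ[k] k) t) * (ε a' • b') := by
            intro t
            induction t with
            | zero => simp
            | add s t hs ht =>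
              simp only [map_add, LinearMap.add_apply, hs, ht, add_mul, smul_add]
            | tmul h c =>
              simp only [hopfOp_tmul, opA_tmul, LinearMap.rTensor_tmul, TensorProduct.lid_tmul,
                AlgHom.toLinearMap_apply, map_mul, hε, smul_mul_assoc, mul_smul_comm, smul_smul]
              congr 1
              ring
          rw [op_tmul, Module.End.mul_apply, opB_apply_eq, key,
            HopfComoduleAlgebra.counit_coaction]
          simp

/-- The projection `A # B → A`, `a # b ↦ ε(b) a`, for an augmentation of `B` that is
`H`-colinear. -/
def projA (ε : B →ₐ[k] k) (hε : ∀ b : B, TensorProduct.rid k H (LinearMap.lTensor H ε.toLinearMap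
      (HopfComoduleAlgebra.coaction b : H ⊗[k] B)) = algebraMap k H (ε b)) :
    TakeuchiSmash k H A B →ₐ[k] A :=
  AlgHom.ofLinearMap (TensorProduct.rid k A ∘ₗ LinearMap.lTensor A ε.toLinearMap :
      A ⊗[k] B →ₗ[k] A)
    (by
      change TensorProduct.rid k A (LinearMap.lTensor A ε.toLinearMap (1 ⊗ₜ 1)) = 1
      simp)
    fun x' y' => by
      obtain ⟨x, rfl⟩ : ∃ x : A ⊗[k] B, x = x' := ⟨x', rfl⟩
      obtain ⟨y, rfl⟩ : ∃ y : A ⊗[k] B, y = y' := ⟨y', rfl⟩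
      change TensorProduct.rid k A (LinearMap.lTensor A ε.toLinearMap (op k H A B x y)) =
        TensorProduct.rid k A (LinearMap.lTensor A ε.toLinearMap x) *
          TensorProduct.rid k A (LinearMap.lTensor A ε.toLinearMap y)
      induction x with
      | zero => simp
      | add x x' hx hx' => simp only [map_add, LinearMap.add_apply, add_mul, hx, hx']
      | tmul a b =>
        induction y with
        | zero => simp
        | add y y' hy hy' => simp only [map_add, mul_add, hy, hy']
        | tmul a' b' =>
          have key : ∀ t : H ⊗[k] B, TensorProduct.rid k A (LinearMap.lTensor A ε.toLinearMap
              (opA k A B a (hopfOp k H A B t (a' ⊗ₜ b')))) =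
              ε b' • (a * (TensorProduct.rid k H (LinearMap.lTensor H ε.toLinearMap t) • a')) := by
            intro t
            induction t with
            | zero => simp
            | add s t hs ht =>
              simp only [map_add, LinearMap.add_apply, hs, ht, mul_add, add_smul, smul_add]
            | tmul h c =>
              simp only [hopfOp_tmul, opA_tmul, LinearMap.lTensor_tmul, TensorProduct.rid_tmul,
                AlgHom.toLinearMap_apply, map_mul, smul_assoc, mul_smul_comm, mul_smul]
              rw [smul_comm]
          rw [op_tmul, Module.End.mul_apply, opB_apply_eq, key, hε, algebraMap_smul]
          simp

theorem projB_mk (ε : A →ₐ[k] k)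
    (hε : ∀ (h : H) (a : A), ε (h • a) = Coalgebra.counit h * ε a) (a : A) (b : B) :
    projB ε hε (a ⊗ₜ[k] b : A ⊗[k] B) = ε a • b := rfl

theorem projA_mk (ε : B →ₐ[k] k) (hε : ∀ b : B, TensorProduct.rid k H (LinearMap.lTensor H
      ε.toLinearMap (HopfComoduleAlgebra.coaction b : H ⊗[k] B)) = algebraMap k H (ε b))
    (a : A) (b : B) : projA ε hε (a ⊗ₜ[k] b : A ⊗[k] B) = ε b • a := rfl

omit [HopfComoduleAlgebra k H B] in
-- An element is a scalar plus an element of `A_{≥ 1}`. The second part stays in `A_{≥ 1}` by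
-- stability, and `h` acts on scalars by the counit.
theorem aug_smul (hA : IsConnectedGraded 𝒜) (h1 : ∀ h : H, ∀ a ∈ geOne 𝒜, h • a ∈ geOne 𝒜)
    (h : H) (a : A) : hA.aug (h • a) = Coalgebra.counit h * hA.aug a := by
  have h2 : a - algebraMap k A (hA.aug a) ∈ geOne 𝒜 := by
    rw [hA.mem_geOne_iff, map_sub, AlgHom.commutes]
    exact sub_self _
  have h3 := (hA.mem_geOne_iff _).1 (h1 h _ h2)
  rw [smul_sub, map_sub, Algebra.algebraMap_eq_smul_one, smul_comm,
    IsHopfModuleAlgebra.smul_one (k := k), map_smul hA.aug (hA.aug a), AlgHom.commutes,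
    sub_eq_zero] at h3
  rw [h3, smul_eq_mul, mul_comm]
  rfl

omit [Module H A] [IsScalarTower k H A] [IsHopfModuleAlgebra k H A] in
theorem rid_lTensor_aug_coaction (hB : IsConnectedGraded ℬ)
    (h1 : ∀ b ∈ geOne ℬ, (HopfComoduleAlgebra.coaction b : TensorProduct k H B) ∈
      LinearMap.range (LinearMap.lTensor H (geOne ℬ).subtype)) (b : B) :
    TensorProduct.rid k H (LinearMap.lTensor H hB.aug.toLinearMap
      (HopfComoduleAlgebra.coaction b : H ⊗[k] B)) = algebraMap k H (hB.aug b) := by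
  have h2 : b - algebraMap k B (hB.aug b) ∈ geOne ℬ := by
    rw [hB.mem_geOne_iff, map_sub, AlgHom.commutes]
    exact sub_self _
  obtain ⟨t, ht⟩ := h1 _ h2
  have h3 : LinearMap.lTensor H hB.aug.toLinearMap (LinearMap.lTensor H (geOne ℬ).subtype t) =
      0 := by
    rw [← LinearMap.comp_apply, ← LinearMap.lTensor_comp,
      show hB.aug.toLinearMap ∘ₗ (geOne ℬ).subtype = 0 from
        LinearMap.ext fun x => (hB.mem_geOne_iff _).1 x.2, LinearMap.lTensor_zero,
      LinearMap.zero_apply]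
  rw [ht, map_sub, AlgHom.commutes, map_sub, sub_eq_zero] at h3
  rw [h3, Algebra.TensorProduct.algebraMap_apply, LinearMap.lTensor_tmul, TensorProduct.rid_tmul]
  simp

/-- The two alternatives give a projection of `A # B` onto `B` or onto `A`. In the second case `B`
is the factor whose resolution is extended to `A # B`, and the resolution over `A` is the one
restricted. -/
theorem isASRegular {d₁ d₂ : ℕ} (hS : Function.Bijective (HopfAlgebra.antipode k : H →ₗ[k] H))
    (hA : IsASRegular 𝒜 d₁) (hB : IsASRegular ℬ d₂) (h𝒜 : IsModuleGradedAlgebra ℋ 𝒜)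
    (hℬ : IsComoduleGradedAlgebra ℋ ℬ)
    (hstable : (∀ h : H, ∀ a ∈ geOne 𝒜, h • a ∈ geOne 𝒜) ∨
        (∀ b ∈ geOne ℬ, (HopfComoduleAlgebra.coaction b : TensorProduct k H B) ∈
          LinearMap.range (LinearMap.lTensor H (geOne ℬ).subtype))) :
    IsASRegular (grading (H := H) 𝒜 ℬ) (d₁ + d₂) := by
  have hR := isConnectedGraded_grading hA.connected hB.connected h𝒜 hℬ
  -- In nonzero total degree one of the factors has nonzero degree, so the composite augmentation
  -- vanishes there.
  have aug_mul : ∀ i j n : ℤ, i + j = n → n ≠ 0 → ∀ a ∈ 𝒜 i, ∀ b ∈ ℬ j,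
      hA.connected.aug a * hB.connected.aug b = 0 := by
    intro i j n hij hn a ha b hb
    by_cases hi : i = 0
    · rw [hB.connected.aug_of_mem (by lia) hb, mul_zero]
    · rw [hA.connected.aug_of_mem hi ha, zero_mul]
  rcases hstable with h1 | h1
  · have hε := aug_smul hA.connected h1
    have h : IsTwistedTensor (inclA k H A B) (inclB k H A B) (projB hA.connected.aug hε)
        hA.connected.aug :=
      { proj_right := fun b => by
          refine (projB_mk _ hε 1 b).trans ?_
          rw [map_one, one_smul]
        proj_left := fun a => by
          refine (projB_mk _ hε a 1).trans ?_
          rw [Algebra.algebraMap_eq_smul_one]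
        bijective_left := mulMap_inclA_inclB_bijective
        bijective_right := mulMap_inclB_inclA_bijective hS }
    refine h.isASRegular hA (hB.isRegularAug.resolution hB.connected.isConnectedProj) hR
      fun n hn x hx => ?_
    refine tensorGrading_induction
      (p := fun x => hB.connected.aug (projB hA.connected.aug hε x) = 0) ?_
      (fun x y hx hy => ?_) (fun i j a b hij ha hb => ?_) x hx
    · exact (congrArg _ (map_zero _)).trans (map_zero _)
    · exact ((congrArg _ (map_add (projB hA.connected.aug hε) _ _)).trans (map_add _ _ _)).trans
        (by rw [hx, hy, add_zero])
    · rw [projB_mk, map_smul, smul_eq_mul]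
      exact aug_mul i j n hij (by exact_mod_cast hn) a ha b hb
  · have hε := rid_lTensor_aug_coaction hB.connected h1
    have h : IsTwistedTensor (inclB k H A B) (inclA k H A B) (projA hB.connected.aug hε)
        hB.connected.aug :=
      { proj_right := fun a => by
          refine (projA_mk _ hε a 1).trans ?_
          rw [map_one, one_smul]
        proj_left := fun b => by
          refine (projA_mk _ hε 1 b).trans ?_
          rw [Algebra.algebraMap_eq_smul_one]
        bijective_left := mulMap_inclB_inclA_bijective hS
        bijective_right := mulMap_inclA_inclB_bijective }
    rw [add_comm d₁ d₂]
    refine h.isASRegular hB (hA.isRegularAug.resolution hA.connected.isConnectedProj) hR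
      fun n hn x hx => ?_
    refine tensorGrading_induction
      (p := fun x => hA.connected.aug (projA hB.connected.aug hε x) = 0) ?_
      (fun x y hx hy => ?_) (fun i j a b hij ha hb => ?_) x hx
    · exact (congrArg _ (map_zero _)).trans (map_zero _)
    · exact ((congrArg _ (map_add (projA hB.connected.aug hε) _ _)).trans (map_add _ _ _)).trans
        (by rw [hx, hy, add_zero])
    · rw [projA_mk, map_smul, smul_eq_mul, mul_comm]
      exact aug_mul i j n hij (by exact_mod_cast hn) a ha b hb

end TakeuchiSmash

end TakeuchiRegular

/-! ### Ore extensions as twisted tensor products with the polynomial ring. -/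

section OreRegular

variable {k : Type u} [Field k] {A : Type u} [Ring A] [Algebra k A] {σ : A ≃ₐ[k] A}
  (δ : SkewDerivation σ)

/-- The ranks of the resolution of the trivial module over `k[x]`. -/
def polynomialResolutionIndex : ℕ → Type
  | 1 => Unit
  | 2 => Unit
  | _ => Empty

/-- The resolution `0 → k[x] → k[x]` of the trivial module over the polynomial ring. -/
def polynomialResolution (k : Type u) [Field k] :
    FiniteFreeResolution (Polynomial k) {b | Polynomial.aeval (0 : k) b = 0}
      {b | Polynomial.aeval (0 : k) b = 0} 1 :=
  have hX : ∀ x : Polynomial k, Polynomial.aeval (0 : k) x = 0 ↔ ∃ u, x = u * Polynomial.X := by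
    intro x
    rw [← Polynomial.coeff_zero_eq_aeval_zero, ← Polynomial.X_dvd_iff, dvd_iff_exists_eq_mul_left]
  { ι := polynomialResolutionIndex
    fintype := fun
      | 0 => inferInstanceAs (Fintype Empty)
      | 1 => inferInstanceAs (Fintype Unit)
      | 2 => inferInstanceAs (Fintype Unit)
      | _ + 3 => inferInstanceAs (Fintype Empty)
    -- Only `D 1` has any entries, and it is the one-by-one matrix with entry `X`.
    D := fun _ _ _ => Polynomial.X
    isEmpty_zero := inferInstanceAs (IsEmpty Empty)
    unique_one := inferInstanceAs (Unique Unit)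
    unique_top := inferInstanceAs (Unique Unit)
    isEmpty_of_lt := fun i hi => by
      obtain ⟨j, rfl⟩ : ∃ j, i = j + 3 := ⟨i - 3, by lia⟩
      exact inferInstanceAs (IsEmpty Empty)
    exact_left := fun i v => by
      have : ∀ j, IsEmpty (polynomialResolutionIndex (j + 3)) :=
        fun j => inferInstanceAs (IsEmpty Empty)
      cases i with
      | zero =>
        constructor
        · intro h
          refine ⟨fun j => isEmptyElim j, funext fun j => ?_⟩
          have h1 : ∑ l : Unit, v l * Polynomial.X = 0 := congrFun h ()
          rw [Fintype.sum_unique] at h1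
          exact ((mul_eq_zero_iff_right Polynomial.X_ne_zero).1 h1).trans
            (Finset.sum_empty (f := fun l : Empty => (Empty.elim l : Polynomial k))).symm
        · rintro ⟨u, rfl⟩
          refine funext fun j => ?_
          change ∑ l : Unit, (∑ m : Empty, u m * Polynomial.X) * Polynomial.X = 0
          simp
      | succ i =>
        refine ⟨fun _ => ⟨0, funext fun j => ((this i).false j).elim⟩, fun _ => ?_⟩
        refine funext fun j => ?_
        change ∑ l : Empty, v l * Polynomial.X = 0
        exact Finset.sum_empty
    left := fun x => by
      rw [Set.mem_ofPred_eq, hX]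
      constructor
      · rintro ⟨u, rfl⟩
        refine ⟨fun _ => u, funext fun _ => ?_⟩
        change _ = ∑ l : Unit, u * Polynomial.X
        rw [Fintype.sum_unique]
      · rintro ⟨u, hu⟩
        refine ⟨u (), (congrFun hu ()).trans ?_⟩
        change ∑ l : Unit, u l * Polynomial.X = _
        rw [Fintype.sum_unique]
    exact_right := fun i hi w => by
      obtain rfl : i = 0 := by lia
      constructor
      · intro h
        refine ⟨fun j => Empty.elim j, funext fun j => ?_⟩
        have h1 : ∑ l : Unit, Polynomial.X * w l = 0 := congrFun h ()
        rw [Fintype.sum_unique] at h1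
        exact ((mul_eq_zero_iff_left Polynomial.X_ne_zero).1 h1).trans
          (Finset.sum_empty (f := fun l : Empty => (Empty.elim l : Polynomial k))).symm
      · rintro ⟨u, rfl⟩
        refine funext fun j => ?_
        change ∑ l : Unit, Polynomial.X * (∑ m : Empty, Polynomial.X * u m) = 0
        simp
    right := fun x => by
      rw [Set.mem_ofPred_eq, hX]
      constructor
      · rintro ⟨u, rfl⟩
        refine ⟨fun _ => u, funext fun _ => ?_⟩
        change _ = ∑ l : Unit, Polynomial.X * u
        rw [Fintype.sum_unique, mul_comm]
      · rintro ⟨u, hu⟩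
        refine ⟨u (), (congrFun hu ()).trans ?_⟩
        change ∑ l : Unit, Polynomial.X * u l = _
        rw [Fintype.sum_unique, mul_comm] }

namespace OreExtension

theorem opX_apply_zero (f : ℕ →₀ A) : opX δ f 0 = δ.toLinearMap (f 0) := by
  induction f using Finsupp.induction_linear with
  | zero => simp
  | add f g hf hg => rw [map_add, Finsupp.add_apply, hf, hg, Finsupp.add_apply, map_add]
  | single n b => cases n <;> simp [opX_single]

theorem opX_apply_succ (f : ℕ →₀ A) (n : ℕ) :
    opX δ f (n + 1) = σ (f n) + δ.toLinearMap (f (n + 1)) := by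
  induction f using Finsupp.induction_linear with
  | zero => simp
  | add f g hf hg =>
    simp only [map_add, Finsupp.add_apply, hf, hg]
    abel
  | single m b =>
    rw [opX_single, Finsupp.add_apply]
    congr 1
    · by_cases h : m = n <;> simp [h]
    · by_cases h : m = n + 1 <;> simp [h]

theorem op_apply_eq_sum (f g : ℕ →₀ A) :
    op δ f g = ∑ i ∈ f.support, opC k A (f i) ((opX δ ^ i) g) := by
  conv_lhs => rw [← f.sum_single, Finsupp.sum, map_sum, LinearMap.sum_apply]
  exact Finset.sum_congr rfl fun i _ => by rw [op_single, Module.End.mul_apply]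

section Grading

variable {δ} {𝒜 : ℤ → Submodule k A} (hA : IsConnectedGraded 𝒜)

theorem single_mem_grading {n m : ℤ} {i : ℕ} {a : A} (ha : a ∈ 𝒜 m) (h : m + i = n) :
    (show OreExtension δ from Finsupp.single i a) ∈ grading δ 𝒜 n := by
  intro j
  change (Finsupp.single i a : ℕ →₀ A) j ∈ _
  rw [Finsupp.single_apply]
  split_ifs with hij
  · subst hij
    rwa [← h, add_sub_cancel_right]
  · exact zero_mem _

variable (hσ : ∀ n : ℤ, ∀ a ∈ 𝒜 n, σ a ∈ 𝒜 n)
  (hδ : ∀ n : ℤ, ∀ a ∈ 𝒜 n, δ.toLinearMap a ∈ 𝒜 (n + 1))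
include hσ hδ

theorem opX_mem {n : ℤ} {f : ℕ →₀ A} (hf : ∀ i : ℕ, f i ∈ 𝒜 (n - i)) (i : ℕ) :
    opX δ f i ∈ 𝒜 (n + 1 - i) := by
  cases i with
  | zero =>
    rw [opX_apply_zero]
    simpa using hδ _ _ (hf 0)
  | succ i =>
    rw [opX_apply_succ]
    refine add_mem ?_ ?_
    · convert hσ _ _ (hf i) using 2
      push_cast
      ring
    · convert hδ _ _ (hf (i + 1)) using 2
      ring

theorem opX_pow_mem {n : ℤ} {f : ℕ →₀ A} (hf : ∀ i : ℕ, f i ∈ 𝒜 (n - i)) (m i : ℕ) :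
    (opX δ ^ m) f i ∈ 𝒜 (n + m - i) := by
  induction m generalizing i with
  | zero => simpa using hf i
  | succ m ih =>
    rw [pow_succ', Module.End.mul_apply]
    convert opX_mem hσ hδ ih i using 2
    push_cast
    ring

include hA

theorem mul_mem_grading {m n : ℤ} {f g : OreExtension δ} (hf : f ∈ grading δ 𝒜 m)
    (hg : g ∈ grading δ 𝒜 n) : f * g ∈ grading δ 𝒜 (m + n) := by
  intro j
  obtain ⟨f, rfl⟩ : ∃ f' : ℕ →₀ A, f' = f := ⟨f, rfl⟩
  obtain ⟨g, rfl⟩ : ∃ g' : ℕ →₀ A, g' = g := ⟨g, rfl⟩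
  change (op δ f g : ℕ →₀ A) j ∈ _
  rw [op_apply_eq_sum, Finsupp.finsetSum_apply]
  refine sum_mem fun i _ => ?_
  change f i * (opX δ ^ i) g j ∈ _
  convert hA.isGraded.gradedMonoid.mul_mem (hf i) (opX_pow_mem hσ hδ hg i j) using 2
  ring

theorem isConnectedGraded_grading : IsConnectedGraded (grading δ 𝒜) where
  isGraded :=
    { gradedMonoid :=
        { one_mem := single_mem_grading hA.isGraded.gradedMonoid.one_mem (by simp)
          mul_mem := fun _ _ _ _ hf hg => mul_mem_grading hA hσ hδ hf hg }
      isInternal := isInternal_of_separating (N := A)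
        -- Degrees are separated by taking the coefficient of `xⁱ` and then its component of degree
        -- `n - i`.
        (fun n (i : ℕ) => gradedProj hA.isGraded.isInternal (n - i) ∘ₗ
          (Finsupp.lapply i : (ℕ →₀ A) →ₗ[k] A))
        (fun m n hmn x hx i => by
          refine (gradedProj_of_mem _ (hx i) _).trans (if_neg ?_)
          lia)
        (fun n x hx h => Finsupp.ext fun i => by
          refine Eq.trans ?_ (h i)
          exact ((gradedProj_of_mem _ (hx i) _).trans (if_pos rfl)).symm)
        (fun x => by
          obtain ⟨x, rfl⟩ : ∃ f' : ℕ →₀ A, f' = x := ⟨x, rfl⟩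
          induction x using Finsupp.induction_linear with
          | zero => exact zero_mem _
          | add f g hf hg => exact add_mem hf hg
          | single i a =>
            refine mem_of_internal (p := fun a => (show OreExtension δ from Finsupp.single i a) ∈
              ⨆ n, grading δ 𝒜 n) hA.isGraded.isInternal ?_ (fun x y hx hy => ?_)
              (fun n x hx => ?_) a
            · rw [Finsupp.single_zero]
              exact zero_mem _
            · rw [Finsupp.single_add]
              exact add_mem hx hy
            · exact Submodule.mem_iSup_of_mem (n + i) (single_mem_grading hx rfl)) }
  neg_eq_bot n hn := by
    refine eq_bot_iff.2 fun x hx => (Submodule.mem_bot k).2 (Finsupp.ext fun i => ?_)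
    have := hx i
    rw [hA.neg_eq_bot _ (by lia), Submodule.mem_bot] at this
    exact this
  nontrivial := by
    have := hA.nontrivial
    exact inferInstanceAs (Nontrivial (ℕ →₀ A))
  zero_eq := by
    have halg : ∀ c : k, algebraMap k (OreExtension δ) c =
        (show OreExtension δ from Finsupp.single 0 (algebraMap k A c)) := by
      intro c
      rw [Algebra.algebraMap_eq_smul_one, Algebra.algebraMap_eq_smul_one]
      exact Finsupp.smul_single _ _ _
    ext x
    constructor
    · intro hx
      have h0 := hx 0
      rw [Nat.cast_zero, sub_zero, hA.zero_eq] at h0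
      obtain ⟨c, hc⟩ := h0
      refine ⟨c, (halg c).trans (Finsupp.ext fun i => ?_)⟩
      cases i with
      | zero => exact (Finsupp.single_eq_same).trans hc
      | succ i =>
        have := hx (i + 1)
        rw [hA.neg_eq_bot _ (by lia), Submodule.mem_bot] at this
        exact (Finsupp.single_eq_of_ne (by lia)).trans this.symm
    · rintro ⟨c, rfl⟩
      rw [Algebra.linearMap_apply, halg]
      refine single_mem_grading (m := 0) ?_ (by simp)
      rw [hA.zero_eq]
      exact ⟨c, rfl⟩

omit hδ in
-- Composing the augmentation with a graded automorphism again kills positive degrees, so uniqueness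
-- applies.
theorem aug_equiv (a : A) : hA.aug (σ a) = hA.aug a :=
  DFunLike.congr_fun (hA.aug_unique (hA.aug.comp σ.toAlgHom) fun n hn x hx =>
    hA.aug_of_mem (by exact_mod_cast hn) (hσ _ _ hx)) a

omit hσ in
-- The derivation raises degrees by one and `A` has no negative part, so its values have no constant
-- term.
theorem aug_derivation (a : A) : hA.aug (δ.toLinearMap a) = 0 := by
  induction a using hA.induction with
  | h0 => rw [map_zero, map_zero]
  | hadd x y hx hy => rw [map_add, map_add, hx, hy, add_zero]
  | hm n x hx => exact hA.aug_of_mem (by lia) (hδ _ _ hx)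

end Grading

/-- The inclusion of the coefficients. -/
def inclC : A →ₐ[k] OreExtension δ where
  toFun a := monomial δ 0 a
  map_one' := rfl
  map_mul' a b := by
    change @Eq (ℕ →₀ A) (Finsupp.single 0 (a * b)) (op δ (Finsupp.single 0 a) (Finsupp.single 0 b))
    rw [op_single, pow_zero, mul_one, opC_single]
  map_zero' := Finsupp.single_zero 0
  map_add' a b := Finsupp.single_add 0 a b
  commutes' c := by
    rw [Algebra.algebraMap_eq_smul_one, Algebra.algebraMap_eq_smul_one]
    exact (Finsupp.smul_single c 0 (1 : A)).symm

/-- The inclusion of the polynomials in `x` with coefficients in `k`. -/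
def inclX : Polynomial k →ₐ[k] OreExtension δ := Polynomial.aeval (monomial δ 1 1)

theorem monomial_one_pow (n : ℕ) : monomial δ 1 1 ^ n = monomial δ n 1 := by
  induction n with
  | zero => rfl
  | succ n ih => rw [pow_succ, ih, monomial_mul_X_pow]

theorem inclX_monomial (n : ℕ) : inclX δ (Polynomial.monomial n 1) = monomial δ n 1 := by
  rw [Polynomial.monomial_one_right_eq_X_pow, inclX, Polynomial.aeval_X_pow, monomial_one_pow]

theorem mulMap_inclC_inclX_bijective : Function.Bijective (mulMap (inclC δ) (inclX δ)) := by
  classical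
  let e : A ⊗[k] Polynomial k ≃ₗ[k] (ℕ →₀ A) :=
    TensorProduct.equivFinsuppOfBasisRight (Polynomial.basisMonomials k)
  refine (Function.Bijective.of_comp_iff _ e.symm.bijective).1 ?_
  have : mulMap (inclC δ) (inclX δ) ∘ₗ e.symm.toLinearMap =
      (LinearMap.id : (ℕ →₀ A) →ₗ[k] (ℕ →₀ A)) := by
    refine Finsupp.lhom_ext fun n a => ?_
    rw [LinearMap.comp_apply, LinearEquiv.coe_coe,
      TensorProduct.equivFinsuppOfBasisRight_symm_apply, Finsupp.sum_single_index (by simp),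
      mulMap_tmul, Polynomial.coe_basisMonomials, inclX_monomial]
    exact (monomial_mul_X_pow δ 0 n a).trans (by rw [zero_add]; rfl)
  exact (congrArg (fun φ : (ℕ →₀ A) →ₗ[k] (ℕ →₀ A) => Function.Bijective φ) this).mpr
    Function.bijective_id

variable (k A) in
/-- The projections of `ℕ →₀ A` to its summands. -/
def coeffProj (n : ℕ) : (ℕ →₀ A) →ₗ[k] (ℕ →₀ A) := Finsupp.lsingle n ∘ₗ Finsupp.lapply n

theorem coeffProj_apply (n : ℕ) (f : ℕ →₀ A) : coeffProj k A n f = Finsupp.single n (f n) := rfl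

/-- This grading records only the power of `x`; it serves the triangularity argument for products
`xⁿ a`. -/
theorem isGrading_coeffProj : IsGrading (coeffProj k A) := by
  intro f
  induction f using Finsupp.induction_linear with
  | zero => exact zero_mem _
  | add f g hf hg => exact add_mem hf hg
  | single n a =>
    refine Submodule.subset_span ⟨n, fun m => ?_⟩
    rw [coeffProj_apply, Finsupp.single_apply]
    split_ifs with h1 h2 h2
    · rw [h1]
    · exact absurd h1.symm h2
    · exact absurd h2.symm h1
    · exact Finsupp.single_zero m

theorem below_coeffProj {n : ℕ} {f : ℕ →₀ A} :
    Below (coeffProj k A) n f ↔ ∀ m, n ≤ m → f m = 0 :=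
  forall₂_congr fun m _ => Finsupp.single_eq_zero

theorem opX_below {n : ℕ} {f : ℕ →₀ A} (hf : Below (coeffProj k A) n f) :
    Below (coeffProj k A) (n + 1) (opX δ f) := by
  rw [below_coeffProj] at hf ⊢
  intro m hm
  obtain ⟨m, rfl⟩ : ∃ l, m = l + 1 := ⟨m - 1, by lia⟩
  rw [opX_apply_succ, hf m (by lia), hf (m + 1) (by lia), map_zero, map_zero, add_zero]

/-- Multiplication by `x` applies `σ` while raising the power, and the term with `δ` leaves the
power unchanged; the leading term of `xⁿ a` is `σⁿ(a) xⁿ`. -/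
theorem opX_pow_single_sub_below (n : ℕ) (a : A) :
    Below (coeffProj k A) n
      ((opX δ ^ n) (Finsupp.single 0 a) - Finsupp.single n ((σ ^ n) a)) := by
  induction n with
  | zero => simpa using Below.zero 0
  | succ n ih =>
    have h1 : (opX δ ^ (n + 1)) (Finsupp.single 0 a) - Finsupp.single (n + 1) ((σ ^ (n + 1)) a) =
        opX δ ((opX δ ^ n) (Finsupp.single 0 a) - Finsupp.single n ((σ ^ n) a)) +
          Finsupp.single n (δ.toLinearMap ((σ ^ n) a)) := by
      rw [map_sub, opX_single, pow_succ', pow_succ', Module.End.mul_apply, AlgEquiv.mul_apply]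
      abel
    rw [h1]
    refine (opX_below δ ih).add (below_coeffProj.2 fun m hm => ?_)
    exact Finsupp.single_eq_of_ne (by lia)

/-- The map `∑ aᵢ xⁱ ↦ ∑ τᵢ(aᵢ) xⁱ`. -/
def diag (τ : ℕ → A ≃ₐ[k] A) : (ℕ →₀ A) →ₗ[k] (ℕ →₀ A) :=
  Finsupp.lsum k fun n => Finsupp.lsingle n ∘ₗ (τ n).toLinearMap

theorem diag_single (τ : ℕ → A ≃ₐ[k] A) (n : ℕ) (a : A) :
    diag τ (Finsupp.single n a) = Finsupp.single n (τ n a) := by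
  rw [diag, Finsupp.lsum_single]
  rfl

theorem diag_comp_diag {τ τ' : ℕ → A ≃ₐ[k] A} (h : ∀ n a, τ n (τ' n a) = a) :
    diag τ ∘ₗ diag τ' = LinearMap.id := by
  refine Finsupp.lhom_ext fun n a => ?_
  rw [LinearMap.comp_apply, diag_single, diag_single, h, LinearMap.id_apply]

theorem diag_bijective (τ : ℕ → A ≃ₐ[k] A) : Function.Bijective (diag τ) :=
  ⟨Function.LeftInverse.injective (g := diag fun n => (τ n).symm) (LinearMap.congr_fun
      (diag_comp_diag (τ := fun n => (τ n).symm) fun n => (τ n).symm_apply_apply)),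
    Function.RightInverse.surjective (g := diag fun n => (τ n).symm) (LinearMap.congr_fun
      (diag_comp_diag (τ' := fun n => (τ n).symm) fun n => (τ n).apply_symm_apply))⟩

/-- The product sends `xⁿ ⊗ a` to `σⁿ(a) xⁿ` plus lower powers. Precomposing with `σ⁻ⁿ` in each
power gives a unitriangular map; this is where invertibility of `σ` enters. -/
theorem mulMap_inclX_inclC_bijective : Function.Bijective (mulMap (inclX δ) (inclC δ)) := by
  classical
  let e : Polynomial k ⊗[k] A ≃ₗ[k] (ℕ →₀ A) :=
    TensorProduct.equivFinsuppOfBasisLeft (Polynomial.basisMonomials k)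
  let S : (ℕ →₀ A) →ₗ[k] (ℕ →₀ A) := diag fun n => (σ ^ n).symm
  let T : (ℕ →₀ A) →ₗ[k] (ℕ →₀ A) := mulMap (inclX δ) (inclC δ) ∘ₗ e.symm.toLinearMap ∘ₗ S
  have hT : ∀ n a, T (Finsupp.single n a) = (opX δ ^ n) (Finsupp.single 0 ((σ ^ n).symm a)) := by
    intro n a
    change mulMap (inclX δ) (inclC δ) (e.symm (S (Finsupp.single n a))) = _
    rw [diag_single, TensorProduct.equivFinsuppOfBasisLeft_symm_apply,
      Finsupp.sum_single_index (by simp), mulMap_tmul, Polynomial.coe_basisMonomials,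
      inclX_monomial]
    change op δ (Finsupp.single n 1) (Finsupp.single 0 _) = _
    rw [op_single, Module.End.mul_apply]
    exact Finsupp.ext fun i => one_mul _
  have hbij : Function.Bijective T := by
    refine bijective_of_sub_below (isGrading_coeffProj (k := k)) T fun n x hx => ?_
    have h1 : x = Finsupp.single n (x n) := by
      have := hx n
      rw [if_pos rfl, coeffProj_apply] at this
      exact this.symm
    rw [h1, hT]
    have := opX_pow_single_sub_below δ n ((σ ^ n).symm (x n))
    rwa [AlgEquiv.apply_symm_apply] at this
  have h2 : Function.Bijective (mulMap (inclX δ) (inclC δ) ∘ (e.symm ∘ S)) := hbij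
  exact (Function.Bijective.of_comp_iff _ (e.symm.bijective.comp (diag_bijective _))).1 h2

/-- The map `∑ aᵢ xⁱ ↦ ∑ ε(aᵢ) xⁱ`. -/
def projXLinear (ε : A →ₐ[k] k) : (ℕ →₀ A) →ₗ[k] Polynomial k :=
  Finsupp.lsum k fun n => Polynomial.monomial n ∘ₗ ε.toLinearMap

theorem projXLinear_single (ε : A →ₐ[k] k) (n : ℕ) (a : A) :
    projXLinear ε (Finsupp.single n a) = Polynomial.monomial n (ε a) := by
  rw [projXLinear, Finsupp.lsum_single]
  rfl

variable {δ}

/-- When `ε` is unchanged by `σ` and kills the values of `δ`, the relation `x a = σ(a) x + δ(a)`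
becomes commutation of `x` with the scalar `ε(a)`. -/
theorem projXLinear_op {ε : A →ₐ[k] k} (hσ : ∀ a, ε (σ a) = ε a)
    (hδ : ∀ a, ε (δ.toLinearMap a) = 0) (f g : ℕ →₀ A) :
    projXLinear ε (op δ f g) = projXLinear ε f * projXLinear ε g := by
  have hC : ∀ (a : A) (g : ℕ →₀ A),
      projXLinear ε (opC k A a g) = Polynomial.C (ε a) * projXLinear ε g := by
    intro a g
    induction g using Finsupp.induction_linear with
    | zero => simp
    | add f g hf hg => simp only [map_add, mul_add, hf, hg]
    | single n b =>
      rw [opC_single, projXLinear_single, projXLinear_single, Polynomial.C_mul_monomial, map_mul]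
  have hX : ∀ g : ℕ →₀ A, projXLinear ε (opX δ g) = Polynomial.X * projXLinear ε g := by
    intro g
    induction g using Finsupp.induction_linear with
    | zero => simp
    | add f g hf hg => simp only [map_add, mul_add, hf, hg]
    | single n b =>
      rw [opX_single, map_add, projXLinear_single, projXLinear_single, projXLinear_single, hσ, hδ,
        map_zero, add_zero, Polynomial.X_mul_monomial]
  have hXpow : ∀ (n : ℕ) (g : ℕ →₀ A),
      projXLinear ε ((opX δ ^ n) g) = Polynomial.X ^ n * projXLinear ε g := by
    intro n g
    induction n with
    | zero => simp
    | succ n ih => rw [pow_succ', Module.End.mul_apply, hX, ih, pow_succ', mul_assoc]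
  induction f using Finsupp.induction_linear with
  | zero => simp
  | add f f' hf hf' => simp only [map_add, LinearMap.add_apply, add_mul, hf, hf']
  | single n a =>
    rw [op_single, Module.End.mul_apply, hC, hXpow, projXLinear_single, ← mul_assoc,
      Polynomial.C_mul_X_pow_eq_monomial]

/-- The projection `A[x; σ, δ] → k[x]` induced by an augmentation of `A` that is compatible with
`σ` and `δ`. -/
def projX (ε : A →ₐ[k] k) (hσ : ∀ a, ε (σ a) = ε a) (hδ : ∀ a, ε (δ.toLinearMap a) = 0) :
    OreExtension δ →ₐ[k] Polynomial k :=
  AlgHom.ofLinearMap (projXLinear ε)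
    ((projXLinear_single ε 0 1).trans (by rw [map_one]; rfl)) (projXLinear_op hσ hδ)

theorem isASRegular {𝒜 : ℤ → Submodule k A} {d : ℕ} (hA : IsASRegular 𝒜 d)
    (hσ : ∀ n : ℤ, ∀ a ∈ 𝒜 n, σ a ∈ 𝒜 n)
    (hδ : ∀ n : ℤ, ∀ a ∈ 𝒜 n, δ.toLinearMap a ∈ 𝒜 (n + 1)) :
    IsASRegular (grading δ 𝒜) (d + 1) := by
  have hσ' := aug_equiv hA.connected hσ
  have hδ' := aug_derivation hA.connected hδ
  have h : IsTwistedTensor (inclC δ) (inclX δ) (projX hA.connected.aug hσ' hδ')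
      hA.connected.aug :=
    { proj_right := fun b => by
        have : (projX hA.connected.aug hσ' hδ').comp (inclX δ) = AlgHom.id k _ := by
          refine Polynomial.algHom_ext ?_
          rw [AlgHom.comp_apply, inclX, Polynomial.aeval_X, AlgHom.id_apply]
          refine (projXLinear_single _ 1 1).trans ?_
          rw [map_one]
          rfl
        exact DFunLike.congr_fun this b
      proj_left := fun a => projXLinear_single _ 0 a
      bijective_left := mulMap_inclC_inclX_bijective δ
      bijective_right := mulMap_inclX_inclC_bijective δ }
  refine h.isASRegular hA (polynomialResolution k)
    (isConnectedGraded_grading hA.connected hσ hδ) fun n hn x hx => ?_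
  -- The composite augmentation evaluates at `x = 0` and then applies the augmentation of `A`, so
  -- only the constant coefficient counts; it has the same degree as the polynomial.
  have hx0 : ∀ f : ℕ →₀ A,
      Polynomial.aeval (0 : k) (projXLinear hA.connected.aug f) = hA.connected.aug (f 0) := by
    intro f
    induction f using Finsupp.induction_linear with
    | zero => simp
    | add f g hf hg => simp only [map_add, Finsupp.add_apply, hf, hg]
    | single m a =>
      rw [projXLinear_single, Polynomial.aeval_monomial]
      cases m <;> simp
  refine (hx0 x).trans (hA.connected.aug_of_mem (n := n) (by exact_mod_cast hn) ?_)
  have := hx 0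
  rwa [Nat.cast_zero, sub_zero] at this

end OreExtension

end OreRegular

end

theorem mainTheorem2 (k : Type u) [Field k] :
    (∀ (H A B : Type u) [Ring H] [HopfAlgebra k H] [Ring A] [Algebra k A] [Ring B] [Algebra k B]
        [Module H A] [IsScalarTower k H A] [IsHopfModuleAlgebra k H A]
        [HopfComoduleAlgebra k H B]
        (ℋ : ℤ → Submodule k H) (𝒜 : ℤ → Submodule k A) (ℬ : ℤ → Submodule k B) (d₁ d₂ : ℕ),
      Function.Bijective (HopfAlgebra.antipode k : H →ₗ[k] H) →
      IsGradedHopfAlgebra ℋ →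
      IsASRegular 𝒜 d₁ →
      IsASRegular ℬ d₂ →
      IsModuleGradedAlgebra ℋ 𝒜 →
      IsComoduleGradedAlgebra ℋ ℬ →
      ((∀ h : H, ∀ a ∈ geOne 𝒜, h • a ∈ geOne 𝒜) ∨
        (∀ b ∈ geOne ℬ, (HopfComoduleAlgebra.coaction b : TensorProduct k H B) ∈
          LinearMap.range (LinearMap.lTensor H (geOne ℬ).subtype))) →
      IsASRegular (TakeuchiSmash.grading (H := H) 𝒜 ℬ) (d₁ + d₂)) ∧
    (∀ (A : Type u) [Ring A] [Algebra k A] (𝒜 : ℤ → Submodule k A) (d : ℕ)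
        (σ : A ≃ₐ[k] A) (δ : SkewDerivation σ),
      IsASRegular 𝒜 d →
      (∀ n : ℤ, ∀ a ∈ 𝒜 n, σ a ∈ 𝒜 n) →
      (∀ n : ℤ, ∀ a ∈ 𝒜 n, δ.toLinearMap a ∈ 𝒜 (n + 1)) →
      IsASRegular (OreExtension.grading δ 𝒜) (d + 1)) := by
  exact ⟨fun H A B _ _ _ _ _ _ _ _ _ _ ℋ 𝒜 ℬ d₁ d₂ hS _ hA hB h𝒜 hℬ hstable =>
      TakeuchiSmash.isASRegular hS hA hB h𝒜 hℬ hstable,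
    fun A _ _ 𝒜 d σ δ hA hσ hδ => OreExtension.isASRegular hA hσ hδ⟩
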